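/- **Setting.** All operators are on $\mathbb R^n$ and indices are summed. A homogeneous linear bond-based peridynamic material is given by a density $\rho>0$, a measurable weight $\boldsymbol\alpha(\mathbf x,\mathbf x')=-\boldsymbol\alpha(\mathbf x',\mathbf x)\in\mathbb R^n$ and an elasticity tensor $\boldsymbol\Theta(\mathbf x,\mathbf x')=\boldsymbol\Theta(\mathbf x',\mathbf x)$ with $\Theta_{ijkl}=\Theta_{jikl}=\Theta_{ijlk}=\Theta_{klij}$, both invariant under simultaneous translation of $\mathbf x,\mathbf x'$, such that the micromodulus $\kappa_{ik}(\boldsymbol\xi)=\Theta_{ijkl}(0,\boldsymbol\xi)\alpha_j(0,\boldsymbol\xi)\alpha_l(0,\boldsymbol\xi)$ is integrable. Put $\mathcal H_{\mathbf x}=\{\mathbf x':\boldsymbol\alpha(\mathbf x,\mathbf x')\ne 0\}$ and $$\mathcal D^*(\mathbf w)(\mathbf x,\mathbf x')=-[\mathbf w(\mathbf x')-\mathbf w(\mathbf x)]\otimes\boldsymbol\alpha(\mathbf x,\mathbf x'),\qquad \mathcal D(\boldsymbol\Psi)(\mathbf x)=\int_{\mathbb R^n}[\boldsymbol\Psi(\mathbf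 x,\mathbf x')+\boldsymbol\Psi(\mathbf x',\mathbf x)]\cdot\boldsymbol\alpha(\mathbf x,\mathbf x')\,dV_{\mathbf x'}.$$ Let $\Omega$ be compact (containing its boundary), $\Omega_\tau=\{\mathbf x'\notin\Omega:\mathbf x'\in\mathcal H_{\mathbf x}\text{ for some }\mathbf x\in\Omega\}=\Omega_{\tau_d}\sqcup\Omega_{\tau_n}$ with measurable parts, and $$\mathcal N(\boldsymbol\Psi)(\mathbf x)=-\int_{\Omega\cup\Omega_\tau}[\boldsymbol\Psi(\mathbf x,\mathbf x')+\boldsymbol\Psi(\mathbf x',\mathbf x)]\cdot\boldsymbol\alpha(\mathbf x,\mathbf x')\,dV_{\mathbf x'}.$$ Assume that $\partial\Omega_d=\overline{\Omega_{\tau_d}}\cap\Omega$ and $\partial\Omega_n=\overline{\Omega_{\tau_n}}\cap\Omega$ make up $\partial\Omega$ and overlap only in a set of surface measure zero (surface measure: the normalized $(n-1)$-dimensional Hausdorff measure), and that $\partial\Omega$ has a measurable outer unit normal $\mathbf n$ almost everywhere. With a measurable even weight $\omega$, for which $\mathbf K=\int_{\mathcal H_{\mathbf x}}\omega\langle\boldsymbol\xi\rangle\,\boldsymbol\xi\otimes\boldsymbol\xi\,dV_{\boldsymbol\xi}$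 ($\boldsymbol\xi=\mathbf x'-\mathbf x$) is invertible, and a constant tensor $\mathcal C$, the nonlocal surface traction is $$\mathbf T(\mathbf w)=\tfrac12\,\mathbf n\cdot\mathcal C:(\mathbf G^{T}+\mathbf G),\qquad \mathbf G=\Big[\int_{\mathcal H_{\mathbf x}}\omega\langle\boldsymbol\xi\rangle(\mathbf w(\mathbf x+\boldsymbol\xi)-\mathbf w(\mathbf x))\otimes\boldsymbol\xi\,dV_{\boldsymbol\xi}\Big]\mathbf K^{-1}.$$ **Motion.** Let $\mathbf u(\mathbf x,t)$ be jointly measurable, differentiable in time on $[0,\infty)$ at each $\mathbf x\in\Omega$ with $\dot{\mathbf u}$ right-continuous at $t=0$, and satisfy $\mathcal D(\boldsymbol\Theta:\mathcal D^*(\mathbf u))+\mathbf b=\rho\ddot{\mathbf u}$ on $\Omega$ for $t>0$, $\mathbf u=\mathbf g_d$ on $\Omega_{\tau_d}$ and $\mathcal N(\boldsymbol\Theta:\mathcal D^*(\mathbf u))=\mathbf g_n$ on $\Omega_{\tau_n}$ for $t\ge0$, with $\mathbf u(\mathbf x,0)=\mathbf u_0$, $\dot{\mathbf u}(\mathbf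 x,0)=\dot{\mathbf u}_0$ on $\Omega$. Let $\operatorname{Re}s>0$, $|\mathbf u(\mathbf x,t)|\le Ke^{\sigma t}$ on $\Omega\cup\Omega_\tau$ with $\sigma<\operatorname{Re}s$, and let $e^{-st}\mathbf b(\mathbf x,t)$ be integrable over $t>0$ for each $\mathbf x\in\Omega$. Write $\tilde{\mathbf u}(\mathbf x,s)=\int_0^\infty\mathbf u(\mathbf x,t)e^{-st}dt$, $\tilde{\mathbf T}=\mathbf T(\tilde{\mathbf u})$ and $$\tilde{\mathbf F}(\mathbf x,s)=\tilde{\mathbf b}(\mathbf x,s)+\rho s\,\mathbf u(\mathbf x,0)+\rho\,\dot{\mathbf u}(\mathbf x,0).$$ **Fundamental solution.** For $k=1,\dots,n$ let $\tilde{\mathbf u}_g^k=\mathbf c_k\delta+\mathbf g_k$, with $\mathbf c_k\in\mathbb C^n$ and $\mathbf g_k$ an integrable function, solve $-\mathcal D(\boldsymbol\Theta:\mathcal D^*(\tilde{\mathbf u}_g^k))+\rho s^2\tilde{\mathbf u}_g^k=\delta\,\mathbf e_k$ on $\mathbb R^n$, the function parts being equal at every point other than the origin; $\tilde{\mathbf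 T}_g^k(\cdot-\mathbf x)=\mathbf T(\tilde{\mathbf u}_g^k(\cdot-\mathbf x))$. The operators act on point masses by linearity. In integrals over $\Omega$ the mass $\delta(\mathbf x'-\mathbf x)$ counts fully for every $\mathbf x\in\Omega$, including $\mathbf x\in\partial\Omega$; it does not contribute to integrals over $\partial\Omega$. **Equivalency condition.** For every $k$ and every $\mathbf x_0$ in the interior of $\Omega$, $$\int_{\Omega_\tau}\mathbf v_p\cdot\mathcal N(\boldsymbol\Theta:\mathcal D^*(\mathbf v))\,dV=\int_{\partial\Omega}\mathbf v_p\cdot\mathbf T(\mathbf v)\,dS$$ holds, with convergent integrals, for $(\mathbf v_p,\mathbf v)=(\tilde{\mathbf u}_g^k(\cdot-\mathbf x_0),\tilde{\mathbf u})$ and for $(\mathbf v_p,\mathbf v)=(\tilde{\mathbf u},\tilde{\mathbf u}_g^k(\cdot-\mathbf x_0))$. **Claim.** 1. $\mathcal D(\boldsymbol\Theta:\mathcal D^*(\tilde{\mathbf u}))+\tilde{\mathbf F}=\rho s^2\tilde{\mathbf u}$ on $\Omega$. 2. (Somigliana formula.) For every $\mathbf x$ in the interior of $\Omega$ and every $k$,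 with convergent integrals, $$\begin{aligned}\tilde u_k(\mathbf x,s)=&\int_{\partial\Omega_d}\big(\tilde{\mathbf T}(\mathbf x',s)\cdot\tilde{\mathbf u}_g^k(\mathbf x'-\mathbf x,s)-\tilde{\mathbf T}_g^k(\mathbf x'-\mathbf x,s)\cdot\tilde{\mathbf u}(\mathbf x',s)\big)dS_{\mathbf x'}\\&+\int_{\partial\Omega_n}\big(\tilde{\mathbf u}_g^k(\mathbf x'-\mathbf x,s)\cdot\tilde{\mathbf T}(\mathbf x',s)-\tilde{\mathbf u}(\mathbf x',s)\cdot\tilde{\mathbf T}_g^k(\mathbf x'-\mathbf x,s)\big)dS_{\mathbf x'}\\&+\int_\Omega\tilde{\mathbf F}(\mathbf x',s)\cdot\tilde{\mathbf u}_g^k(\mathbf x'-\mathbf x,s)\,dV_{\mathbf x'}.\end{aligned}$$ 3. (Boundary integral equation.) Suppose moreover that $n\ge2$; $\Omega$ is the closure of its interior; $\mathbf u(\cdot,t)$ is continuous on $\Omega$ for each $t\ge0$; balls of radius $r$ carry surface measure at most $c\,r^{n-1}$ of $\partial\Omega$; $|\kappa_{ik}(\boldsymbol\xi)|\le c(1+|\boldsymbol\xi|^{-\gamma})$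 with some $0\le\gamma<n-1$; $\mathbf W(\boldsymbol\xi)=\omega\langle\boldsymbol\xi\rangle\boldsymbol\xi\,1_{\mathcal H_0}(\boldsymbol\xi)$ is bounded and integrable; and for each $\mathbf x\in\partial\Omega$ the functions $\kappa$ and $\mathbf W$ are continuous at $\mathbf x'-\mathbf x$ for almost every $\mathbf x'\in\partial\Omega$. Then for every $\mathbf x\in\partial\Omega$ and every $k$ the same formula holds with the two boundary integrals taken as Cauchy principal values (which exist), and also with ordinary, convergent integrals. -/

import Mathlib

open MeasureTheory Set Filter Topology

noncomputable section

namespace Peridynamics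

/-- Points of `n`-dimensional Euclidean space. -/
abbrev Pt (n : ℕ) := EuclideanSpace ℝ (Fin n)

/-! ### Nonlocal vector calculus

Displacements take values in `Fin n → V`, where `V = ℝ` (time domain) or `V = ℂ` (Laplace domain).
All integral operators carry the measure of integration `m` explicitly: `m` is Lebesgue measure for
an ordinary field, and a Dirac measure when the contribution of a point mass is computed. -/

section Operators

variable {n : ℕ} {V : Type*} [NormedAddCommGroup V] [NormedSpace ℝ V]

/-- The family of `x`: all points that interact with `x`. -/
def family (α : Pt n → Pt n → Fin n → ℝ) (x : Pt n) : Set (Pt n) := {x' | α x x' ≠ 0}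

/-- The volume-constrained boundary of `Ω`: the points outside `Ω` interacting with `Ω`. -/
def collar (α : Pt n → Pt n → Fin n → ℝ) (Ω : Set (Pt n)) : Set (Pt n) :=
  {x' | x' ∉ Ω ∧ ∃ x ∈ Ω, x' ∈ family α x}

/-- `𝒟*(w)(x,x') = -(w(x') - w(x)) ⊗ α(x,x')`. -/
def Dstar (α : Pt n → Pt n → Fin n → ℝ) (w : Pt n → Fin n → V) (x x' : Pt n) (k l : Fin n) : V :=
  -(α x x' l • (w x' k - w x k))

/-- `(Θ : G)(x,x')_{ij} = ∑_{kl} Θ_{ijkl}(x,x') G_{kl}(x,x')`. -/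
def ddot (Θ : Pt n → Pt n → Fin n → Fin n → Fin n → Fin n → ℝ)
    (G : Pt n → Pt n → Fin n → Fin n → V) (x x' : Pt n) (i j : Fin n) : V :=
  ∑ k, ∑ l, Θ x x' i j k l • G x x' k l

/-- `𝒟(Ψ)(x) = ∫ [Ψ(x,x') + Ψ(x',x)] · α(x,x') dm(x')`. -/
def Dop (m : Measure (Pt n)) (α : Pt n → Pt n → Fin n → ℝ)
    (Ψ : Pt n → Pt n → Fin n → Fin n → V) (x : Pt n) (i : Fin n) : V :=
  ∫ x', ∑ j, α x x' j • (Ψ x x' i j + Ψ x' x i j) ∂m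

/-- `𝒩(Ψ)(x) = -∫_Y [Ψ(x,x') + Ψ(x',x)] · α(x,x') dm(x')`, used with `Y = Ω ∪ Ω_τ`. -/
def Nop (m : Measure (Pt n)) (α : Pt n → Pt n → Fin n → ℝ) (Y : Set (Pt n))
    (Ψ : Pt n → Pt n → Fin n → Fin n → V) (x : Pt n) (i : Fin n) : V :=
  -∫ x' in Y, ∑ j, α x x' j • (Ψ x x' i j + Ψ x' x i j) ∂m

/-- The shape tensor `K(x) = ∫_{H_x} ω⟨ξ⟩ ξ ⊗ ξ dξ`, with `ξ = x' - x`. -/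
def shapeTensor (α : Pt n → Pt n → Fin n → ℝ) (ω : Pt n → ℝ) (x : Pt n) :
    Matrix (Fin n) (Fin n) ℝ :=
  Matrix.of fun p q => ∫ x' in family α x, ω (x' - x) * ((x' - x) p * (x' - x) q)

/-- The nonlocal displacement gradient
`[∫_{H_x} ω⟨ξ⟩ (w(x+ξ) - w(x)) ⊗ ξ dm] · K(x)⁻¹`. It equals `F - I`, where `F` is the nonlocal
deformation gradient of the deformation `x ↦ x + w(x)`. -/
def nonlocalGrad (m : Measure (Pt n)) (α : Pt n → Pt n → Fin n → ℝ) (ω : Pt n → ℝ)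
    (w : Pt n → Fin n → V) (x : Pt n) (p q : Fin n) : V :=
  ∑ r, (shapeTensor α ω x)⁻¹ r q •
    ∫ x' in family α x, (ω (x' - x) * (x' - x) r) • (w x' p - w x p) ∂m

/-- The surface traction `½ ν · C : (Gᵀ + G)` of a displacement gradient `G`. -/
def traction (C : Fin n → Fin n → Fin n → Fin n → ℝ) (ν : Pt n) (G : Fin n → Fin n → V)
    (j : Fin n) : V :=
  (1 / 2 : ℝ) • ∑ l, ∑ p, ∑ q, (ν l * C l j p q) • (G q p + G p q)

end Operators

/-- The micromodulus `κ_{ik}(x,x') = ∑_{jl} Θ_{ijkl}(x,x') α_j(x,x') α_l(x,x')`, so that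
`𝒟(Θ : 𝒟*(u))(x) = -2 ∫ κ(x,x') (u(x') - u(x)) dx'`. -/
def micromodulus {n : ℕ} (α : Pt n → Pt n → Fin n → ℝ)
    (Θ : Pt n → Pt n → Fin n → Fin n → Fin n → Fin n → ℝ) (x x' : Pt n) (i k : Fin n) : ℝ :=
  ∑ j, ∑ l, Θ x x' i j k l * (α x x' j * α x x' l)

/-- A homogeneous linear elastic bond-based peridynamic material. -/
structure Material (n : ℕ) where
  /-- nonlocal weight -/
  α : Pt n → Pt n → Fin n → ℝ
  /-- bond elasticity tensor -/
  Θ : Pt n → Pt n → Fin n → Fin n → Fin n → Fin n → ℝ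
  /-- weight function of the nonlocal deformation gradient -/
  ω : Pt n → ℝ
  /-- elasticity tensor in the definition of the surface traction -/
  C : Fin n → Fin n → Fin n → Fin n → ℝ
  /-- mass density -/
  ρ : ℝ
  α_antisymm : ∀ x x', α x x' = -α x' x
  α_transl : ∀ x x' z, α (x + z) (x' + z) = α x x'
  α_measurable : Measurable (α 0)
  Θ_symm : ∀ x x', Θ x x' = Θ x' x
  Θ_minor₁ : ∀ x x' i j k l, Θ x x' i j k l = Θ x x' j i k l
  Θ_minor₂ : ∀ x x' i j k l, Θ x x' i j k l = Θ x x' i j l k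
  Θ_major : ∀ x x' i j k l, Θ x x' i j k l = Θ x x' k l i j
  Θ_transl : ∀ x x' z, Θ (x + z) (x' + z) = Θ x x'
  micromodulus_integrable : ∀ i k, Integrable fun ξ => micromodulus α Θ 0 ξ i k
  ω_measurable : Measurable ω
  ω_even : ∀ ξ, ω (-ξ) = ω ξ
  shape_invertible : ∀ x, IsUnit (shapeTensor α ω x).det
  ρ_pos : 0 < ρ

namespace Material

variable {n : ℕ} (M : Material n)

/-- The internal force operator `𝒟(Θ : 𝒟*(w))`. -/
def force {V : Type*} [NormedAddCommGroup V] [NormedSpace ℝ V]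
    (w : Pt n → Fin n → V) : Pt n → Fin n → V :=
  Dop volume M.α (ddot M.Θ (Dstar M.α w))

/-- The interaction operator `𝒩(Θ : 𝒟*(w))` of the body `Ω`. -/
def interaction {V : Type*} [NormedAddCommGroup V] [NormedSpace ℝ V]
    (Ω : Set (Pt n)) (w : Pt n → Fin n → V) : Pt n → Fin n → V :=
  Nop volume M.α (Ω ∪ collar M.α Ω) (ddot M.Θ (Dstar M.α w))

/-- The surface traction `T(w)` with respect to a normal field `ν`. -/
def T {V : Type*} [NormedAddCommGroup V] [NormedSpace ℝ V]
    (ν : Pt n → Pt n) (w : Pt n → Fin n → V) (x : Pt n) : Fin n → V :=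
  traction M.C (ν x) (nonlocalGrad volume M.α M.ω w x)

end Material

/-! ### Fields with a point mass, and the fundamental solution -/

/-- A generalized displacement field `reg(x) + δ(x - pole) coeff`: a Dirac mass plus a function. -/
structure DiracField (n : ℕ) where
  pole : Pt n
  coeff : Fin n → ℂ
  reg : Pt n → Fin n → ℂ

namespace DiracField

variable {n : ℕ} (v : DiracField n)

/-- The translated field `x ↦ v(x - x₀)`. -/
def shift (x₀ : Pt n) : DiracField n where
  pole := v.pole + x₀
  coeff := v.coeff
  reg := fun x => v.reg (x - x₀)

open scoped Classical in
/-- The function equal to `coeff` at the pole and to `0` elsewhere. Integrating a bond integrand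
built from it against the Dirac measure at the pole gives the contribution of the point mass. -/
def bump : Pt n → Fin n → ℂ := fun x => if x = v.pole then v.coeff else 0

variable (M : Material n)

/-- `𝒟(Θ : 𝒟*(v))` is again a Dirac mass at the pole plus a function. This is the function, valid
off the pole. -/
def force (x : Pt n) (i : Fin n) : ℂ :=
  M.force v.reg x i + Dop (Measure.dirac v.pole) M.α (ddot M.Θ (Dstar M.α v.bump)) x i

/-- The coefficient of the Dirac mass of `𝒟(Θ : 𝒟*(v))`: it comes from the term `-w(x)` in the
differences `w(x') - w(x)`, evaluated at `x = pole`. -/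
def forceCoeff : Fin n → ℂ := M.force v.bump v.pole

/-- `𝒩(Θ : 𝒟*(v))` off the pole. -/
def interaction (Ω : Set (Pt n)) (x : Pt n) (i : Fin n) : ℂ :=
  M.interaction Ω v.reg x i +
    Nop (Measure.dirac v.pole) M.α (Ω ∪ collar M.α Ω) (ddot M.Θ (Dstar M.α v.bump)) x i

/-- The surface traction `T(v)` off the pole. -/
def T (ν : Pt n → Pt n) (x : Pt n) : Fin n → ℂ :=
  traction M.C (ν x) fun p q =>
    nonlocalGrad volume M.α M.ω v.reg x p q +
      nonlocalGrad (Measure.dirac v.pole) M.α M.ω v.bump x p q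

open scoped Classical in
/-- `∫_A F · v`: the Dirac mass counts fully if its pole belongs to `A`. -/
def pairing (A : Set (Pt n)) (F : Pt n → Fin n → ℂ) : ℂ :=
  (∫ x in A, F x ⬝ᵥ v.reg x) + if v.pole ∈ A then F v.pole ⬝ᵥ v.coeff else 0

end DiracField

/-- `v` is the Laplace-domain fundamental solution of the infinitely extended material for a unit
point force at the origin in direction `e_k`:
`-𝒟(Θ : 𝒟*(v)) + ρ s² v = δ e_k` on the whole space. The Dirac masses and the functions on both
sides are equated separately; off the pole the equation holds at every point. -/
structure IsFundamentalSolution {n : ℕ} (M : Material n) (s : ℂ) (k : Fin n)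
    (v : DiracField n) : Prop where
  pole_eq : v.pole = 0
  integrable : Integrable v.reg
  at_pole : ∀ i, -v.forceCoeff M i + M.ρ * s ^ 2 * v.coeff i = if i = k then 1 else 0
  off_pole : ∀ x, x ≠ 0 → ∀ i, -v.force M x i + M.ρ * s ^ 2 * v.reg x i = 0

/-! ### The body -/

/-- `e` is the outer unit normal of `Ω` at `x`: near `x`, every double cone around the hyperplane
orthogonal to `e` separates `Ω` from its complement. -/
def IsOuterUnitNormal {n : ℕ} (Ω : Set (Pt n)) (x e : Pt n) : Prop :=
  ‖e‖ = 1 ∧ ∀ ε > 0, ∃ r > 0, ∀ y ∈ Metric.ball x r, y ≠ x →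
    (ε * ‖y - x‖ ≤ inner ℝ (y - x) e → y ∉ Ω) ∧ (inner ℝ (y - x) e ≤ -(ε * ‖y - x‖) → y ∈ Ω)

/-- The surface measure on the local boundary `∂Ω`. -/
def surface {n : ℕ} (Ω : Set (Pt n)) : Measure (Pt n) :=
  (Measure.euclideanHausdorffMeasure (n - 1)).restrict (frontier Ω)

/-- The part of the local boundary adjacent to a part `A` of the volume-constrained boundary. -/
def localBoundary {n : ℕ} (Ω A : Set (Pt n)) : Set (Pt n) := closure A ∩ Ω

/-- A body `Ω` (containing its boundary), the displacement part `Ωd` and the force part `Ωn` of its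
volume-constrained boundary, and its outer unit normal field `ν`. The corresponding parts
`localBoundary Ω Ωd` and `localBoundary Ω Ωn` make up the local boundary `∂Ω`. -/
structure IsBody {n : ℕ} (α : Pt n → Pt n → Fin n → ℝ) (Ω Ωd Ωn : Set (Pt n))
    (ν : Pt n → Pt n) : Prop where
  compact : IsCompact Ω
  measurable_d : MeasurableSet Ωd
  measurable_n : MeasurableSet Ωn
  union : Ωd ∪ Ωn = collar α Ω
  disjoint : Disjoint Ωd Ωn
  frontier_eq : frontier Ω = localBoundary Ω Ωd ∪ localBoundary Ω Ωn
  overlap : surface Ω (localBoundary Ω Ωd ∩ localBoundary Ω Ωn) = 0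
  measurable_normal : Measurable ν
  normal : ∀ᵐ x ∂surface Ω, IsOuterUnitNormal Ω x (ν x)

/-! ### The motion and its Laplace transform -/

/-- `u` is a motion of the body with velocity `v`, body force density `b`, volume constraints `gd`,
`gn` and initial data `u₀`, `v₀`. -/
structure IsMotion {n : ℕ} (M : Material n) (Ω Ωd Ωn : Set (Pt n))
    (u v b gd gn : Pt n → ℝ → Fin n → ℝ) (u₀ v₀ : Pt n → Fin n → ℝ) : Prop where
  velocity : ∀ x ∈ Ω, ∀ t, 0 ≤ t → HasDerivWithinAt (u x) (v x t) (Ici 0) t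
  velocity_zero : ∀ x ∈ Ω, ContinuousWithinAt (v x) (Ici 0) 0
  motion : ∀ x ∈ Ω, ∀ t, 0 < t → ∃ a, HasDerivAt (v x) a t ∧
    M.force (fun y => u y t) x + b x t = M.ρ • a
  displacement : ∀ x ∈ Ωd, ∀ t, 0 ≤ t → u x t = gd x t
  force : ∀ x ∈ Ωn, ∀ t, 0 ≤ t → M.interaction Ω (fun y => u y t) x = gn x t
  initial_displacement : ∀ x ∈ Ω, u x 0 = u₀ x
  initial_velocity : ∀ x ∈ Ω, v x 0 = v₀ x

/-- The componentwise Laplace transform `∫₀^∞ f(x,t) e^{-st} dt`. -/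
def laplace {n : ℕ} (f : Pt n → ℝ → Fin n → ℝ) (s : ℂ) (x : Pt n) (i : Fin n) : ℂ :=
  ∫ t in Ioi (0 : ℝ), Complex.exp (-(s * t)) * (f x t i : ℂ)

/-- The effective body force `b̃ + ρ s u₀ + ρ v₀`. -/
def effectiveForce {n : ℕ} (ρ : ℝ) (b : Pt n → ℝ → Fin n → ℝ) (u₀ v₀ : Pt n → Fin n → ℝ)
    (s : ℂ) (x : Pt n) (i : Fin n) : ℂ :=
  laplace b s x i + ρ * s * u₀ x i + ρ * v₀ x i

/-- The equivalency condition (virtual work): the work of the volume-constraint force `N` of an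
actual state on the possible displacement `vp` over the volume-constrained boundary `Ωτ` equals the
work of the surface traction `T` of the actual state on `vp` over the local boundary `∂Ω`. -/
def Equivalency {n : ℕ} (Ω Ωτ : Set (Pt n)) (vp N T : Pt n → Fin n → ℂ) : Prop :=
  IntegrableOn (fun x => vp x ⬝ᵥ N x) Ωτ ∧ Integrable (fun x => vp x ⬝ᵥ T x) (surface Ω) ∧
    ∫ x in Ωτ, vp x ⬝ᵥ N x = ∫ x, vp x ⬝ᵥ T x ∂surface Ω

/-! ### Boundary integrals -/

/-- The boundary integrand `T̃(x') · v(x') - T(v)(x') · ũ(x')` for a displacement field `w = ũ` and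
a field `v` with a point mass (which does not enter off the pole). -/
def boundaryIntegrand {n : ℕ} (M : Material n) (ν : Pt n → Pt n) (w : Pt n → Fin n → ℂ)
    (v : DiracField n) (x' : Pt n) : ℂ :=
  M.T ν w x' ⬝ᵥ v.reg x' - v.T M ν x' ⬝ᵥ w x'

/-- `I` is the Cauchy principal value of `∫_A f dμ` with respect to the point `x`. -/
def HasPV {n : ℕ} (μ : Measure (Pt n)) (A : Set (Pt n)) (f : Pt n → ℂ) (x : Pt n) (I : ℂ) : Prop :=
  (∀ ε > 0, IntegrableOn f (A \ Metric.ball x ε) μ) ∧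
    Tendsto (fun ε : ℝ => ∫ x' in A \ Metric.ball x ε, f x' ∂μ) (𝓝[>] 0) (𝓝 I)

open scoped Classical in
/-- `ω⟨ξ⟩ ξ`, restricted to the family of the origin. -/
def weightVector {n : ℕ} (M : Material n) (ξ : Pt n) : Pt n :=
  if ξ ∈ family M.α 0 then M.ω ξ • ξ else 0

/-- The Somigliana formula at the pole `x` of `v` for component `k`: all integrals converge and
`w_k(x) = ∫_{∂Ω_d} (…) + ∫_{∂Ω_n} (…) + ∫_Ω F · v`. -/
def SomiglianaFormula {n : ℕ} (M : Material n) (Ω Ωd Ωn : Set (Pt n)) (ν : Pt n → Pt n)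
    (w F : Pt n → Fin n → ℂ) (v : DiracField n) (x : Pt n) (k : Fin n) : Prop :=
  IntegrableOn (boundaryIntegrand M ν w v) (localBoundary Ω Ωd) (surface Ω) ∧
  IntegrableOn (boundaryIntegrand M ν w v) (localBoundary Ω Ωn) (surface Ω) ∧
  IntegrableOn (fun x' => F x' ⬝ᵥ v.reg x') Ω ∧
  w x k = (∫ x' in localBoundary Ω Ωd, boundaryIntegrand M ν w v x' ∂surface Ω) +
    (∫ x' in localBoundary Ω Ωn, boundaryIntegrand M ν w v x' ∂surface Ω) + v.pairing Ω F

/-- The boundary integral equation at the pole `x` of `v` for component `k`: the same formula with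
Cauchy principal values of the two boundary integrals, which exist. -/
def BoundaryIntegralEquation {n : ℕ} (M : Material n) (Ω Ωd Ωn : Set (Pt n)) (ν : Pt n → Pt n)
    (w F : Pt n → Fin n → ℂ) (v : DiracField n) (x : Pt n) (k : Fin n) : Prop :=
  IntegrableOn (fun x' => F x' ⬝ᵥ v.reg x') Ω ∧
  ∃ Id In : ℂ,
    HasPV (surface Ω) (localBoundary Ω Ωd) (boundaryIntegrand M ν w v) x Id ∧
    HasPV (surface Ω) (localBoundary Ω Ωn) (boundaryIntegrand M ν w v) x In ∧
    w x k = Id + In + v.pairing Ω F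

/-- Regularity for the passage to the boundary: dimension at least two, `Ω` is the closure of its
interior, `∂Ω` is upper Ahlfors regular, the micromodulus is at most weakly singular with respect
to surface integration, the vector weight `ω⟨ξ⟩ ξ` is bounded and integrable, and the jumps of these
two kernels meet `∂Ω` in surface-null sets only. -/
structure IsBoundaryRegular {n : ℕ} (M : Material n) (Ω : Set (Pt n)) : Prop where
  two_le : 2 ≤ n
  regular_closed : Ω ⊆ closure (interior Ω)
  ahlfors : ∃ c : ℝ, ∀ (y : Pt n) (r : ℝ), 0 < r →
    surface Ω (Metric.ball y r) ≤ ENNReal.ofReal (c * r ^ (n - 1))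
  weakly_singular : ∃ c γ : ℝ, 0 ≤ γ ∧ γ < (n : ℝ) - 1 ∧ ∀ ξ i k,
    |micromodulus M.α M.Θ 0 ξ i k| ≤ c * (1 + ‖ξ‖ ^ (-γ))
  weight_bounded : ∃ c : ℝ, ∀ ξ, ‖weightVector M ξ‖ ≤ c
  weight_integrable : Integrable (weightVector M)
  continuous_micromodulus : ∀ x ∈ frontier Ω, ∀ᵐ x' ∂surface Ω,
    ContinuousAt (micromodulus M.α M.Θ 0) (x' - x)
  continuous_weight : ∀ x ∈ frontier Ω, ∀ᵐ x' ∂surface Ω, ContinuousAt (weightVector M) (x' - x)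

end Peridynamics

end

open Peridynamics

noncomputable section

namespace Peridynamics

/-! All operators of the material are governed by one kernel, the micromodulus `kernel`. It is even,
symmetric in its indices and integrable, and a point of `Ω` has no bonds leaving `Ω ∪ collar M.α Ω`.
So the force on `Ω` is minus the interaction operator.

In time, Fubini carries the Laplace transform through the force, and `laplace_second_deriv` turns
the acceleration into `s²ũ - s u(0) - u̇(0)`. No growth bound on the velocity is needed: the
boundary term at infinity has a limit, and that limit must be zero.

In space, the bond work form is symmetric, which is Green's identity `Material.green`. It is applied
to `ũ` and the function part of the fundamental solution. The point mass contributes the value of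
the effective force at the pole and bond terms proportional to the micromodulus; in
`IsFundamentalSolution.reciprocity` these combine to isolate `ũ_k` at the pole. The equivalency
condition then replaces the collar integrals by surface integrals, giving the formula at interior
points.

At a boundary point, interior poles tend to it. The volume term is continuous in the pole. For the
surface term, the function part of the fundamental solution solves an integral equation of the
second kind (`reg_eq_potential`), and an absorption argument (`singular_bound_of_le_potential`)
bounds it by a multiple of `1 + |y|^{-γ}`. Since `γ < n - 1`, such bounds are uniformly integrable
on the surface whatever the pole, and Vitali's theorem gives the limit
(`tendsto_integral_of_singular_bound`). No jump term appears, and the principal values are ordinary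
integrals. -/

open scoped ENNReal

/-! ### Operators as integrals against the micromodulus. -/

namespace Material

variable {n : ℕ} (M : Material n)

/-- The micromodulus as a convolution kernel. -/
def kernel (ξ : Pt n) (i k : Fin n) : ℝ := micromodulus M.α M.Θ 0 ξ i k

lemma α_eq (x x' : Pt n) : M.α x x' = M.α 0 (x' - x) := by
  have h := M.α_transl 0 (x' - x) x
  simpa using h

lemma Θ_eq (x x' : Pt n) : M.Θ x x' = M.Θ 0 (x' - x) := by
  have h := M.Θ_transl 0 (x' - x) x
  simpa using h

lemma α_zero_neg (ξ : Pt n) : M.α 0 (-ξ) = -M.α 0 ξ := by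
  rw [M.α_antisymm 0 ξ, M.α_eq ξ 0, zero_sub, neg_neg]

lemma Θ_zero_neg (ξ : Pt n) : M.Θ 0 (-ξ) = M.Θ 0 ξ := by
  rw [M.Θ_symm 0 ξ, M.Θ_eq ξ 0, zero_sub]

lemma kernel_neg (ξ : Pt n) : M.kernel (-ξ) = M.kernel ξ := by
  ext i k
  simp [kernel, micromodulus, M.α_zero_neg, M.Θ_zero_neg]

lemma kernel_symm (ξ : Pt n) (i k : Fin n) : M.kernel ξ i k = M.kernel ξ k i := by
  unfold kernel micromodulus
  rw [Finset.sum_comm]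
  refine Finset.sum_congr rfl fun j _ => Finset.sum_congr rfl fun l _ => ?_
  rw [M.Θ_major 0 ξ i l k j]
  ring

lemma kernel_integrable (i k : Fin n) : Integrable fun ξ => M.kernel ξ i k :=
  M.micromodulus_integrable i k

lemma kernel_eq_zero {ξ : Pt n} (h : ξ ∉ family M.α 0) (i k : Fin n) : M.kernel ξ i k = 0 := by
  have h0 : M.α 0 ξ = 0 := by simpa [family] using h
  simp [kernel, micromodulus, h0]

lemma mem_family_iff (x x' : Pt n) : x' ∈ family M.α x ↔ x' - x ∈ family M.α 0 := by
  simp [family, M.α_eq x x']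

lemma measurableSet_family (x : Pt n) : MeasurableSet (family M.α x) := by
  have h : family M.α x = (fun x' => M.α 0 (x' - x)) ⁻¹' {0}ᶜ := by
    ext x'
    simp [family, M.α_eq x x']
  rw [h]
  exact (M.α_measurable.comp (measurable_id.sub_const x)) (measurableSet_singleton 0).compl

lemma mem_union_collar {Ω : Set (Pt n)} {x x' : Pt n} (hx : x ∈ Ω) (h : x' ∈ family M.α x) :
    x' ∈ Ω ∪ collar M.α Ω := by
  by_cases hx' : x' ∈ Ω
  · exact Or.inl hx'
  · exact Or.inr ⟨hx', x, hx, h⟩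

lemma kernel_sub_eq_zero {Ω : Set (Pt n)} {x x' : Pt n} (hx : x ∈ Ω)
    (h : x' ∉ Ω ∪ collar M.α Ω) (i k : Fin n) : M.kernel (x' - x) i k = 0 :=
  M.kernel_eq_zero (fun h' => h (M.mem_union_collar hx ((M.mem_family_iff x x').2 h'))) i k

variable {V : Type*} [NormedAddCommGroup V] [NormedSpace ℝ V]

/-- Reversing a bond changes the sign of both `α` and the displacement difference, so both
directions contribute equally. This gives the factor `-2` and leaves the kernel as the only material
datum in the force and interaction operators. -/
lemma bond_integrand (w : Pt n → Fin n → V) (x x' : Pt n) (i : Fin n) :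
    ∑ j, M.α x x' j • (ddot M.Θ (Dstar M.α w) x x' i j + ddot M.Θ (Dstar M.α w) x' x i j) =
      (-2 : ℝ) • ∑ k, M.kernel (x' - x) i k • (w x' k - w x k) := by
  have hsym : ∀ j, ddot M.Θ (Dstar M.α w) x' x i j = ddot M.Θ (Dstar M.α w) x x' i j := by
    intro j
    unfold ddot Dstar
    refine Finset.sum_congr rfl fun k _ => Finset.sum_congr rfl fun l _ => ?_
    rw [M.Θ_symm x' x, M.α_antisymm x' x, Pi.neg_apply, neg_smul, ← smul_neg, neg_sub]
  simp only [hsym, ← two_smul ℝ (ddot M.Θ (Dstar M.α w) x x' i _)]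
  unfold ddot Dstar kernel micromodulus
  rw [← M.α_eq, ← M.Θ_eq]
  simp only [Finset.smul_sum, Finset.sum_smul]
  rw [Finset.sum_comm]
  refine Finset.sum_congr rfl fun k _ => Finset.sum_congr rfl fun j _ =>
    Finset.sum_congr rfl fun l _ => ?_
  simp only [smul_smul, ← neg_smul]
  congr 1
  ring

lemma Dop_eq (m : Measure (Pt n)) (w : Pt n → Fin n → V) (x : Pt n) (i : Fin n) :
    Dop m M.α (ddot M.Θ (Dstar M.α w)) x i =
      (-2 : ℝ) • ∫ x', ∑ k, M.kernel (x' - x) i k • (w x' k - w x k) ∂m := by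
  unfold Dop
  simp only [M.bond_integrand]
  rw [integral_smul]

lemma force_eq (w : Pt n → Fin n → V) (x : Pt n) (i : Fin n) :
    M.force w x i = (-2 : ℝ) • ∫ x', ∑ k, M.kernel (x' - x) i k • (w x' k - w x k) :=
  M.Dop_eq volume w x i

lemma Nop_eq (m : Measure (Pt n)) (Y : Set (Pt n)) (w : Pt n → Fin n → V) (x : Pt n) (i : Fin n) :
    Nop m M.α Y (ddot M.Θ (Dstar M.α w)) x i =
      (2 : ℝ) • ∫ x' in Y, ∑ k, M.kernel (x' - x) i k • (w x' k - w x k) ∂m := by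
  unfold Nop
  simp only [M.bond_integrand]
  rw [integral_smul, neg_smul, neg_neg]

lemma interaction_eq (Ω : Set (Pt n)) (w : Pt n → Fin n → V) (x : Pt n) (i : Fin n) :
    M.interaction Ω w x i =
      (2 : ℝ) • ∫ x' in Ω ∪ collar M.α Ω, ∑ k, M.kernel (x' - x) i k • (w x' k - w x k) :=
  M.Nop_eq volume _ w x i

/-- The kernel vanishes on bonds from `Ω` that leave the interaction domain. Thus the equation on
`Ω` and the constraint on the collar involve the same operator, as Green's identity requires. -/
lemma force_eq_neg_interaction {Ω : Set (Pt n)} (w : Pt n → Fin n → V) {x : Pt n} (hx : x ∈ Ω)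
    (i : Fin n) : M.force w x i = -M.interaction Ω w x i := by
  rw [M.force_eq, M.interaction_eq, setIntegral_eq_integral_of_forall_compl_eq_zero, neg_smul]
  intro x' hx'
  simp [M.kernel_sub_eq_zero hx hx']

end Material

lemma collar_measurable {n : ℕ} {α : Pt n → Pt n → Fin n → ℝ} {Ω Ωd Ωn : Set (Pt n)}
    {ν : Pt n → Pt n} (h : IsBody α Ω Ωd Ωn ν) : MeasurableSet (collar α Ω) :=
  h.union ▸ h.measurable_d.union h.measurable_n

/-! ### Laplace transform of the acceleration. -/

/-- By the mean value inequality for `F y - y L`, the increment of `F` over `[t, t + 1]` is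
eventually within any `ε` of `L`, while it tends to zero. -/
lemma eq_zero_of_tendsto_deriv {F F' : ℝ → ℂ} {L : ℂ} (hF : ∀ t, 0 < t → HasDerivAt F (F' t) t)
    (h0 : Tendsto F atTop (𝓝 0)) (hL : Tendsto F' atTop (𝓝 L)) : L = 0 := by
  have hshift : Tendsto (fun t => F (t + 1) - F t - L) atTop (𝓝 (0 - 0 - L)) :=
    ((h0.comp (tendsto_atTop_add_const_right _ _ tendsto_id)).sub h0).sub_const L
  have hle : ∀ ε > 0, ‖(0 : ℂ) - 0 - L‖ ≤ ε := by
    intro ε hε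
    refine le_of_tendsto hshift.norm ?_
    obtain ⟨T, hT⟩ := (eventually_atTop.1 ((Metric.tendsto_nhds.1 hL) ε hε))
    filter_upwards [eventually_ge_atTop (max T 1)] with t ht
    have ht1 : 1 ≤ t := (le_max_right _ _).trans ht
    have htT : T ≤ t := (le_max_left _ _).trans ht
    have hG : ∀ y ∈ Ici t, HasDerivWithinAt (fun y : ℝ => F y - (y : ℂ) * L) (F' y - 1 * L)
        (Ici t) y := fun y hy =>
      ((hF y (by linarith [mem_Ici.1 hy])).sub
        ((HasDerivAt.ofReal_comp (hasDerivAt_id y)).mul_const L)).hasDerivWithinAt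
    have hb : ∀ y ∈ Ici t, ‖F' y - 1 * L‖ ≤ ε := fun y hy => by
      have := hT y (htT.trans hy)
      rw [dist_eq_norm] at this
      simpa using this.le
    have := (convex_Ici t).norm_image_sub_le_of_norm_hasDerivWithin_le hG hb
      (self_mem_Ici) (show t + 1 ∈ Ici t by simp)
    have hre : F (t + 1) - ((t + 1 : ℝ) : ℂ) * L - (F t - (t : ℂ) * L) = F (t + 1) - F t - L := by
      push_cast
      ring
    rw [hre] at this
    simpa using this
  have : ‖L‖ ≤ 0 := le_of_forall_pos_le_add fun ε hε => by simpa using hle ε hε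
  exact norm_le_zero_iff.1 this

lemma norm_exp_neg_mul (s : ℂ) (t : ℝ) :
    ‖Complex.exp (-(s * t))‖ = Real.exp (-(s.re * t)) := by
  rw [Complex.norm_exp]
  simp

lemma norm_exp_mul_le {s : ℂ} {f : ℝ} {K σ t : ℝ} (hf : |f| ≤ K * Real.exp (σ * t)) :
    ‖Complex.exp (-(s * t)) * (f : ℂ)‖ ≤ K * Real.exp (-(s.re - σ) * t) := by
  rw [norm_mul, norm_exp_neg_mul, Complex.norm_real, Real.norm_eq_abs]
  calc Real.exp (-(s.re * t)) * |f| ≤ Real.exp (-(s.re * t)) * (K * Real.exp (σ * t)) := by gcongr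
    _ = K * (Real.exp (-(s.re * t)) * Real.exp (σ * t)) := by ring
    _ = _ := by rw [← Real.exp_add]; ring_nf

lemma integrableOn_exp_mul {s : ℂ} {f : ℝ → ℝ} {K σ : ℝ} (hσ : σ < s.re)
    (hm : AEStronglyMeasurable f (volume.restrict (Ioi 0)))
    (hf : ∀ t, 0 ≤ t → |f t| ≤ K * Real.exp (σ * t)) :
    IntegrableOn (fun t : ℝ => Complex.exp (-(s * t)) * (f t : ℂ)) (Ioi 0) := by
  have hexp : Continuous fun t : ℝ => Complex.exp (-(s * t)) := by fun_prop
  refine Integrable.mono' ((exp_neg_integrableOn_Ioi 0 (sub_pos.2 hσ)).const_mul K)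
    (hexp.aestronglyMeasurable.mul (Complex.continuous_ofReal.comp_aestronglyMeasurable hm)) ?_
  filter_upwards [ae_restrict_mem measurableSet_Ioi] with t ht
  exact norm_exp_mul_le (hf t (le_of_lt ht))

/-- The Laplace transform of a second derivative. -/
lemma laplace_second_deriv {s : ℂ} {f v a : ℝ → ℝ} {K σ : ℝ} (hσ : σ < s.re)
    (hv : ∀ t, 0 ≤ t → HasDerivWithinAt f (v t) (Ici 0) t)
    (hv0 : ContinuousWithinAt v (Ici 0) 0)
    (ha : ∀ t, 0 < t → HasDerivAt v (a t) t)
    (hf : ∀ t, 0 ≤ t → |f t| ≤ K * Real.exp (σ * t))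
    (hint : IntegrableOn (fun t : ℝ => Complex.exp (-(s * t)) * (a t : ℂ)) (Ioi 0)) :
    ∫ t in Ioi (0 : ℝ), Complex.exp (-(s * t)) * (a t : ℂ) =
      s ^ 2 * (∫ t in Ioi (0 : ℝ), Complex.exp (-(s * t)) * (f t : ℂ)) - s * f 0 - v 0 := by
  have hcont : ContinuousOn f (Ici 0) := fun t ht => (hv t ht).continuousWithinAt
  have hfint := integrableOn_exp_mul hσ
    ((hcont.mono Ioi_subset_Ici_self).aestronglyMeasurable measurableSet_Ioi) hf
  have hE : ∀ t : ℝ, HasDerivAt (fun t : ℝ => Complex.exp (-(s * t)))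
      (-s * Complex.exp (-(s * t))) t := fun t => by
    have h1 : HasDerivAt (fun t : ℝ => -(s * (t : ℂ))) (-(s * 1)) t :=
      ((HasDerivAt.ofReal_comp (hasDerivAt_id t)).const_mul s).neg
    convert h1.cexp using 1
    ring
  have hfd : ∀ t, 0 < t → HasDerivAt f (v t) t := fun t ht =>
    (hv t ht.le).hasDerivAt (Ici_mem_nhds ht)
  have hfd' : ∀ t, 0 < t → HasDerivAt (fun t => (f t : ℂ)) (v t : ℂ) t := fun t ht =>
    (hfd t ht).ofReal_comp
  have had' : ∀ t, 0 < t → HasDerivAt (fun t => (v t : ℂ)) (a t : ℂ) t := fun t ht =>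
    (ha t ht).ofReal_comp
  -- In the derivative of this function the terms in `v` cancel, so it is a single antiderivative
  -- that replaces two integrations by parts.
  set w : ℝ → ℂ := fun t => Complex.exp (-(s * t)) * ((v t : ℂ) + s * f t) with hw
  have hwd : ∀ t ∈ Ioi (0 : ℝ), HasDerivAt w (Complex.exp (-(s * t)) * (a t : ℂ) -
      s ^ 2 * (Complex.exp (-(s * t)) * (f t : ℂ))) t := by
    intro t ht
    refine HasDerivAt.congr_deriv (f := w)
      ((hE t).mul ((had' t ht).add ((hfd' t ht).const_mul s))) ?_
    ring
  have hwint : IntegrableOn (fun t : ℝ => Complex.exp (-(s * t)) * (a t : ℂ) -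
      s ^ 2 * (Complex.exp (-(s * t)) * (f t : ℂ))) (Ioi 0) := hint.sub (hfint.const_mul _)
  have hlim := tendsto_limUnder_of_hasDerivAt_of_integrableOn_Ioi hwd hwint
  have hz : Tendsto (fun t : ℝ => Complex.exp (-(s * t)) * (f t : ℂ)) atTop (𝓝 0) := by
    have h1 : Tendsto (fun t : ℝ => K * Real.exp (-(s.re - σ) * t)) atTop (𝓝 0) := by
      have : Tendsto (fun t : ℝ => -(s.re - σ) * t) atTop atBot :=
        tendsto_id.const_mul_atTop_of_neg (by linarith)
      simpa using (Real.tendsto_exp_atBot.comp this).const_mul K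
    refine squeeze_zero_norm' ?_ h1
    filter_upwards [eventually_ge_atTop 0] with t ht
    exact norm_exp_mul_le (hf t ht)
  -- The limit of `w` exists because its derivative is integrable. Since `e^{-st} f` tends to zero
  -- and its derivative is `w - 2 s e^{-st} f`, that limit is zero.
  have hL : limUnder atTop w = 0 := by
    refine eq_zero_of_tendsto_deriv (F' := fun t => w t - 2 * s * (Complex.exp (-(s * t)) * f t))
      (fun t ht => ?_) hz ?_
    · refine HasDerivAt.congr_deriv (f := fun t : ℝ => Complex.exp (-(s * t)) * (f t : ℂ))
        ((hE t).mul (hfd' t ht)) ?_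
      simp only [hw]
      ring
    · simpa using hlim.sub (hz.const_mul (2 * s))
  rw [hL] at hlim
  have hc0 : ContinuousWithinAt w (Ici 0) 0 := by
    refine ContinuousWithinAt.mul (by fun_prop) (ContinuousWithinAt.add ?_ ?_)
    · exact Complex.continuous_ofReal.continuousAt.comp_continuousWithinAt hv0
    · exact continuousWithinAt_const.mul
        (Complex.continuous_ofReal.continuousAt.comp_continuousWithinAt (hcont 0 self_mem_Ici))
  have := integral_Ioi_of_hasDerivAt_of_tendsto hc0 hwd hwint hlim
  rw [integral_sub hint (hfint.const_mul _), integral_const_mul] at this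
  simp only [hw, Complex.ofReal_zero, mul_zero, neg_zero, Complex.exp_zero, one_mul] at this
  linear_combination this

/-! ### Laplace transform of the motion. -/

section Motion

variable {n : ℕ} {M : Material n} {Ω : Set (Pt n)} {u : Pt n → ℝ → Fin n → ℝ} {s : ℂ} {K σ : ℝ}

lemma abs_coord_le {x : Pt n} {t : ℝ} {B : ℝ} (h : ‖u x t‖ ≤ B) (i : Fin n) : |u x t i| ≤ B :=
  (norm_le_pi_norm (u x t) i).trans h

lemma measurable_coord (hm : Measurable fun p : Pt n × ℝ => u p.1 p.2) (i : Fin n) :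
    Measurable fun p : Pt n × ℝ => u p.1 p.2 i := (measurable_pi_apply i).comp hm

lemma measurable_time (hm : Measurable fun p : Pt n × ℝ => u p.1 p.2) (x : Pt n) (i : Fin n) :
    Measurable fun t => u x t i := (measurable_coord hm i).comp measurable_prodMk_left

lemma laplace_measurable (hm : Measurable fun p : Pt n × ℝ => u p.1 p.2) (s : ℂ) (i : Fin n) :
    StronglyMeasurable fun x => laplace u s x i := by
  have : Measurable fun p : Pt n × ℝ => Complex.exp (-(s * p.2)) * (u p.1 p.2 i : ℂ) := by
    have := measurable_coord hm i
    fun_prop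
  exact this.stronglyMeasurable.integral_prod_right

lemma laplace_integrableOn (hm : Measurable fun p : Pt n × ℝ => u p.1 p.2) (hσ : σ < s.re)
    {x : Pt n} (hx : ∀ t, 0 ≤ t → ‖u x t‖ ≤ K * Real.exp (σ * t)) (i : Fin n) :
    IntegrableOn (fun t : ℝ => Complex.exp (-(s * t)) * (u x t i : ℂ)) (Ioi 0) :=
  integrableOn_exp_mul hσ (measurable_time hm x i).aestronglyMeasurable
    fun t ht => abs_coord_le (hx t ht) i

lemma norm_laplace_le (hσ : σ < s.re) {x : Pt n}
    (hx : ∀ t, 0 ≤ t → ‖u x t‖ ≤ K * Real.exp (σ * t)) (i : Fin n) :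
    ‖laplace u s x i‖ ≤ ∫ t in Ioi (0 : ℝ), K * Real.exp (-(s.re - σ) * t) := by
  refine norm_integral_le_of_norm_le
    ((exp_neg_integrableOn_Ioi 0 (sub_pos.2 hσ)).const_mul K) ?_
  filter_upwards [ae_restrict_mem measurableSet_Ioi] with t ht
  exact norm_exp_mul_le (abs_coord_le (hx t (le_of_lt ht)) i)

lemma laplace_continuousOn (hm : Measurable fun p : Pt n × ℝ => u p.1 p.2) (hσ : σ < s.re)
    (hK : ∀ x ∈ Ω, ∀ t, 0 ≤ t → ‖u x t‖ ≤ K * Real.exp (σ * t))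
    (hc : ∀ t, 0 ≤ t → ContinuousOn (fun x => u x t) Ω) (i : Fin n) :
    ContinuousOn (fun x => laplace u s x i) Ω := by
  intro x hx
  refine tendsto_integral_filter_of_dominated_convergence
    (fun t => K * Real.exp (-(s.re - σ) * t)) ?_ ?_
    ((exp_neg_integrableOn_Ioi 0 (sub_pos.2 hσ)).const_mul K) ?_
  · filter_upwards [self_mem_nhdsWithin] with y hy
    exact (laplace_integrableOn hm hσ (hK y hy) i).aestronglyMeasurable
  · filter_upwards [self_mem_nhdsWithin] with y hy
    filter_upwards [ae_restrict_mem measurableSet_Ioi] with t ht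
    exact norm_exp_mul_le (abs_coord_le (hK y hy t (le_of_lt ht)) i)
  · filter_upwards [ae_restrict_mem measurableSet_Ioi] with t ht
    have h1 : Tendsto (fun y => u y t i) (𝓝[Ω] x) (𝓝 (u x t i)) :=
      (tendsto_pi_nhds.1 (hc t (le_of_lt ht) x hx)) i
    exact ((Complex.continuous_ofReal.tendsto _).comp h1).const_mul _

/-- The internal force commutes with the Laplace transform. -/
lemma laplace_force (hm : Measurable fun p : Pt n × ℝ => u p.1 p.2) (hσ : σ < s.re)
    (hK : ∀ x ∈ Ω ∪ collar M.α Ω, ∀ t, 0 ≤ t → ‖u x t‖ ≤ K * Real.exp (σ * t))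
    {x : Pt n} (hx : x ∈ Ω) (i : Fin n) :
    IntegrableOn (fun t : ℝ => Complex.exp (-(s * t)) * ((M.force (fun y => u y t) x i : ℝ) : ℂ))
      (Ioi 0) ∧
    ∫ t in Ioi (0 : ℝ), Complex.exp (-(s * t)) * ((M.force (fun y => u y t) x i : ℝ) : ℂ) =
      M.force (laplace u s) x i := by
  set φ : Pt n → ℝ → ℂ := fun x' t => Complex.exp (-(s * t)) *
    ∑ k, (M.kernel (x' - x) i k : ℂ) * ((u x' t k : ℂ) - (u x t k : ℂ)) with hφ
  have hint : Integrable (Function.uncurry φ) (volume.prod (volume.restrict (Ioi (0 : ℝ)))) := by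
    -- The majorant is a product of a function of the bond and a function of time; the factor `2`
    -- accounts for the two ends of the bond. The growth bound is only available on `Ω ∪ collar M.α
    -- Ω`, and elsewhere the kernel vanishes.
    have hg : Integrable (fun p : Pt n × ℝ => (∑ k, |M.kernel (p.1 - x) i k|) *
        (2 * K * Real.exp (-(s.re - σ) * p.2))) (volume.prod (volume.restrict (Ioi (0 : ℝ)))) := by
      refine Integrable.mul_prod
        (integrable_finsetSum _ fun k _ => ((M.kernel_integrable i k).comp_sub_right x).abs)
        ((exp_neg_integrableOn_Ioi 0 (sub_pos.2 hσ)).const_mul (2 * K))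
    refine hg.mono' ?_ ?_
    · refine AEStronglyMeasurable.mul ?_ ?_
      · have : Continuous fun p : Pt n × ℝ => Complex.exp (-(s * p.2)) := by fun_prop
        exact this.aestronglyMeasurable
      · refine Finset.aestronglyMeasurable_fun_sum _ fun k _ => AEStronglyMeasurable.mul ?_ ?_
        · exact Complex.continuous_ofReal.comp_aestronglyMeasurable
            ((M.kernel_integrable i k).comp_sub_right x).aestronglyMeasurable.comp_fst
        · have h1 := measurable_coord hm k
          have h2 : Measurable fun p : Pt n × ℝ => u x p.2 k :=
            (measurable_time hm x k).comp measurable_snd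
          refine Measurable.aestronglyMeasurable ?_
          exact (Complex.measurable_ofReal.comp h1).sub (Complex.measurable_ofReal.comp h2)
    · have hpos : ∀ᵐ p ∂((volume : Measure (Pt n)).prod (volume.restrict (Ioi (0 : ℝ)))),
          p.2 ∈ Ioi (0 : ℝ) :=
        Measure.quasiMeasurePreserving_snd.ae (ae_restrict_mem measurableSet_Ioi)
      filter_upwards [hpos] with p hp
      have hp0 : 0 ≤ p.2 := le_of_lt hp
      simp only [Function.uncurry, hφ]
      rw [Finset.mul_sum, Finset.sum_mul]
      refine (norm_sum_le _ _).trans (Finset.sum_le_sum fun k _ => ?_)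
      by_cases hY : p.1 ∈ Ω ∪ collar M.α Ω
      · have e : Complex.exp (-(s * p.2)) * ((M.kernel (p.1 - x) i k : ℂ) *
            ((u p.1 p.2 k : ℂ) - (u x p.2 k : ℂ))) = (M.kernel (p.1 - x) i k : ℂ) *
            (Complex.exp (-(s * p.2)) * (u p.1 p.2 k : ℂ) -
              Complex.exp (-(s * p.2)) * (u x p.2 k : ℂ)) := by ring
        rw [e, norm_mul, Complex.norm_real, Real.norm_eq_abs]
        refine mul_le_mul_of_nonneg_left ?_ (abs_nonneg _)
        refine (norm_sub_le _ _).trans ?_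
        have h1 := norm_exp_mul_le (s := s) (abs_coord_le (hK p.1 hY p.2 hp0) k)
        have h2 := norm_exp_mul_le (s := s) (abs_coord_le (hK x (Or.inl hx) p.2 hp0) k)
        linarith
      · simp [M.kernel_sub_eq_zero hx hY]
  have hforce : ∀ t : ℝ, Complex.exp (-(s * t)) * ((M.force (fun y => u y t) x i : ℝ) : ℂ) =
      (-2 : ℂ) * ∫ x', φ x' t := by
    intro t
    rw [M.force_eq, hφ]
    simp only [smul_eq_mul]
    rw [integral_const_mul, Complex.ofReal_mul, ← integral_complex_ofReal]
    push_cast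
    ring
  have hswap := integral_integral_swap hint
  constructor
  · simp only [hforce]
    exact (hint.integral_prod_right).const_mul _
  · simp only [hforce]
    rw [integral_const_mul, ← hswap, M.force_eq]
    have : ∀ x', ∫ t in Ioi (0 : ℝ), φ x' t =
        ∑ k, M.kernel (x' - x) i k • (laplace u s x' k - laplace u s x k) := by
      intro x'
      by_cases hY : x' ∈ Ω ∪ collar M.α Ω
      · have hi1 := fun k => laplace_integrableOn hm hσ (hK x' hY) k
        have hi2 := fun k => laplace_integrableOn hm hσ (hK x (Or.inl hx)) k
        have e : ∀ t : ℝ, φ x' t = ∑ k, (M.kernel (x' - x) i k : ℂ) *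
            (Complex.exp (-(s * t)) * (u x' t k : ℂ) - Complex.exp (-(s * t)) * (u x t k : ℂ)) := by
          intro t
          simp only [hφ, Finset.mul_sum]
          exact Finset.sum_congr rfl fun k _ => by ring
        simp only [e]
        have hi : ∀ k, Integrable (fun t : ℝ => (M.kernel (x' - x) i k : ℂ) *
            (Complex.exp (-(s * t)) * (u x' t k : ℂ) - Complex.exp (-(s * t)) * (u x t k : ℂ)))
            (volume.restrict (Ioi 0)) := fun k => ((hi1 k).sub (hi2 k)).const_mul _
        rw [integral_finsetSum _ fun k _ => hi k]
        refine Finset.sum_congr rfl fun k _ => ?_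
        rw [integral_const_mul, integral_sub (hi1 k) (hi2 k), Complex.real_smul]
        rfl
      · simp [hφ, M.kernel_sub_eq_zero hx hY]
    simp only [this, Complex.real_smul]
    push_cast
    rfl

/-- The Laplace-transformed equation of motion. -/
theorem laplace_motion {Ωd Ωn : Set (Pt n)} {v b gd gn : Pt n → ℝ → Fin n → ℝ}
    {u₀ v₀ : Pt n → Fin n → ℝ} (hu : IsMotion M Ω Ωd Ωn u v b gd gn u₀ v₀)
    (hm : Measurable fun p : Pt n × ℝ => u p.1 p.2) (hσ : σ < s.re)
    (hK : ∀ x ∈ Ω ∪ collar M.α Ω, ∀ t, 0 ≤ t → ‖u x t‖ ≤ K * Real.exp (σ * t))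
    (hb : ∀ x ∈ Ω, IntegrableOn (fun t : ℝ => Real.exp (-(s.re * t)) • b x t) (Ioi 0))
    {x : Pt n} (hx : x ∈ Ω) (i : Fin n) :
    M.force (laplace u s) x i + effectiveForce M.ρ b u₀ v₀ s x i =
      M.ρ * s ^ 2 * laplace u s x i := by
  obtain ⟨hfint, hfeq⟩ := laplace_force hm hσ hK hx i
  have hρ : (M.ρ : ℂ) ≠ 0 := Complex.ofReal_ne_zero.2 M.ρ_pos.ne'
  have hbint : IntegrableOn (fun t : ℝ => Complex.exp (-(s * t)) * (b x t i : ℂ)) (Ioi 0) := by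
    have h1 : IntegrableOn (fun t : ℝ => Real.exp (-(s.re * t)) * b x t i) (Ioi 0) := by
      exact (integrable_pi_iff.1 (hb x hx)) i
    -- Only the unimodular factor `e^{-i t Im s}` separates the assumed integrability from the
    -- required one.
    have h2 : IntegrableOn (fun t : ℝ => Complex.exp (-(Complex.I * s.im * t)) *
        ((Real.exp (-(s.re * t)) * b x t i : ℝ) : ℂ)) (Ioi 0) := by
      refine Integrable.bdd_mul (c := 1) h1.ofReal ?_ ?_
      · exact Continuous.aestronglyMeasurable (by fun_prop)
      · refine Eventually.of_forall fun t => ?_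
        rw [Complex.norm_exp]
        simp
    refine h2.congr (Eventually.of_forall fun t => ?_)
    simp only
    rw [Complex.ofReal_mul, ← mul_assoc, Complex.ofReal_exp, ← Complex.exp_add]
    congr 2
    conv_rhs => rw [← Complex.re_add_im s]
    push_cast
    ring
  choose! a ha using hu.motion x hx
  -- Solving the equation of motion for the acceleration makes its transform converge, because those
  -- of the force and of `b` do.
  have ha' : ∀ t ∈ Ioi (0 : ℝ), Complex.exp (-(s * t)) * (a t i : ℂ) =
      (M.ρ : ℂ)⁻¹ * (Complex.exp (-(s * t)) * ((M.force (fun y => u y t) x i : ℝ) : ℂ) +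
        Complex.exp (-(s * t)) * (b x t i : ℂ)) := by
    intro t ht
    have h1 := congrFun (ha t ht).2 i
    simp only [Pi.add_apply, Pi.smul_apply, smul_eq_mul] at h1
    rw [← mul_add, ← Complex.ofReal_add, h1, Complex.ofReal_mul]
    field_simp
  have haint : IntegrableOn (fun t : ℝ => Complex.exp (-(s * t)) * (a t i : ℂ)) (Ioi 0) :=
    IntegrableOn.congr_fun ((hfint.add hbint).const_mul _) (fun t ht => (ha' t ht).symm)
      measurableSet_Ioi
  have hmain := laplace_second_deriv (f := fun t => u x t i) (v := fun t => v x t i)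
    (a := fun t => a t i) hσ
    (fun t ht => (hasDerivWithinAt_pi.1 (hu.velocity x hx t ht)) i)
    ((continuousWithinAt_pi.1 (hu.velocity_zero x hx)) i)
    (fun t ht => (hasDerivAt_pi.1 (ha t ht).1) i)
    (fun t ht => abs_coord_le (hK x (Or.inl hx) t ht) i) haint
  rw [setIntegral_congr_fun measurableSet_Ioi ha', integral_const_mul,
    integral_add hfint hbint, hfeq] at hmain
  rw [hu.initial_displacement x hx, hu.initial_velocity x hx] at hmain
  unfold effectiveForce
  have h3 : ∫ t in Ioi (0 : ℝ), Complex.exp (-(s * t)) * (b x t i : ℂ) = laplace b s x i := rfl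
  have h4 : ∫ t in Ioi (0 : ℝ), Complex.exp (-(s * t)) * (u x t i : ℂ) = laplace u s x i := rfl
  rw [h3, h4] at hmain
  field_simp at hmain
  linear_combination hmain

end Motion

/-! ### Integrability over pairs of points. -/

section Bilinear

variable {n : ℕ} {μ : Measure (Pt n)} {κ : Pt n → ℝ} {f g : Pt n → ℂ} {B : ℝ} {Y : Set (Pt n)}

/-- Up to a swap of variables this is the integrand of a convolution of two integrable functions. -/
lemma integrable_kernel_mul_fst (hκ : Integrable κ) (hg : Integrable g) (Y : Set (Pt n)) :
    Integrable (fun p : Pt n × Pt n => (κ (p.2 - p.1) : ℂ) * g p.1)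
      ((volume.restrict Y).prod (volume.restrict Y)) := by
  have h := (Integrable.convolution_integrand (ContinuousLinearMap.mul ℂ ℂ) hg hκ.ofReal).swap
  rw [Measure.prod_restrict]
  refine (h.congr (Eventually.of_forall fun p => ?_)).integrableOn
  simp [mul_comm]

lemma integrable_kernel_mul_snd (hκ : Integrable κ) (hg : Integrable g) (Y : Set (Pt n)) :
    Integrable (fun p : Pt n × Pt n => (κ (p.2 - p.1) : ℂ) * g p.2)
      ((volume.restrict Y).prod (volume.restrict Y)) := by
  have h := (integrable_kernel_mul_fst (κ := fun ξ => κ (-ξ)) hκ.comp_neg hg Y).swap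
  refine h.congr (Eventually.of_forall fun p => ?_)
  simp

lemma integrable_mul_of_bounded_fst {H : Pt n × Pt n → ℂ} (hY : MeasurableSet Y)
    (hf : AEStronglyMeasurable f) (hB : ∀ x ∈ Y, ‖f x‖ ≤ B)
    (hH : Integrable H ((volume.restrict Y).prod (volume.restrict Y))) :
    Integrable (fun p => f p.1 * H p) ((volume.restrict Y).prod (volume.restrict Y)) := by
  refine hH.bdd_mul (c := B) hf.restrict.comp_fst ?_
  filter_upwards [Measure.quasiMeasurePreserving_fst.ae (ae_restrict_mem (μ := volume) hY)]
    with p hp using hB _ hp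

lemma integrable_mul_of_bounded_snd {H : Pt n × Pt n → ℂ} (hY : MeasurableSet Y)
    (hf : AEStronglyMeasurable f) (hB : ∀ x ∈ Y, ‖f x‖ ≤ B)
    (hH : Integrable H ((volume.restrict Y).prod (volume.restrict Y))) :
    Integrable (fun p => f p.2 * H p) ((volume.restrict Y).prod (volume.restrict Y)) := by
  refine hH.bdd_mul (c := B) hf.restrict.comp_snd ?_
  filter_upwards [Measure.quasiMeasurePreserving_snd.ae (ae_restrict_mem (μ := volume) hY)]
    with p hp using hB _ hp

end Bilinear

/-! ### Green's identity and reciprocity. -/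

section Reciprocity

variable {n : ℕ} (M : Material n) {Ω : Set (Pt n)} {w r : Pt n → Fin n → ℂ} {B : ℝ}

/-- The work density of the bond forces of `f` on the displacement `p`. -/
def Material.bondWork (p f : Pt n → Fin n → ℂ) (i : Fin n) (z : Pt n × Pt n) : ℂ :=
  p z.1 i * ∑ k, (M.kernel (z.2 - z.1) i k : ℂ) * (f z.2 k - f z.1 k)

/-- One field is only known to be bounded on `Y` (the transformed motion), the other only integrable
(the fundamental solution). Together with an integrable kernel this suffices for work in either
order. -/
lemma Material.bondWork_integrable₁ {Y : Set (Pt n)} (hY : MeasurableSet Y)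
    (hw : ∀ i, AEStronglyMeasurable fun x => w x i) (hB : ∀ x ∈ Y, ∀ i, ‖w x i‖ ≤ B)
    (hr : ∀ i, Integrable fun x => r x i) (i : Fin n) :
    Integrable (M.bondWork w r i) ((volume.restrict Y).prod (volume.restrict Y)) := by
  refine integrable_mul_of_bounded_fst (f := fun x => w x i) hY (hw i) (fun x hx => hB x hx i) ?_
  refine integrable_finsetSum _ fun k _ => ?_
  simp only [mul_sub]
  exact (integrable_kernel_mul_snd (M.kernel_integrable i k) (hr k) Y).sub
    (integrable_kernel_mul_fst (M.kernel_integrable i k) (hr k) Y)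

lemma Material.bondWork_integrable₂ {Y : Set (Pt n)} (hY : MeasurableSet Y)
    (hw : ∀ i, AEStronglyMeasurable fun x => w x i) (hB : ∀ x ∈ Y, ∀ i, ‖w x i‖ ≤ B)
    (hr : ∀ i, Integrable fun x => r x i) (i : Fin n) :
    Integrable (M.bondWork r w i) ((volume.restrict Y).prod (volume.restrict Y)) := by
  have h : M.bondWork r w i = fun z => ∑ k,
      (w z.2 k * ((M.kernel (z.2 - z.1) i k : ℂ) * r z.1 i) -
        w z.1 k * ((M.kernel (z.2 - z.1) i k : ℂ) * r z.1 i)) := by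
    ext z
    simp only [Material.bondWork, Finset.mul_sum]
    exact Finset.sum_congr rfl fun k _ => by ring
  rw [h]
  refine integrable_finsetSum _ fun k _ => ?_
  have h1 := integrable_kernel_mul_fst (M.kernel_integrable i k) (hr i) Y
  exact (integrable_mul_of_bounded_snd (f := fun x => w x k) hY (hw k)
    (fun x hx => hB x hx k) h1).sub
    (integrable_mul_of_bounded_fst (f := fun x => w x k) hY (hw k) (fun x hx => hB x hx k) h1)

lemma Material.interaction_eq_complex (Ω : Set (Pt n)) (w : Pt n → Fin n → ℂ) (x : Pt n)
    (i : Fin n) : M.interaction Ω w x i =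
      2 * ∫ x' in Ω ∪ collar M.α Ω, ∑ k, (M.kernel (x' - x) i k : ℂ) * (w x' k - w x k) := by
  rw [M.interaction_eq, Complex.real_smul]
  simp only [Complex.real_smul]
  push_cast
  rfl

lemma Material.interaction_work {p f : Pt n → Fin n → ℂ} (h : ∀ i, Integrable (M.bondWork p f i)
      ((volume.restrict (Ω ∪ collar M.α Ω)).prod (volume.restrict (Ω ∪ collar M.α Ω)))) :
    IntegrableOn (fun x => p x ⬝ᵥ M.interaction Ω f x) (Ω ∪ collar M.α Ω) ∧
    ∫ x in Ω ∪ collar M.α Ω, p x ⬝ᵥ M.interaction Ω f x =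
      2 * ∑ i, ∫ z, M.bondWork p f i z
        ∂(volume.restrict (Ω ∪ collar M.α Ω)).prod (volume.restrict (Ω ∪ collar M.α Ω)) := by
  have e : ∀ x i, p x i * M.interaction Ω f x i =
      2 * ∫ x' in Ω ∪ collar M.α Ω, M.bondWork p f i (x, x') := by
    intro x i
    simp only [Material.bondWork, M.interaction_eq_complex]
    rw [integral_const_mul]
    ring
  simp only [dotProduct, e]
  have hi : ∀ i, Integrable (fun x => 2 * ∫ x' in Ω ∪ collar M.α Ω, M.bondWork p f i (x, x'))
      (volume.restrict (Ω ∪ collar M.α Ω)) := fun i => (h i).integral_prod_left.const_mul 2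
  refine ⟨integrable_finsetSum _ fun i _ => hi i, ?_⟩
  rw [integral_finsetSum _ fun i _ => hi i, Finset.mul_sum]
  refine Finset.sum_congr rfl fun i _ => ?_
  rw [integral_const_mul, integral_prod _ (h i)]

/-- The nonlocal Green identity on the interaction domain. -/
theorem Material.green (hY : MeasurableSet (Ω ∪ collar M.α Ω))
    (hw : ∀ i, AEStronglyMeasurable fun x => w x i)
    (hB : ∀ x ∈ Ω ∪ collar M.α Ω, ∀ i, ‖w x i‖ ≤ B) (hr : ∀ i, Integrable fun x => r x i) :
    IntegrableOn (fun x => w x ⬝ᵥ M.interaction Ω r x) (Ω ∪ collar M.α Ω) ∧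
    IntegrableOn (fun x => r x ⬝ᵥ M.interaction Ω w x) (Ω ∪ collar M.α Ω) ∧
    ∫ x in Ω ∪ collar M.α Ω, w x ⬝ᵥ M.interaction Ω r x =
      ∫ x in Ω ∪ collar M.α Ω, r x ⬝ᵥ M.interaction Ω w x := by
  have h1 := M.bondWork_integrable₁ hY hw hB hr
  have h2 := M.bondWork_integrable₂ hY hw hB hr
  obtain ⟨i1, e1⟩ := M.interaction_work h1
  obtain ⟨i2, e2⟩ := M.interaction_work h2
  refine ⟨i1, i2, ?_⟩
  rw [e1, e2, ← integral_finsetSum _ fun i _ => h1 i, ← integral_finsetSum _ fun i _ => h2 i]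
  congr 1
  set μ := (volume.restrict (Ω ∪ collar M.α Ω)).prod (volume.restrict (Ω ∪ collar M.α Ω))
  set D : Pt n × Pt n → ℂ := fun z => ∑ i, M.bondWork w r i z - ∑ i, M.bondWork r w i z with hD
  -- The terms with both fields at the same point cancel by symmetry of the kernel in its indices.
  -- The remaining terms change sign under exchange of the points, because the kernel is even.
  have hanti : ∀ z : Pt n × Pt n, D z.swap = -D z := by
    intro z
    have hform : ∀ z, D z = ∑ i, ∑ k, (M.kernel (z.2 - z.1) i k : ℂ) *
        (w z.1 i * r z.2 k - r z.1 i * w z.2 k) := by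
      intro z
      have hz : ∑ i, ∑ k, (M.kernel (z.2 - z.1) i k : ℂ) * (w z.1 i * r z.1 k) =
          ∑ i, ∑ k, (M.kernel (z.2 - z.1) i k : ℂ) * (r z.1 i * w z.1 k) := by
        rw [Finset.sum_comm]
        refine Finset.sum_congr rfl fun i _ => Finset.sum_congr rfl fun k _ => ?_
        rw [M.kernel_symm _ k i]
        ring
      have : D z = ∑ i, ∑ k, (M.kernel (z.2 - z.1) i k : ℂ) *
          (w z.1 i * r z.2 k - r z.1 i * w z.2 k) -
          ∑ i, ∑ k, (M.kernel (z.2 - z.1) i k : ℂ) * (w z.1 i * r z.1 k) +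
          ∑ i, ∑ k, (M.kernel (z.2 - z.1) i k : ℂ) * (r z.1 i * w z.1 k) := by
        simp only [hD, Material.bondWork, Finset.mul_sum, ← Finset.sum_sub_distrib,
          ← Finset.sum_add_distrib]
        exact Finset.sum_congr rfl fun i _ => Finset.sum_congr rfl fun k _ => by ring
      rw [this, hz]
      ring
    rw [hform, hform, Finset.sum_comm, ← Finset.sum_neg_distrib]
    refine Finset.sum_congr rfl fun i _ => ?_
    rw [← Finset.sum_neg_distrib]
    refine Finset.sum_congr rfl fun k _ => ?_
    simp only [Prod.fst_swap, Prod.snd_swap]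
    rw [M.kernel_symm _ k i, ← neg_sub z.2 z.1, M.kernel_neg]
    ring
  have hzero : ∫ z, D z ∂μ = 0 := by
    have hs := integral_prod_swap (μ := volume.restrict (Ω ∪ collar M.α Ω))
      (ν := volume.restrict (Ω ∪ collar M.α Ω)) D
    simp only [hanti, integral_neg] at hs
    exact self_eq_neg.1 hs.symm
  rw [hD, integral_sub (integrable_finsetSum _ fun i _ => h1 i)
    (integrable_finsetSum _ fun i _ => h2 i), sub_eq_zero] at hzero
  exact hzero

lemma Material.force_eq_complex (w : Pt n → Fin n → ℂ) (x : Pt n) (i : Fin n) :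
    M.force w x i =
      (-2) * ∫ x', ∑ k, (M.kernel (x' - x) i k : ℂ) * (w x' k - w x k) := by
  rw [M.force_eq, Complex.real_smul]
  simp only [Complex.real_smul]
  push_cast
  rfl

lemma Material.force_shift (f : Pt n → Fin n → ℂ) (x₀ x : Pt n) (i : Fin n) :
    M.force (fun y => f (y - x₀)) x i = M.force f (x - x₀) i := by
  rw [M.force_eq_complex, M.force_eq_complex]
  congr 1
  rw [← integral_sub_right_eq_self (fun y => ∑ k, (M.kernel (y - (x - x₀)) i k : ℂ) *
    (f y k - f (x - x₀) k)) x₀]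
  simp only [sub_sub_sub_cancel_right]

/-- The integral of the micromodulus. -/
def Material.mass (i k : Fin n) : ℝ := ∫ ξ, M.kernel ξ i k

lemma Material.kernel_mul_integrableOn (hY : MeasurableSet (Ω ∪ collar M.α Ω))
    (hw : ∀ i, AEStronglyMeasurable fun x => w x i)
    (hB : ∀ x ∈ Ω ∪ collar M.α Ω, ∀ i, ‖w x i‖ ≤ B) {x₀ : Pt n} (i j : Fin n) :
    IntegrableOn (fun x => (M.kernel (x - x₀) i j : ℂ) * w x j) (Ω ∪ collar M.α Ω) := by
  refine Integrable.mul_bdd (c := B)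
    (((M.kernel_integrable i j).comp_sub_right x₀).ofReal).integrableOn (hw j).restrict ?_
  filter_upwards [ae_restrict_mem hY] with x hx using hB x hx j

/-- Nothing bounds `w` outside the interaction domain, so the integral is restricted before being
split. For a point of `Ω` the kernel already has its full mass there. -/
lemma Material.force_eq_of_mem (hY : MeasurableSet (Ω ∪ collar M.α Ω))
    (hw : ∀ i, AEStronglyMeasurable fun x => w x i)
    (hB : ∀ x ∈ Ω ∪ collar M.α Ω, ∀ i, ‖w x i‖ ≤ B) {x₀ : Pt n} (hx₀ : x₀ ∈ Ω) (i : Fin n) :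
    M.force w x₀ i =
      (-2) * ∑ j, ((∫ x in Ω ∪ collar M.α Ω, (M.kernel (x - x₀) i j : ℂ) * w x j) -
        M.mass i j * w x₀ j) := by
  have hint := fun i j => M.kernel_mul_integrableOn (x₀ := x₀) hY hw hB i j
  have hmass : ∀ j, ∫ x in Ω ∪ collar M.α Ω, (M.kernel (x - x₀) i j : ℂ) = M.mass i j := by
    intro j
    rw [setIntegral_eq_integral_of_forall_compl_eq_zero
      (fun x hx => by rw [M.kernel_sub_eq_zero hx₀ hx, Complex.ofReal_zero]),
      integral_complex_ofReal, integral_sub_right_eq_self (fun ξ => M.kernel ξ i j), Material.mass]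
  rw [M.force_eq_neg_interaction w hx₀, M.interaction_eq_complex]
  have hsub : ∀ j, Integrable (fun x => (M.kernel (x - x₀) i j : ℂ) * (w x j - w x₀ j))
      (volume.restrict (Ω ∪ collar M.α Ω)) := fun j => by
    simp only [mul_sub]
    exact (hint i j).sub
      (((M.kernel_integrable i j).comp_sub_right x₀).ofReal.integrableOn.mul_const _)
  rw [integral_finsetSum _ fun j _ => hsub j, neg_mul]
  congr 2
  refine Finset.sum_congr rfl fun j _ => ?_
  simp only [mul_sub]
  have hconst : Integrable (fun x => (M.kernel (x - x₀) i j : ℂ) * w x₀ j)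
      (volume.restrict (Ω ∪ collar M.α Ω)) :=
    ((M.kernel_integrable i j).comp_sub_right x₀).ofReal.integrableOn.mul_const _
  rw [integral_sub (hint i j) hconst, integral_mul_const, hmass]

namespace DiracField

variable (v : DiracField n)

@[simp] lemma shift_pole (x₀ : Pt n) : (v.shift x₀).pole = v.pole + x₀ := rfl
@[simp] lemma shift_coeff (x₀ : Pt n) : (v.shift x₀).coeff = v.coeff := rfl
@[simp] lemma shift_reg (x₀ x : Pt n) : (v.shift x₀).reg x = v.reg (x - x₀) := rfl

lemma bump_pole : v.bump v.pole = v.coeff := by simp [bump]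

lemma bump_of_ne {x : Pt n} (h : x ≠ v.pole) : v.bump x = 0 := by simp [bump, h]

lemma force_eq {x : Pt n} (h : x ≠ v.pole) (i : Fin n) :
    v.force M x i = M.force v.reg x i - 2 * ∑ k, (M.kernel (x - v.pole) i k : ℂ) * v.coeff k := by
  unfold force
  rw [M.Dop_eq, integral_dirac, v.bump_pole, v.bump_of_ne h, ← neg_sub x v.pole, M.kernel_neg,
    Complex.real_smul]
  simp only [Complex.real_smul, Pi.zero_apply, sub_zero]
  push_cast
  ring

/-- The point mass sees only the bond joining `x` to the pole; with the pole in `Ω` this bond lies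
in the domain of integration. -/
lemma interaction_eq {Ω : Set (Pt n)} {x : Pt n} (h : x ≠ v.pole) (hp : v.pole ∈ Ω) (i : Fin n) :
    v.interaction M Ω x i = M.interaction Ω v.reg x i +
      2 * ∑ k, (M.kernel (x - v.pole) i k : ℂ) * v.coeff k := by
  classical
  unfold interaction
  rw [M.Nop_eq, setIntegral_dirac, if_pos (show v.pole ∈ Ω ∪ collar M.α Ω from Or.inl hp),
    v.bump_pole, v.bump_of_ne h, ← neg_sub x v.pole, M.kernel_neg, Complex.real_smul]
  simp only [Complex.real_smul, Pi.zero_apply, sub_zero]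
  push_cast
  ring

/-- The bump vanishes almost everywhere, so only the term `-w(x)` at the pole survives. Positive
dimension is needed for the pole to be a null set. -/
lemma forceCoeff_eq [Nonempty (Fin n)] (i : Fin n) :
    v.forceCoeff M i = 2 * ∑ k, (M.mass i k : ℂ) * v.coeff k := by
  unfold forceCoeff
  rw [M.force_eq_complex]
  have : ∫ x', ∑ k, (M.kernel (x' - v.pole) i k : ℂ) * (v.bump x' k - v.bump v.pole k) =
      ∫ x', ∑ k, (M.kernel (x' - v.pole) i k : ℂ) * (-v.coeff k) := by
    refine integral_congr_ae ?_
    filter_upwards [compl_mem_ae_iff.2 (measure_singleton (μ := volume) v.pole)] with x hx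
    rw [v.bump_pole, v.bump_of_ne hx]
    simp
  rw [this, integral_finsetSum _ fun k _ =>
    (((M.kernel_integrable i k).comp_sub_right v.pole).ofReal).mul_const _, Finset.mul_sum,
    Finset.mul_sum]
  refine Finset.sum_congr rfl fun k _ => ?_
  rw [integral_mul_const, integral_complex_ofReal,
    integral_sub_right_eq_self (fun ξ => M.kernel ξ i k), Material.mass]
  ring

end DiracField

/-! ### Reciprocity with the fundamental solution. -/

section FundamentalSolution

variable {M} {s : ℂ} {k : Fin n} {v : DiracField n}

/-- In matrix form, `(ρ s² - 2 mass) c_k = e_k`. Since `mass` is symmetric, pairing `c_k` with this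
matrix applied to a vector extracts the `k`-th component. -/
lemma IsFundamentalSolution.coeff_eq (h : IsFundamentalSolution M s k v) (i : Fin n) :
    M.ρ * s ^ 2 * v.coeff i = (if i = k then 1 else 0) +
      2 * ∑ j, (M.mass i j : ℂ) * v.coeff j := by
  have : Nonempty (Fin n) := ⟨k⟩
  have := h.at_pole i
  rw [v.forceCoeff_eq M] at this
  linear_combination this

lemma IsFundamentalSolution.shift_pole (h : IsFundamentalSolution M s k v) (x₀ : Pt n) :
    (v.shift x₀).pole = x₀ := by simp [h.pole_eq]

lemma IsFundamentalSolution.reg_eq (h : IsFundamentalSolution M s k v) {x₀ x : Pt n} (hx : x ≠ x₀)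
    (i : Fin n) : M.ρ * s ^ 2 * (v.shift x₀).reg x i = M.force (v.shift x₀).reg x i -
      2 * ∑ j, (M.kernel (x - x₀) i j : ℂ) * v.coeff j := by
  have h1 := h.off_pole (x - x₀) (sub_ne_zero.2 hx) i
  rw [v.force_eq M (by rw [h.pole_eq]; exact sub_ne_zero.2 hx), h.pole_eq, sub_zero] at h1
  have h2 : M.force (v.shift x₀).reg x i = M.force v.reg (x - x₀) i := M.force_shift v.reg x₀ x i
  rw [h2, v.shift_reg]
  linear_combination h1

lemma IsFundamentalSolution.shift_reg_integrable (h : IsFundamentalSolution M s k v) (x₀ : Pt n)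
    (i : Fin n) : Integrable fun x => (v.shift x₀).reg x i :=
  (integrable_pi_iff.1 h.integrable i).comp_sub_right x₀

variable {F : Pt n → Fin n → ℂ}

/-- The force at the pole of a fundamental solution acting on its point mass. -/
lemma IsFundamentalSolution.force_dot_coeff (h : IsFundamentalSolution M s k v)
    (hY : MeasurableSet (Ω ∪ collar M.α Ω))
    (hw : ∀ i, AEStronglyMeasurable fun x => w x i)
    (hB : ∀ x ∈ Ω ∪ collar M.α Ω, ∀ i, ‖w x i‖ ≤ B)
    (hF : ∀ x ∈ Ω, ∀ i, M.force w x i + F x i = M.ρ * s ^ 2 * w x i) {x₀ : Pt n} (hx₀ : x₀ ∈ Ω) :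
    IntegrableOn (fun x => w x ⬝ᵥ fun i => ∑ j, (M.kernel (x - x₀) i j : ℂ) * v.coeff j)
      (Ω ∪ collar M.α Ω) ∧
    F x₀ ⬝ᵥ v.coeff = w x₀ k + 2 * ∫ x in Ω ∪ collar M.α Ω,
      w x ⬝ᵥ fun i => ∑ j, (M.kernel (x - x₀) i j : ℂ) * v.coeff j := by
  have hint := fun i j => M.kernel_mul_integrableOn (x₀ := x₀) hY hw hB i j
  have hterm : ∀ x, (w x ⬝ᵥ fun i => ∑ j, (M.kernel (x - x₀) i j : ℂ) * v.coeff j) =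
      ∑ i, ∑ j, v.coeff i * ((M.kernel (x - x₀) i j : ℂ) * w x j) := by
    intro x
    simp only [dotProduct, Finset.mul_sum]
    rw [Finset.sum_comm]
    refine Finset.sum_congr rfl fun i _ => Finset.sum_congr rfl fun j _ => ?_
    rw [M.kernel_symm _ j i]
    ring
  have hforce := fun i => M.force_eq_of_mem hY hw hB hx₀ i
  simp only [hterm]
  have hI : ∀ i j, Integrable (fun x => v.coeff i * ((M.kernel (x - x₀) i j : ℂ) * w x j))
      (volume.restrict (Ω ∪ collar M.α Ω)) := fun i j => (hint i j).const_mul _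
  refine ⟨integrable_finsetSum _ fun i _ => integrable_finsetSum _ fun j _ => hI i j, ?_⟩
  rw [integral_finsetSum _ fun i _ => integrable_finsetSum _ fun j _ => hI i j]
  simp only [fun i => integral_finsetSum Finset.univ fun j _ => hI i j, integral_const_mul]
  have hF' : ∀ i, F x₀ i = M.ρ * s ^ 2 * w x₀ i + 2 * ∑ j,
      ((∫ x in Ω ∪ collar M.α Ω, (M.kernel (x - x₀) i j : ℂ) * w x j) - M.mass i j * w x₀ j) := by
    intro i
    rw [← hF x₀ hx₀ i, hforce]
    ring
  -- The unit vector `e_k` is replaced by the matrix acting on `coeff`; symmetry of `mass` below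
  -- moves the matrix onto `w x₀`, where the equation for `F` produces it.
  have hwk : w x₀ k = ∑ i, w x₀ i * (M.ρ * s ^ 2 * v.coeff i -
      2 * ∑ j, (M.mass i j : ℂ) * v.coeff j) := by
    have : ∀ i, w x₀ i * (M.ρ * s ^ 2 * v.coeff i - 2 * ∑ j, (M.mass i j : ℂ) * v.coeff j) =
        if i = k then w x₀ i else 0 := by
      intro i
      rw [h.coeff_eq i]
      split_ifs <;> ring
    simp [this]
  have hmasssymm : ∑ i, w x₀ i * ∑ j, (M.mass i j : ℂ) * v.coeff j =
      ∑ i, ∑ j, v.coeff i * (M.mass i j * w x₀ j) := by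
    simp only [Finset.mul_sum]
    rw [Finset.sum_comm]
    refine Finset.sum_congr rfl fun i _ => Finset.sum_congr rfl fun j _ => ?_
    have : M.mass j i = M.mass i j := by simp only [Material.mass, M.kernel_symm _ j i]
    rw [this]
    ring
  have e1 : w x₀ k = ∑ i, w x₀ i * (M.ρ * s ^ 2 * v.coeff i) -
      2 * ∑ i, ∑ j, v.coeff i * (M.mass i j * w x₀ j) := by
    rw [hwk, ← hmasssymm, Finset.mul_sum, ← Finset.sum_sub_distrib]
    exact Finset.sum_congr rfl fun i _ => by ring
  rw [e1]
  simp only [dotProduct, hF', add_mul, Finset.sum_add_distrib, Finset.sum_sub_distrib]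
  have e2 : ∑ i, 2 * (∑ j, (∫ x in Ω ∪ collar M.α Ω, (M.kernel (x - x₀) i j : ℂ) * w x j) -
      ∑ j, (M.mass i j : ℂ) * w x₀ j) * v.coeff i =
      2 * ∑ i, ∑ j, v.coeff i * (∫ x in Ω ∪ collar M.α Ω, (M.kernel (x - x₀) i j : ℂ) * w x j) -
      2 * ∑ i, ∑ j, v.coeff i * (M.mass i j * w x₀ j) := by
    simp only [Finset.mul_sum, ← Finset.sum_sub_distrib, Finset.sum_mul]
    exact Finset.sum_congr rfl fun i _ => Finset.sum_congr rfl fun j _ => by ring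
  rw [e2]
  have e3 : ∑ i, (M.ρ : ℂ) * s ^ 2 * w x₀ i * v.coeff i =
      ∑ i, w x₀ i * (M.ρ * s ^ 2 * v.coeff i) := Finset.sum_congr rfl fun i _ => by ring
  rw [e3]
  ring

/-- The reciprocity identity between a state `w` and the fundamental solution with pole in `Ω`. -/
theorem IsFundamentalSolution.reciprocity (h : IsFundamentalSolution M s k v)
    (hΩ : MeasurableSet Ω) (hc : MeasurableSet (collar M.α Ω))
    (hw : ∀ i, AEStronglyMeasurable fun x => w x i)
    (hB : ∀ x ∈ Ω ∪ collar M.α Ω, ∀ i, ‖w x i‖ ≤ B)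
    (hF : ∀ x ∈ Ω, ∀ i, M.force w x i + F x i = M.ρ * s ^ 2 * w x i) {x₀ : Pt n} (hx₀ : x₀ ∈ Ω) :
    IntegrableOn (fun x => F x ⬝ᵥ (v.shift x₀).reg x) Ω ∧
    IntegrableOn (fun x => w x ⬝ᵥ (v.shift x₀).interaction M Ω x) (collar M.α Ω) ∧
    IntegrableOn (fun x => (v.shift x₀).reg x ⬝ᵥ M.interaction Ω w x) (collar M.α Ω) ∧
    w x₀ k = (∫ x in collar M.α Ω, (v.shift x₀).reg x ⬝ᵥ M.interaction Ω w x) -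
      (∫ x in collar M.α Ω, w x ⬝ᵥ (v.shift x₀).interaction M Ω x) +
      (v.shift x₀).pairing Ω F := by
  have : Nonempty (Fin n) := ⟨k⟩
  set r := (v.shift x₀).reg with hr
  obtain ⟨g1, g2, g3⟩ := M.green (hΩ.union hc) hw hB (h.shift_reg_integrable x₀)
  obtain ⟨q1, q2⟩ := h.force_dot_coeff (hΩ.union hc) hw hB hF hx₀
  set Q : Pt n → ℂ := fun x => w x ⬝ᵥ fun i => ∑ j, (M.kernel (x - x₀) i j : ℂ) * v.coeff j with hQ
  have hdisj : Disjoint Ω (collar M.α Ω) := disjoint_left.2 fun x hx hx' => hx'.1 hx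
  have hpole := h.shift_pole x₀
  have hN : ∀ x ∈ collar M.α Ω, w x ⬝ᵥ (v.shift x₀).interaction M Ω x =
      w x ⬝ᵥ M.interaction Ω r x + 2 * Q x := by
    intro x hx
    have hne : x ≠ (v.shift x₀).pole := by
      rw [hpole]
      rintro rfl
      exact hx.1 hx₀
    have : (v.shift x₀).interaction M Ω x = M.interaction Ω r x +
        (2 : ℂ) • fun i => ∑ j, (M.kernel (x - x₀) i j : ℂ) * v.coeff j := by
      ext i
      rw [(v.shift x₀).interaction_eq M hne (by rwa [hpole]), hpole]
      rfl
    rw [this, dotProduct_add, dotProduct_smul, smul_eq_mul]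
  -- The inertia term of the motion is eliminated using the equation for the function part of the
  -- fundamental solution. That equation is available only off the pole, hence almost everywhere.
  have hFr : ∀ᵐ x ∂volume.restrict Ω, F x ⬝ᵥ r x =
      r x ⬝ᵥ M.interaction Ω w x - w x ⬝ᵥ M.interaction Ω r x - 2 * Q x := by
    filter_upwards [ae_restrict_mem hΩ,
      ae_restrict_of_ae (compl_mem_ae_iff.2 (measure_singleton (μ := volume) x₀))] with x hx hne
    have e1 : ∀ i, F x i = M.ρ * s ^ 2 * w x i + M.interaction Ω w x i := fun i => by
      rw [← hF x hx i, M.force_eq_neg_interaction w hx]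
      ring
    have e2 : ∀ i, M.ρ * s ^ 2 * r x i = -M.interaction Ω r x i -
        2 * ∑ j, (M.kernel (x - x₀) i j : ℂ) * v.coeff j := fun i => by
      rw [hr, h.reg_eq hne, M.force_eq_neg_interaction _ hx]
    simp only [dotProduct, hQ, Finset.mul_sum (s := Finset.univ) (a := (2 : ℂ)),
      ← Finset.sum_sub_distrib]
    refine Finset.sum_congr rfl fun i _ => ?_
    rw [e1]
    linear_combination w x i * e2 i
  have m1 : Ω ⊆ Ω ∪ collar M.α Ω := subset_union_left
  have m2 : collar M.α Ω ⊆ Ω ∪ collar M.α Ω := subset_union_right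
  have i1 : IntegrableOn (fun x => F x ⬝ᵥ r x) Ω :=
    (((g2.mono_set m1).sub (g1.mono_set m1)).sub ((q1.mono_set m1).const_mul 2)).congr
      (hFr.mono fun x hx => hx.symm)
  have i2 : IntegrableOn (fun x => w x ⬝ᵥ (v.shift x₀).interaction M Ω x) (collar M.α Ω) :=
    IntegrableOn.congr_fun ((g1.mono_set m2).add ((q1.mono_set m2).const_mul 2))
      (fun x hx => (hN x hx).symm) hc
  refine ⟨i1, i2, g2.mono_set m2, ?_⟩
  have i3 : Integrable (fun x => r x ⬝ᵥ M.interaction Ω w x - w x ⬝ᵥ M.interaction Ω r x)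
      (volume.restrict Ω) := (g2.mono_set m1).sub (g1.mono_set m1)
  unfold DiracField.pairing
  rw [hpole, if_pos hx₀, DiracField.shift_coeff, q2, ← hr, integral_congr_ae hFr,
    integral_sub i3 ((q1.mono_set m1).const_mul 2),
    integral_sub (g2.mono_set m1) (g1.mono_set m1), integral_const_mul,
    setIntegral_congr_fun hc hN, integral_add (g1.mono_set m2) ((q1.mono_set m2).const_mul 2),
    integral_const_mul]
  rw [setIntegral_union hdisj hc (g1.mono_set m1) (g1.mono_set m2),
    setIntegral_union hdisj hc (g2.mono_set m1) (g2.mono_set m2)] at g3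
  rw [setIntegral_union hdisj hc (q1.mono_set m1) (q1.mono_set m2)]
  -- Green's identity exchanges the `Ω` part for the collar part. The integrals of `Q` over `Ω`
  -- cancel, and the one over the collar is the point-mass part of the interaction.
  linear_combination g3

end FundamentalSolution

lemma IsBody.frontier_subset {α : Pt n → Pt n → Fin n → ℝ} {Ωd Ωn : Set (Pt n)}
    {ν : Pt n → Pt n} (h : IsBody α Ω Ωd Ωn ν) : frontier Ω ⊆ Ω :=
  h.compact.isClosed.frontier_subset

lemma IsBody.surface_integral_eq {α : Pt n → Pt n → Fin n → ℝ} {Ωd Ωn : Set (Pt n)}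
    {ν : Pt n → Pt n} (h : IsBody α Ω Ωd Ωn ν) {f : Pt n → ℂ} (hf : Integrable f (surface Ω)) :
    ∫ x, f x ∂surface Ω = (∫ x in localBoundary Ω Ωd, f x ∂surface Ω) +
      ∫ x in localBoundary Ω Ωn, f x ∂surface Ω := by
  have hd : MeasurableSet (localBoundary Ω Ωd) :=
    (isClosed_closure.inter h.compact.isClosed).measurableSet
  have hn : MeasurableSet (localBoundary Ω Ωn) :=
    (isClosed_closure.inter h.compact.isClosed).measurableSet
  have h0 : ∫ x in localBoundary Ω Ωd ∪ localBoundary Ω Ωn, f x ∂surface Ω =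
      ∫ x, f x ∂surface Ω := by
    rw [← h.frontier_eq]
    congr 1
    unfold surface
    rw [Measure.restrict_restrict isClosed_frontier.measurableSet, inter_self]
  rw [← h0, setIntegral_union₀ h.overlap hn.nullMeasurableSet hf.integrableOn hf.integrableOn]

end Reciprocity

/-! ### Continuity of convolutions under translation. -/

section Translation

variable {n : ℕ}

/-- Translation is continuous in `L¹`, and pairing with a bounded function is continuous on `L¹`. -/
lemma continuous_integral_translate_mul {f g : Pt n → ℂ} {B : ℝ} (hf : Integrable f)
    (hg : AEStronglyMeasurable g) (hB : ∀ᵐ z, ‖g z‖ ≤ B) :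
    Continuous fun y => ∫ z, f (z - y) * g z := by
  have hmem : MemLp f 1 := memLp_one_iff_integrable.2 hf
  let τ : Pt n → C(Pt n, Pt n) := fun y => ⟨fun z => z - y, by fun_prop⟩
  have hτ : Continuous τ := by
    have : Continuous fun p : Pt n × Pt n => p.2 - p.1 := by fun_prop
    exact (ContinuousMap.mk _ this).curry.continuous
  have hmp : ∀ y, MeasurePreserving (τ y) (volume : Measure (Pt n)) volume :=
    fun y => measurePreserving_sub_right volume y
  have hcont : Continuous fun y => Lp.compMeasurePreserving (τ y) (hmp y) (hmem.toLp f) :=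
    continuous_const.compMeasurePreservingLp hτ hmp (by simp)
  have hint : ∀ y, Integrable fun z => f (z - y) * g z := fun y =>
    (hf.comp_sub_right y).mul_bdd (c := B) hg hB
  rw [continuous_iff_continuousAt]
  intro y₀
  have hlim := tendsto_iff_norm_sub_tendsto_zero.1 (hcont.tendsto y₀)
  rw [ContinuousAt, tendsto_iff_norm_sub_tendsto_zero]
  refine squeeze_zero (fun _ => norm_nonneg _) (fun y => ?_) (by simpa using hlim.const_mul B)
  rw [← integral_sub (hint y) (hint y₀)]
  have hd : Integrable fun z => f (z - y) - f (z - y₀) :=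
    (hf.comp_sub_right y).sub (hf.comp_sub_right y₀)
  have hnorm : ‖Lp.compMeasurePreserving (τ y) (hmp y) (hmem.toLp f) -
      Lp.compMeasurePreserving (τ y₀) (hmp y₀) (hmem.toLp f)‖ =
      ∫ z, ‖f (z - y) - f (z - y₀)‖ := by
    rw [L1.norm_eq_integral_norm]
    refine integral_congr_ae ?_
    filter_upwards [Lp.coeFn_sub (Lp.compMeasurePreserving (τ y) (hmp y) (hmem.toLp f))
        (Lp.compMeasurePreserving (τ y₀) (hmp y₀) (hmem.toLp f)),
      Lp.coeFn_compMeasurePreserving (hmem.toLp f) (hmp y),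
      Lp.coeFn_compMeasurePreserving (hmem.toLp f) (hmp y₀),
      (hmp y).quasiMeasurePreserving.ae (hmem.coeFn_toLp),
      (hmp y₀).quasiMeasurePreserving.ae (hmem.coeFn_toLp)] with z h1 h2 h3 h4 h5
    rw [h1, Pi.sub_apply, h2, h3, Function.comp_apply, Function.comp_apply, h4, h5]
    rfl
  rw [hnorm, ← integral_const_mul]
  refine norm_integral_le_of_norm_le (hd.norm.const_mul B) ?_
  filter_upwards [hB] with z hz
  rw [← sub_mul, norm_mul, mul_comm]
  gcongr

end Translation

/-! ### Weakly singular potentials. -/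

section Riesz

/-- The weakly singular majorant `1 + |z|^{-γ}`, infinite at the origin if `γ > 0`. -/
def singularMajorant {n : ℕ} (γ : ℝ) (z : Pt n) : ℝ≥0∞ := 1 + ‖z‖ₑ ^ (-γ)

variable {n : ℕ} {γ : ℝ}

lemma singularMajorant_measurable : Measurable (singularMajorant (n := n) γ) := by
  unfold singularMajorant
  fun_prop

lemma one_le_singularMajorant (z : Pt n) : 1 ≤ singularMajorant γ z := le_self_add

lemma singularMajorant_le (hγ : 0 ≤ γ) {y z : Pt n} (h : ‖y‖ ≤ 2 * ‖z‖) :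
    singularMajorant γ z ≤ 2 ^ γ * singularMajorant γ y := by
  have h2 : (1 : ℝ≥0∞) ≤ 2 ^ γ := by
    simpa using ENNReal.rpow_le_rpow_of_exponent_le one_le_two hγ
  have h0 : (2 : ℝ≥0∞) ^ γ ≠ 0 := by positivity
  have ht : (2 : ℝ≥0∞) ^ γ ≠ ∞ := ENNReal.rpow_ne_top_of_nonneg hγ (by simp)
  have he : ‖y‖ₑ ≤ 2 * ‖z‖ₑ := by
    have := ENNReal.ofReal_le_ofReal h
    rwa [ENNReal.ofReal_mul zero_le_two, ENNReal.ofReal_ofNat, ofReal_norm, ofReal_norm] at this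
  unfold singularMajorant
  rw [mul_add, mul_one]
  refine add_le_add h2 ?_
  rw [ENNReal.rpow_neg, ENNReal.rpow_neg]
  calc (‖z‖ₑ ^ γ)⁻¹ = 2 ^ γ * (2 ^ γ * ‖z‖ₑ ^ γ)⁻¹ := by
        rw [ENNReal.mul_inv (Or.inl h0) (Or.inl ht), ← mul_assoc, ENNReal.mul_inv_cancel h0 ht,
          one_mul]
    _ ≤ 2 ^ γ * (‖y‖ₑ ^ γ)⁻¹ := by
        gcongr
        rw [← ENNReal.mul_rpow_of_nonneg _ _ hγ]
        gcongr

lemma singularMajorant_ne_top {z : Pt n} (hz : z ≠ 0) : singularMajorant γ z ≠ ∞ := by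
  unfold singularMajorant
  refine ENNReal.add_ne_top.2 ⟨by simp, ?_⟩
  exact ENNReal.rpow_ne_top_of_ne_zero (by simpa using hz) (by simp)

/-- Outside of a ball the majorant is bounded. -/
lemma singularMajorant_le_of_le (hγ : 0 ≤ γ) {ε : ℝ} (hε : 0 < ε) :
    ∃ C : ℝ≥0∞, C ≠ ∞ ∧ ∀ z : Pt n, ε ≤ ‖z‖ → singularMajorant γ z ≤ C := by
  refine ⟨1 + (ENNReal.ofReal ε) ^ (-γ), ENNReal.add_ne_top.2 ⟨by simp,
    ENNReal.rpow_ne_top_of_ne_zero (by simpa using hε) (by simp)⟩, fun z hz => ?_⟩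
  unfold singularMajorant
  rw [ENNReal.rpow_neg, ENNReal.rpow_neg, ← ofReal_norm]
  gcongr

lemma singularMajorant_eq_ofReal {z : Pt n} (hz : z ≠ 0) :
    singularMajorant γ z = ENNReal.ofReal (1 + ‖z‖ ^ (-γ)) := by
  unfold singularMajorant
  rw [← ofReal_norm, ENNReal.ofReal_rpow_of_pos (norm_pos_iff.2 hz),
    ENNReal.ofReal_add zero_le_one (by positivity), ENNReal.ofReal_one]

/-- Weakly singular functions are uniformly integrable over small balls with respect to an upper
Ahlfors regular measure. -/
lemma exists_ball_lintegral_le (hγ : 0 ≤ γ) {d : ℕ} (hd : γ < d) {μ : Measure (Pt n)} {c : ℝ}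
    (hμ : ∀ (y : Pt n) (r : ℝ), 0 < r → μ (Metric.ball y r) ≤ ENNReal.ofReal (c * r ^ d))
    {δ : ℝ≥0∞} (hδ : δ ≠ 0) :
    ∃ ε : ℝ, 0 < ε ∧ ∀ y, ∫⁻ z in Metric.ball y ε, singularMajorant γ (z - y) ∂μ ≤ δ := by
  -- On the shell of radius about `2^{-j}` the majorant grows like `2^{γj}` and the measure decays
  -- like `2^{-dj}`; `q` is the resulting ratio, below one because `γ < d`.
  set q : ℝ := (1 / 2 : ℝ) ^ (-γ) * (1 / 2) ^ d with hq
  have hq0 : 0 ≤ q := by positivity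
  have hq1 : q < 1 := by
    rw [hq, ← Real.rpow_natCast, ← Real.rpow_add (by norm_num)]
    exact Real.rpow_lt_one (by norm_num) (by norm_num) (by linarith)
  -- `a j` bounds the majorant on the shell between radii `2^{-(j+1)}` and `2^{-j}`. The radius in
  -- `b j` is doubled so that an open ball contains the closed outer edge of the shell.
  set a : ℕ → ℝ≥0∞ := fun j => ENNReal.ofReal (1 + ((1 / 2 : ℝ) ^ (j + 1)) ^ (-γ)) with ha
  set b : ℕ → ℝ≥0∞ := fun j => a j * ENNReal.ofReal (c * (2 * (1 / 2 : ℝ) ^ j) ^ d) with hb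
  have hpow : ∀ j : ℕ, ((1 / 2 : ℝ) ^ j) ^ (-γ) = ((1 / 2 : ℝ) ^ (-γ)) ^ j := fun j => by
    rw [← Real.rpow_natCast, ← Real.rpow_mul (by norm_num), mul_comm, Real.rpow_mul (by norm_num),
      Real.rpow_natCast]
  have hone : ∀ j : ℕ, (1 : ℝ) ≤ ((1 / 2 : ℝ) ^ (j + 1)) ^ (-γ) := fun j =>
    Real.one_le_rpow_of_pos_of_le_one_of_nonpos (by positivity)
      (pow_le_one₀ (by norm_num) (by norm_num)) (by linarith)
  have hbsum : ∑' j, b j ≠ ∞ := by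
    have hle : ∀ j, b j ≤ ENNReal.ofReal ((2 * (1 / 2 : ℝ) ^ (-γ) * (|c| * 2 ^ d)) * q ^ j) := by
      intro j
      rw [hb]
      simp only [ha]
      rw [← ENNReal.ofReal_mul (by positivity)]
      refine ENNReal.ofReal_le_ofReal ?_
      have h1 : 1 + ((1 / 2 : ℝ) ^ (j + 1)) ^ (-γ) ≤
          2 * ((1 / 2 : ℝ) ^ (-γ) * ((1 / 2 : ℝ) ^ (-γ)) ^ j) := by
        have h3 := hone j
        rw [hpow] at h3 ⊢
        rw [pow_succ, mul_comm] at h3 ⊢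
        linarith
      have h2 : c * (2 * (1 / 2 : ℝ) ^ j) ^ d ≤ |c| * 2 ^ d * ((1 / 2) ^ d) ^ j := by
        rw [mul_pow, ← pow_mul, mul_comm j d, pow_mul, mul_assoc]
        gcongr
        exact le_abs_self c
      calc (1 + ((1 / 2 : ℝ) ^ (j + 1)) ^ (-γ)) * (c * (2 * (1 / 2 : ℝ) ^ j) ^ d) ≤
          (1 + ((1 / 2 : ℝ) ^ (j + 1)) ^ (-γ)) * (|c| * 2 ^ d * ((1 / 2) ^ d) ^ j) := by gcongr
        _ ≤ 2 * ((1 / 2 : ℝ) ^ (-γ) * ((1 / 2 : ℝ) ^ (-γ)) ^ j) *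
            (|c| * 2 ^ d * ((1 / 2) ^ d) ^ j) := by gcongr
        _ = _ := by rw [hq, mul_pow]; ring
    refine ne_top_of_le_ne_top ?_ (ENNReal.tsum_le_tsum hle)
    exact ((summable_geometric_of_lt_one hq0 hq1).mul_left _).tsum_ofReal_ne_top
  -- The ball of radius `2^{-N}` meets only shells of index at least `N`, so a tail of the series
  -- controls the integral, uniformly in the centre.
  obtain ⟨N, hN⟩ := ((ENNReal.tendsto_sum_nat_add b hbsum).eventually
    (ge_mem_nhds (pos_iff_ne_zero.2 hδ))).exists
  refine ⟨(1 / 2) ^ N, by positivity, fun y => ?_⟩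
  set φ : Pt n → ℝ≥0∞ := fun z => ∑' j, (Metric.ball y (2 * (1 / 2 : ℝ) ^ (j + N))).indicator
    (fun _ => a (j + N)) z with hφ
  have hpt : ∀ z ∈ Metric.ball y ((1 / 2 : ℝ) ^ N), singularMajorant γ (z - y) ≤ φ z := by
    intro z hz
    by_cases hzy : z = y
    -- At the centre the majorant may be infinite, but all balls contain the centre and every term
    -- is at least one, so `φ` is infinite too.
    · have hle : ∑' _ : ℕ, (1 : ℝ≥0∞) ≤ φ z := by
        refine ENNReal.tsum_le_tsum fun j => ?_
        rw [hzy, indicator_of_mem (Metric.mem_ball_self (by positivity))]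
        rw [ha, ← ENNReal.ofReal_one]
        refine ENNReal.ofReal_le_ofReal ?_
        have := hone (j + N)
        linarith
      rw [ENNReal.tsum_const_eq_top_of_ne_zero one_ne_zero] at hle
      exact le_top.trans hle
    · rw [mem_ball_iff_norm] at hz
      have hpos : 0 < ‖z - y‖ := norm_pos_iff.2 (sub_ne_zero.2 hzy)
      obtain ⟨j, hj1, hj2⟩ := exists_nat_pow_near_of_lt_one hpos
        (hz.le.trans (pow_le_one₀ (by norm_num) (by norm_num)))
        (by norm_num : (0 : ℝ) < 1 / 2) (by norm_num)
      have hNj : N ≤ j := by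
        have := (pow_lt_pow_iff_right_of_lt_one₀ (by norm_num : (0 : ℝ) < 1 / 2)
          (by norm_num)).1 (hj1.trans hz)
        omega
      obtain ⟨i, rfl⟩ := Nat.exists_eq_add_of_le' hNj
      refine le_trans ?_ (ENNReal.le_tsum i)
      have hmem : z ∈ Metric.ball y (2 * (1 / 2 : ℝ) ^ (i + N)) := by
        rw [mem_ball_iff_norm]
        have : (0 : ℝ) < (1 / 2) ^ (i + N) := by positivity
        linarith
      rw [indicator_of_mem hmem, singularMajorant_eq_ofReal (sub_ne_zero.2 hzy)]
      refine ENNReal.ofReal_le_ofReal ?_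
      gcongr 1 + ?_
      exact Real.rpow_le_rpow_of_nonpos (by positivity) hj1.le (by linarith)
  calc ∫⁻ z in Metric.ball y ((1 / 2 : ℝ) ^ N), singularMajorant γ (z - y) ∂μ
      ≤ ∫⁻ z in Metric.ball y ((1 / 2 : ℝ) ^ N), φ z ∂μ :=
        setLIntegral_mono' Metric.isOpen_ball.measurableSet hpt
    _ ≤ ∫⁻ z, φ z ∂μ := setLIntegral_le_lintegral _ _
    _ = ∑' j, a (j + N) * μ (Metric.ball y (2 * (1 / 2 : ℝ) ^ (j + N))) := by
        rw [hφ, lintegral_tsum fun j =>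
          (measurable_const.indicator Metric.isOpen_ball.measurableSet).aemeasurable]
        simp only [lintegral_indicator_const Metric.isOpen_ball.measurableSet]
    _ ≤ ∑' j, b (j + N) := ENNReal.tsum_le_tsum fun j => by
        simp only [hb]
        gcongr
        exact hμ y _ (by positivity)
    _ ≤ δ := hN

lemma volume_ball_le (y : Pt n) (r : ℝ) (hr : 0 < r) : (volume : Measure (Pt n)) (Metric.ball y r) ≤
    ENNReal.ofReal ((volume (Metric.ball (0 : Pt n) 1)).toReal * r ^ n) := by
  rw [Measure.addHaar_ball_of_pos _ _ hr, finrank_euclideanSpace_fin, mul_comm,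
    ENNReal.ofReal_mul ENNReal.toReal_nonneg, ENNReal.ofReal_toReal measure_ball_lt_top.ne]

/-- Integrals of products of two majorants over small balls. -/
lemma ball_lintegral_mul_le (hγ : 0 ≤ γ) {δ : ℝ≥0∞} {ε : ℝ}
    (hε : ∀ y : Pt n, ∫⁻ z in Metric.ball y ε, singularMajorant γ (z - y) ≤ δ) (y : Pt n) :
    ∫⁻ z in Metric.ball y ε, singularMajorant γ (z - y) * singularMajorant γ z ≤
      2 ^ γ * (2 * δ) * singularMajorant γ y := by
  have hpt : ∀ z ∈ Metric.ball y ε, singularMajorant γ (z - y) * singularMajorant γ z ≤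
      2 ^ γ * singularMajorant γ y * (singularMajorant γ (z - y) +
        (Metric.ball (0 : Pt n) ε).indicator (singularMajorant γ) z) := by
    intro z hz
    rw [mem_ball_iff_norm] at hz
    -- At least one factor is comparable with the majorant at `y`. If `z` is not far enough from the
    -- origin, then `|z| < |z - y|`: the first factor is comparable, and `z` lies in the `ε`-ball
    -- about the origin.
    rcases le_or_gt ‖y‖ (2 * ‖z‖) with h | h
    · calc singularMajorant γ (z - y) * singularMajorant γ z
          ≤ singularMajorant γ (z - y) * (2 ^ γ * singularMajorant γ y) := by
            gcongr
            exact singularMajorant_le hγ h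
        _ = 2 ^ γ * singularMajorant γ y * singularMajorant γ (z - y) := mul_comm _ _
        _ ≤ _ := by gcongr; exact le_self_add
    · have h1 : ‖y‖ ≤ ‖z‖ + ‖z - y‖ := by
        have := norm_sub_le z (z - y)
        rwa [sub_sub_cancel] at this
      have hmem : z ∈ Metric.ball (0 : Pt n) ε := by
        rw [mem_ball_zero_iff]
        linarith
      rw [indicator_of_mem hmem]
      calc singularMajorant γ (z - y) * singularMajorant γ z
          ≤ (2 ^ γ * singularMajorant γ y) * singularMajorant γ z := by
            gcongr
            exact singularMajorant_le hγ (by linarith)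
        _ ≤ _ := by gcongr; exact le_add_self
  have hmeas : Measurable fun z : Pt n => singularMajorant γ (z - y) :=
    singularMajorant_measurable.comp (measurable_id.sub_const y)
  have hmeas' : Measurable ((Metric.ball (0 : Pt n) ε).indicator (singularMajorant γ)) :=
    singularMajorant_measurable.indicator Metric.isOpen_ball.measurableSet
  calc _ ≤ ∫⁻ z in Metric.ball y ε, 2 ^ γ * singularMajorant γ y * (singularMajorant γ (z - y) +
        (Metric.ball (0 : Pt n) ε).indicator (singularMajorant γ) z) :=
        setLIntegral_mono' Metric.isOpen_ball.measurableSet hpt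
    _ = 2 ^ γ * singularMajorant γ y * (∫⁻ z in Metric.ball y ε, singularMajorant γ (z - y) +
        (Metric.ball (0 : Pt n) ε).indicator (singularMajorant γ) z) :=
        lintegral_const_mul _ (hmeas.add hmeas')
    _ ≤ 2 ^ γ * singularMajorant γ y * (δ + δ) := by
        rw [lintegral_add_left hmeas]
        gcongr
        · exact hε y
        · refine (setLIntegral_le_lintegral _ _).trans ?_
          rw [lintegral_indicator Metric.isOpen_ball.measurableSet]
          simpa using hε 0
    _ = _ := by rw [two_mul]; ring

/-- The truncated potential is convolution with a kernel of total mass at most `δ`; Tonelli gives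
the `L¹` bound. -/
lemma lintegral_ball_lintegral_le {δ : ℝ≥0∞} {ε : ℝ}
    (hε : ∀ y : Pt n, ∫⁻ z in Metric.ball y ε, singularMajorant γ (z - y) ≤ δ) {f : Pt n → ℝ≥0∞}
    (hf : AEMeasurable f) :
    ∫⁻ y, ∫⁻ z in Metric.ball y ε, singularMajorant γ (z - y) * f z ≤ δ * ∫⁻ z, f z := by
  have e : ∀ y, ∫⁻ z in Metric.ball y ε, singularMajorant γ (z - y) * f z =
      ∫⁻ z, (Metric.ball (0 : Pt n) ε).indicator (singularMajorant γ) (z - y) * f z := by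
    intro y
    rw [← lintegral_indicator Metric.isOpen_ball.measurableSet]
    refine lintegral_congr fun z => ?_
    by_cases h : ‖z - y‖ < ε
    · rw [indicator_of_mem (by rwa [mem_ball_iff_norm]),
        indicator_of_mem (by rwa [mem_ball_zero_iff])]
    · rw [indicator_of_notMem (by rwa [mem_ball_iff_norm]),
        indicator_of_notMem (by rwa [mem_ball_zero_iff]), zero_mul]
  have hk : Measurable ((Metric.ball (0 : Pt n) ε).indicator (singularMajorant γ)) :=
    singularMajorant_measurable.indicator Metric.isOpen_ball.measurableSet
  simp only [e]
  rw [lintegral_lintegral_swap]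
  · have e2 : ∀ z, ∫⁻ y, (Metric.ball (0 : Pt n) ε).indicator (singularMajorant γ) (z - y) * f z ≤
        δ * f z := by
      intro z
      have hkz : Measurable fun y => (Metric.ball (0 : Pt n) ε).indicator (singularMajorant γ)
          (z - y) := hk.comp (measurable_const.sub measurable_id)
      rw [lintegral_mul_const _ hkz]
      gcongr
      rw [lintegral_sub_left_eq_self (fun x => (Metric.ball (0 : Pt n) ε).indicator
        (singularMajorant γ) x) z, lintegral_indicator Metric.isOpen_ball.measurableSet]
      simpa using hε 0
    exact (lintegral_mono e2).trans (lintegral_const_mul'' _ hf).le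
  · exact (hk.comp (measurable_snd.sub measurable_fst)).aemeasurable.mul hf.comp_snd

/-- An integrable function that is bounded by a weakly singular function plus its weakly singular
potential is bounded by a weakly singular function, and so is its potential. -/
theorem singular_bound_of_le_potential (hγ : 0 ≤ γ) (hγn : γ < n) {φ : Pt n → ℝ≥0∞}
    (hφ : AEMeasurable φ) (hφint : ∫⁻ z, φ z ≠ ∞) {C : ℝ≥0∞} (hC : C ≠ ∞)
    (hle : ∀ᵐ y, φ y ≤ C * singularMajorant γ y + C * ∫⁻ z, singularMajorant γ (z - y) * φ z) :
    ∃ D : ℝ≥0∞, D ≠ ∞ ∧ (∀ᵐ y, φ y ≤ D * singularMajorant γ y) ∧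
      ∀ y, ∫⁻ z, singularMajorant γ (z - y) * φ z ≤ D * singularMajorant γ y := by
  have h2t : (2 : ℝ≥0∞) ^ γ ≠ ∞ := ENNReal.rpow_ne_top_of_nonneg hγ (by simp)
  -- With `δ = 1 / (2A)` the near part of the potential, multiplied by `C`, has norm at most one
  -- half both on `L¹` and on functions bounded by the majorant. The summand `1` keeps `A` nonzero.
  set A : ℝ≥0∞ := C * (2 ^ γ * 2) + C + 1 with hA
  have hAt : A ≠ ∞ := by
    simp [hA, ENNReal.mul_eq_top, hC, h2t]
  have hA0 : A ≠ 0 := by simp [hA]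
  set δ : ℝ≥0∞ := A⁻¹ * 2⁻¹ with hδ
  have hδ0 : δ ≠ 0 := by simp [hδ, hAt]
  have hAδ : A * δ = 2⁻¹ := by rw [hδ, ← mul_assoc, ENNReal.mul_inv_cancel hA0 hAt, one_mul]
  have hδt : δ ≠ ∞ := by simp [hδ, ENNReal.mul_eq_top, hA0]
  have hCδ : C * δ ≤ 2⁻¹ := by
    rw [← hAδ, hA]
    gcongr
    exact le_add_self.trans le_self_add
  have hCδ' : C * (2 ^ γ * (2 * δ)) ≤ 2⁻¹ := by
    rw [← hAδ, hA, ← mul_assoc (2 ^ γ), ← mul_assoc]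
    gcongr
    exact le_self_add.trans le_self_add
  obtain ⟨ε, hε0, hε⟩ := exists_ball_lintegral_le hγ hγn (volume_ball_le (n := n)) hδ0
  obtain ⟨E, hE, hEle⟩ := singularMajorant_le_of_le (n := n) hγ hε0
  set J : (Pt n → ℝ≥0∞) → Pt n → ℝ≥0∞ := fun f y =>
    ∫⁻ z in Metric.ball y ε, singularMajorant γ (z - y) * f z with hJ
  set I := ∫⁻ z, φ z with hI
  have hsplit : ∀ y, ∫⁻ z, singularMajorant γ (z - y) * φ z ≤ E * I + J φ y := by
    intro y
    rw [← lintegral_add_compl _ (Metric.isOpen_ball (x := y) (ε := ε)).measurableSet, add_comm]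
    refine add_le_add ?_ le_rfl
    calc _ ≤ ∫⁻ z in (Metric.ball y ε)ᶜ, E * φ z := by
          refine setLIntegral_mono' Metric.isOpen_ball.measurableSet.compl fun z hz => ?_
          gcongr
          refine hEle _ ?_
          rw [mem_compl_iff, mem_ball_iff_norm, not_lt] at hz
          exact hz
      _ ≤ ∫⁻ z, E * φ z := setLIntegral_le_lintegral _ _
      _ = E * I := lintegral_const_mul' _ _ hE
  set C₁ : ℝ≥0∞ := C + C * (E * I) with hC₁
  have hC₁t : C₁ ≠ ∞ := by simp [hC₁, ENNReal.mul_eq_top, hC, hE, hφint]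
  -- This is the excess of `φ` over the expected bound. The factor `2` closes the absorption: `C *
  -- J` maps `2 C₁` times the majorant below `C₁` times it, leaving `C₁` for the far part and the
  -- source.
  set ψ : Pt n → ℝ≥0∞ := fun y => φ y - 2 * C₁ * singularMajorant γ y with hψ
  have hψm : AEMeasurable ψ := hφ.sub (singularMajorant_measurable.const_mul _).aemeasurable
  have hJ1 : ∀ y, C * J φ y ≤ C * J ψ y + C₁ * singularMajorant γ y := by
    intro y
    have hm : Measurable fun z : Pt n => singularMajorant γ (z - y) :=
      singularMajorant_measurable.comp (measurable_id.sub_const y)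
    have hmm : Measurable fun z : Pt n => singularMajorant γ (z - y) * singularMajorant γ z :=
      hm.mul singularMajorant_measurable
    have h1 : J φ y ≤ J ψ y + 2 * C₁ * (2 ^ γ * (2 * δ) * singularMajorant γ y) := by
      calc J φ y ≤ ∫⁻ z in Metric.ball y ε, (singularMajorant γ (z - y) * ψ z + 2 * C₁ *
            (singularMajorant γ (z - y) * singularMajorant γ z)) := by
            refine lintegral_mono fun z => ?_
            calc singularMajorant γ (z - y) * φ z ≤ singularMajorant γ (z - y) *
                (ψ z + 2 * C₁ * singularMajorant γ z) := by
                  gcongr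
                  exact le_tsub_add
              _ = _ := by ring
        _ = J ψ y + 2 * C₁ * ∫⁻ z in Metric.ball y ε,
            (singularMajorant γ (z - y) * singularMajorant γ z) := by
            rw [lintegral_add_right _ (hmm.const_mul _), lintegral_const_mul _ hmm]
        _ ≤ _ := by
            gcongr
            exact ball_lintegral_mul_le hγ hε y
    calc C * J φ y ≤ C * (J ψ y + 2 * C₁ * (2 ^ γ * (2 * δ) * singularMajorant γ y)) := by gcongr
      _ = C * J ψ y + (C * (2 ^ γ * (2 * δ))) * 2 * (C₁ * singularMajorant γ y) := by ring
      _ ≤ C * J ψ y + 2⁻¹ * 2 * (C₁ * singularMajorant γ y) := by gcongr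
      _ = _ := by rw [ENNReal.inv_mul_cancel (by simp) (by simp), one_mul]
  have hψle : ∀ᵐ y, ψ y ≤ C * J ψ y := by
    filter_upwards [hle] with y hy
    refine tsub_le_iff_right.2 ?_
    calc φ y ≤ C * singularMajorant γ y + C * ∫⁻ z, singularMajorant γ (z - y) * φ z := hy
      _ ≤ C * singularMajorant γ y + C * (E * I + J φ y) := by gcongr; exact hsplit y
      _ = C * singularMajorant γ y + C * (E * I) * 1 + C * J φ y := by ring
      _ ≤ C * singularMajorant γ y + C * (E * I) * singularMajorant γ y +
          (C * J ψ y + C₁ * singularMajorant γ y) := by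
          gcongr
          · exact one_le_singularMajorant y
          · exact hJ1 y
      _ = _ := by rw [hC₁]; ring
  -- The excess is at most `C * J ψ`, so its finite integral is at most half of itself.
  have hψ0 : ∫⁻ y, ψ y = 0 := by
    have h1 : ∫⁻ y, ψ y ≤ 2⁻¹ * ∫⁻ y, ψ y := by
      calc ∫⁻ y, ψ y ≤ ∫⁻ y, C * J ψ y := lintegral_mono_ae hψle
        _ = C * ∫⁻ y, J ψ y := lintegral_const_mul' _ _ hC
        _ ≤ C * (δ * ∫⁻ y, ψ y) := by gcongr; exact lintegral_ball_lintegral_le hε hψm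
        _ = (C * δ) * ∫⁻ y, ψ y := by ring
        _ ≤ _ := by gcongr
    have hfin : ∫⁻ y, ψ y ≠ ∞ :=
      ne_top_of_le_ne_top hφint (lintegral_mono fun y => tsub_le_self)
    by_contra hne
    have h3 : (2 : ℝ≥0∞)⁻¹ * ∫⁻ y, ψ y < 1 * ∫⁻ y, ψ y :=
      (ENNReal.mul_lt_mul_iff_left hne hfin).2 (by simp [ENNReal.inv_lt_one])
    rw [one_mul] at h3
    exact absurd h1 (not_le.2 h3)
  have hφle : ∀ᵐ y, φ y ≤ 2 * C₁ * singularMajorant γ y := by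
    filter_upwards [(lintegral_eq_zero_iff' hψm).1 hψ0] with y hy
    exact tsub_eq_zero_iff_le.1 hy
  set D : ℝ≥0∞ := 2 * C₁ + (E * I + 2 * C₁ * (2 ^ γ * (2 * δ))) with hD
  refine ⟨D, by simp [hD, ENNReal.mul_eq_top, hC₁t, hE, hφint, h2t, hδt], ?_, fun y => ?_⟩
  · filter_upwards [hφle] with y hy
    refine hy.trans ?_
    rw [hD]
    gcongr
    exact le_self_add
  -- The bound on `φ` holds only almost everywhere, but it enters under the integral, so the
  -- potential is bounded at every point.
  · have h1 : J φ y ≤ 2 * C₁ * (2 ^ γ * (2 * δ) * singularMajorant γ y) := by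
      calc J φ y ≤ ∫⁻ z in Metric.ball y ε, 2 * C₁ *
            (singularMajorant γ (z - y) * singularMajorant γ z) := by
            refine lintegral_mono_ae ?_
            filter_upwards [ae_restrict_of_ae hφle] with z hz
            calc singularMajorant γ (z - y) * φ z ≤ singularMajorant γ (z - y) *
                (2 * C₁ * singularMajorant γ z) := by gcongr
              _ = _ := by ring
        _ = 2 * C₁ * ∫⁻ z in Metric.ball y ε, singularMajorant γ (z - y) * singularMajorant γ z :=
            lintegral_const_mul' _ _ (ENNReal.mul_ne_top (by simp) hC₁t)
        _ ≤ _ := by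
            gcongr
            exact ball_lintegral_mul_le hγ hε y
    calc _ ≤ E * I + J φ y := hsplit y
      _ ≤ E * I * singularMajorant γ y + 2 * C₁ * (2 ^ γ * (2 * δ) * singularMajorant γ y) :=
          add_le_add (le_mul_of_one_le_right' (one_le_singularMajorant y)) h1
      _ = (E * I + 2 * C₁ * (2 ^ γ * (2 * δ))) * singularMajorant γ y := by ring
      _ ≤ _ := mul_le_mul' (hD ▸ le_add_self) le_rfl

end Riesz

/-! ### Continuity of convolutions off the origin. -/

section Convolution

variable {n : ℕ}

/-- For `y` near `y₀ ≠ 0` the singularities of the two factors sit at distinct points. Cutting `g`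
at a small ball leaves, in each piece, an integrable factor and a bounded one. -/
lemma continuousAt_integral_translate_mul {f g : Pt n → ℂ} (hf : Integrable f) (hg : Integrable g)
    (hfb : ∀ ε : ℝ, 0 < ε → ∃ B, ∀ z, ε ≤ ‖z‖ → ‖f z‖ ≤ B)
    (hgb : ∀ ε : ℝ, 0 < ε → ∃ B, ∀ z, ε ≤ ‖z‖ → ‖g z‖ ≤ B) {y₀ : Pt n} (hy₀ : y₀ ≠ 0) :
    ContinuousAt (fun y => ∫ z, f (z - y) * g z) y₀ := by
  set δ : ℝ := ‖y₀‖ / 3 with hδ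
  have hy : 0 < ‖y₀‖ := norm_pos_iff.2 hy₀
  have hδ0 : 0 < δ := by positivity
  obtain ⟨Bf, hBf⟩ := hfb δ hδ0
  obtain ⟨Bg, hBg⟩ := hgb δ hδ0
  set s : Set (Pt n) := Metric.ball 0 δ with hs
  have hsm : MeasurableSet s := Metric.isOpen_ball.measurableSet
  have hbound : ∀ {h : Pt n → ℂ} {B : ℝ}, (∀ z, δ ≤ ‖z‖ → ‖h z‖ ≤ B) →
      ∀ z, ‖sᶜ.indicator h z‖ ≤ |B| := by
    intro h B hB z
    by_cases hz : z ∈ s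
    · rw [indicator_of_notMem (by simpa using hz)]
      simp
    · rw [indicator_of_mem hz]
      rw [hs, mem_ball_zero_iff, not_lt] at hz
      exact (hB z hz).trans (le_abs_self B)
  have c1 : Continuous fun y => ∫ z, f (z - y) * sᶜ.indicator g z :=
    continuous_integral_translate_mul hf (hg.indicator hsm.compl).aestronglyMeasurable
      (Eventually.of_forall (hbound hBg))
  have c2 : Continuous fun y => ∫ z, s.indicator g (z - y) * sᶜ.indicator f z :=
    continuous_integral_translate_mul (hg.indicator hsm)
      (hf.indicator hsm.compl).aestronglyMeasurable (Eventually.of_forall (hbound hBf))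
  refine (c1.add (c2.comp continuous_neg)).continuousAt.congr ?_
  have hnear : ∀ᶠ y in 𝓝 y₀, 2 * δ < ‖y‖ :=
    continuous_norm.continuousAt.eventually (lt_mem_nhds (by simp only [hδ]; linarith))
  filter_upwards [hnear] with y hy2
  -- For `|y| > 2δ` and `|z| < δ` one has `|z - y| ≥ δ`, so truncating `f` changes nothing where the
  -- inner part of `g` lives.
  have e : ∀ z, f (z - y) * g z =
      f (z - y) * sᶜ.indicator g z + sᶜ.indicator f (z - y) * s.indicator g z := by
    intro z
    by_cases hz : z ∈ s
    · rw [indicator_of_notMem (by simpa using hz), indicator_of_mem hz, indicator_of_mem]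
      · ring
      · rw [hs, mem_ball_zero_iff] at hz
        rw [mem_compl_iff, hs, mem_ball_zero_iff, not_lt]
        have := norm_sub_norm_le y z
        rw [norm_sub_rev] at this
        linarith
    · rw [indicator_of_mem (show z ∈ sᶜ from hz), indicator_of_notMem hz]
      ring
  have i1 : Integrable fun z => f (z - y) * sᶜ.indicator g z :=
    (hf.comp_sub_right y).mul_bdd (hg.indicator hsm.compl).aestronglyMeasurable
      (Eventually.of_forall (hbound hBg))
  have i2 : Integrable fun z => sᶜ.indicator f (z - y) * s.indicator g z :=
    (hg.indicator hsm).bdd_mul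
      ((hf.indicator hsm.compl).comp_sub_right y).aestronglyMeasurable
      (Eventually.of_forall fun z => hbound hBf (z - y))
  simp only [e]
  rw [integral_add i1 i2]
  refine congrArg₂ (fun a b : ℂ => a + b) rfl ?_
  -- The substitution `z ↦ z - y` puts the translation on the integrable factor `g`; this is why
  -- `c2` is used at `-y`.
  refine (integral_sub_right_eq_self (fun z => s.indicator g (z - -y) * sᶜ.indicator f z)
    y).symm.trans ?_
  refine integral_congr_ae (Eventually.of_forall fun z => ?_)
  simp [mul_comm]

end Convolution

/-! ### Regularity of the fundamental solution. -/

section Regularity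

variable {n : ℕ} {M : Material n} {s : ℂ}

/-- The micromodulus is dominated by a weakly singular majorant. -/
def Material.IsWeaklySingular (M : Material n) (γ : ℝ) : Prop :=
  ∃ c : ℝ, ∀ ξ i k, |micromodulus M.α M.Θ 0 ξ i k| ≤ c * (1 + ‖ξ‖ ^ (-γ))

lemma Material.IsWeaklySingular.enorm_kernel_le {γ : ℝ} (h : M.IsWeaklySingular γ) :
    ∃ C : ℝ≥0∞, C ≠ ∞ ∧ ∀ ξ i k, ‖(M.kernel ξ i k : ℂ)‖ₑ ≤ C * singularMajorant γ ξ := by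
  obtain ⟨c, hc⟩ := h
  refine ⟨ENNReal.ofReal (2 * |c|), ENNReal.ofReal_ne_top, fun ξ i k => ?_⟩
  have h1 : ‖(M.kernel ξ i k : ℂ)‖ₑ ≤ ENNReal.ofReal (|c| * (1 + ‖ξ‖ ^ (-γ))) := by
    rw [← ofReal_norm, Complex.norm_real, Real.norm_eq_abs]
    refine ENNReal.ofReal_le_ofReal ((hc ξ i k).trans ?_)
    gcongr
    exact le_abs_self c
  refine h1.trans ?_
  -- At the origin the real power is at most one, whereas the majorant may be infinite; the doubled
  -- constant covers this value.
  by_cases hξ : ξ = 0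
  · calc ENNReal.ofReal (|c| * (1 + ‖ξ‖ ^ (-γ))) ≤ ENNReal.ofReal (2 * |c|) := by
          refine ENNReal.ofReal_le_ofReal ?_
          have := Real.zero_rpow_le_one (-γ)
          rw [hξ, norm_zero]
          nlinarith [abs_nonneg c]
      _ ≤ _ := le_mul_of_one_le_right' (one_le_singularMajorant ξ)
  · rw [singularMajorant_eq_ofReal hξ, ← ENNReal.ofReal_mul (by positivity)]
    refine ENNReal.ofReal_le_ofReal ?_
    gcongr
    linarith [abs_nonneg c]

/-- The right-hand side of the integral equation for the regular part of the fundamental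
solution. -/
def DiracField.potential (M : Material n) (v : DiracField n) (y : Pt n) (i : Fin n) : ℂ :=
  -2 * ∑ j, ((∫ z, (M.kernel (z - y) i j : ℂ) * v.reg z j) + (M.kernel y i j : ℂ) * v.coeff j)

variable {ug : Fin n → DiracField n}

/-- The regular part of the fundamental solution solves an integral equation of the second kind. -/
lemma reg_eq_potential (hug : ∀ k, IsFundamentalSolution M s k (ug k)) {k : Fin n} {y : Pt n}
    (hy : y ≠ 0) (hint : ∀ i j, Integrable fun z => (M.kernel (z - y) i j : ℂ) * (ug k).reg z j)
    (l : Fin n) : (ug k).reg y l = ∑ j, (ug l).coeff j * (ug k).potential M y j := by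
  set r := (ug k).reg with hr
  have hforce : ∀ i, M.force r y i =
      (-2) * ∑ j, ((∫ z, (M.kernel (z - y) i j : ℂ) * r z j) - M.mass i j * r y j) := by
    intro i
    have hc : ∀ j, Integrable fun z => (M.kernel (z - y) i j : ℂ) * r y j := fun j =>
      ((M.kernel_integrable i j).comp_sub_right y).ofReal.mul_const _
    have hsub : ∀ j, Integrable fun z => (M.kernel (z - y) i j : ℂ) * (r z j - r y j) :=
      fun j => by
        simp only [mul_sub]
        exact (hint i j).sub (hc j)
    rw [M.force_eq_complex, integral_finsetSum _ fun j _ => hsub j]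
    congr 1
    refine Finset.sum_congr rfl fun j _ => ?_
    simp only [mul_sub]
    rw [integral_sub (hint i j) (hc j), integral_mul_const, integral_complex_ofReal,
      integral_sub_right_eq_self (fun ξ => M.kernel ξ i j), Material.mass]
  have heq : ∀ i, (ug k).potential M y i =
      M.ρ * s ^ 2 * r y i - 2 * ∑ j, (M.mass i j : ℂ) * r y j := by
    intro i
    have h1 := (hug k).reg_eq (x₀ := 0) hy i
    have h2 : ((ug k).shift 0).reg = r := by
      ext x
      simp [hr]
    rw [h2, hforce, sub_zero] at h1
    rw [h1, DiracField.potential, Finset.sum_sub_distrib, Finset.sum_add_distrib]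
    ring
  have hA : ∀ i, (M.ρ * s ^ 2 * (ug l).coeff i - 2 * ∑ j, (M.mass i j : ℂ) * (ug l).coeff j) =
      if i = l then 1 else 0 := fun i => by
    rw [(hug l).coeff_eq i]
    ring
  have hsymm : ∑ i, r y i * ∑ j, (M.mass i j : ℂ) * (ug l).coeff j =
      ∑ i, (ug l).coeff i * ∑ j, (M.mass i j : ℂ) * r y j := by
    simp only [Finset.mul_sum]
    rw [Finset.sum_comm]
    refine Finset.sum_congr rfl fun i _ => Finset.sum_congr rfl fun j _ => ?_
    have : M.mass j i = M.mass i j := by simp only [Material.mass, M.kernel_symm _ j i]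
    rw [this]
    ring
  -- The coefficients of the `l`-th solution invert `ρ s² - 2 mass` in direction `l`. Solving for
  -- all components of one solution therefore uses the point masses of all `n` solutions.
  calc r y l = ∑ i, r y i * (if i = l then 1 else 0) := by simp
    _ = ∑ i, r y i * (M.ρ * s ^ 2 * (ug l).coeff i -
        2 * ∑ j, (M.mass i j : ℂ) * (ug l).coeff j) := by simp only [hA]
    _ = ∑ i, M.ρ * s ^ 2 * (ug l).coeff i * r y i -
        2 * ∑ i, r y i * ∑ j, (M.mass i j : ℂ) * (ug l).coeff j := by
        rw [Finset.mul_sum, ← Finset.sum_sub_distrib]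
        exact Finset.sum_congr rfl fun i _ => by ring
    _ = ∑ j, (ug l).coeff j * (ug k).potential M y j := by
        rw [hsymm, Finset.mul_sum, ← Finset.sum_sub_distrib]
        refine Finset.sum_congr rfl fun i _ => ?_
        rw [heq]
        ring

/-- The regular part of the fundamental solution is weakly singular, and its convolution with the
micromodulus converges off the origin. -/
theorem reg_weakly_singular (hug : ∀ k, IsFundamentalSolution M s k (ug k)) {γ : ℝ} (hγ : 0 ≤ γ)
    (hγn : γ < n) (hκ : M.IsWeaklySingular γ) (k : Fin n) :
    (∀ y ≠ 0, ∀ i j, Integrable fun z => (M.kernel (z - y) i j : ℂ) * (ug k).reg z j) ∧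
    ∃ C : ℝ≥0∞, C ≠ ∞ ∧ ∀ y ≠ 0, ∀ i, ‖(ug k).reg y i‖ₑ ≤ C * singularMajorant γ y := by
  obtain ⟨C, hC, hCle⟩ := hκ.enorm_kernel_le
  have : Nonempty (Fin n) := ⟨k⟩
  set r := (ug k).reg with hr
  have hrint : ∀ i, Integrable fun z => r z i := integrable_pi_iff.1 (hug k).integrable
  set φ : Pt n → ℝ≥0∞ := fun z => ∑ i, ‖r z i‖ₑ with hφ
  have hφm : AEMeasurable φ :=
    Finset.aemeasurable_fun_sum _ fun i _ => (hrint i).aestronglyMeasurable.enorm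
  have hφint : ∫⁻ z, φ z ≠ ∞ := by
    rw [hφ, lintegral_finsetSum' _ fun i _ => (hrint i).aestronglyMeasurable.enorm]
    exact ENNReal.sum_ne_top.2 fun i _ => (hrint i).2.ne
  have hrφ : ∀ z i, ‖r z i‖ₑ ≤ φ z := fun z i =>
    Finset.single_le_sum (f := fun i => ‖r z i‖ₑ) (fun _ _ => zero_le) (Finset.mem_univ i)
  have hpot : ∀ y i j, ∫⁻ z, ‖(M.kernel (z - y) i j : ℂ) * r z j‖ₑ ≤
      C * ∫⁻ z, singularMajorant γ (z - y) * φ z := by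
    intro y i j
    rw [← lintegral_const_mul' _ _ hC]
    refine lintegral_mono fun z => ?_
    rw [enorm_mul, ← mul_assoc]
    exact mul_le_mul' (hCle _ i j) (hrφ z j)
  set E : ℝ≥0∞ := ∑ l, ∑ j, ‖(ug l).coeff j‖ₑ * (2 * ∑ i, (C + C * ‖(ug k).coeff i‖ₑ)) with hE
  have hEt : E ≠ ∞ := by
    refine ENNReal.sum_ne_top.2 fun l _ => ENNReal.sum_ne_top.2 fun j _ => ?_
    refine ENNReal.mul_ne_top (by simp) (ENNReal.mul_ne_top (by simp) ?_)
    exact ENNReal.sum_ne_top.2 fun i _ => by simp [ENNReal.mul_eq_top, hC]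
  have hgood : ∀ y ≠ 0, (∀ i j, Integrable fun z => (M.kernel (z - y) i j : ℂ) * r z j) →
      φ y ≤ E * (singularMajorant γ y + ∫⁻ z, singularMajorant γ (z - y) * φ z) := by
    intro y hy hint
    set X := singularMajorant γ y + ∫⁻ z, singularMajorant γ (z - y) * φ z with hX
    have hb : ∀ i, ‖(ug k).potential M y i‖ₑ ≤ 2 * ∑ j, (C + C * ‖(ug k).coeff j‖ₑ) * X := by
      intro i
      unfold DiracField.potential
      rw [enorm_mul]
      refine mul_le_mul' (by simp [← ofReal_norm]) ((enorm_sum_le _ _).trans ?_)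
      refine Finset.sum_le_sum fun j _ => (enorm_add_le _ _).trans ?_
      rw [add_mul]
      refine add_le_add ?_ ?_
      · refine (enorm_integral_le_lintegral_enorm _).trans ((hpot y i j).trans ?_)
        gcongr
        exact le_add_self
      · rw [enorm_mul, mul_right_comm]
        gcongr
        exact (hCle y i j).trans (mul_le_mul' le_rfl le_self_add)
    rw [hφ, hE, Finset.sum_mul]
    refine Finset.sum_le_sum fun l _ => ?_
    rw [hr, reg_eq_potential hug hy hint l, Finset.sum_mul]
    refine (enorm_sum_le _ _).trans (Finset.sum_le_sum fun j _ => ?_)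
    rw [enorm_mul, mul_assoc, mul_assoc, Finset.sum_mul]
    gcongr
    exact hb j
  -- Fubini gives convergence of the convolution only for almost every `y`, which is enough for the
  -- absorption argument.
  have hae : ∀ᵐ y : Pt n, ∀ i j, Integrable fun z => (M.kernel (z - y) i j : ℂ) * r z j := by
    refine ae_all_iff.2 fun i => ae_all_iff.2 fun j => ?_
    have := (integrable_kernel_mul_snd (M.kernel_integrable i j) (hrint j) univ).prod_right_ae
    simpa using this
  obtain ⟨D, hD, -, hDle⟩ := singular_bound_of_le_potential hγ hγn hφm hφint hEt (by
    filter_upwards [hae, compl_mem_ae_iff.2 (measure_singleton (μ := volume) (0 : Pt n))]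
      with y hy hy0
    rw [← mul_add]
    exact hgood y hy0 hy)
  -- The potential bound holds at every `y`, so the convolution converges everywhere off the origin,
  -- and the integral equation with it.
  have hall : ∀ y ≠ 0, ∀ i j, Integrable fun z => (M.kernel (z - y) i j : ℂ) * r z j := by
    intro y hy i j
    refine ⟨((M.kernel_integrable i j).comp_sub_right y).ofReal.aestronglyMeasurable.mul
      (hrint j).aestronglyMeasurable, ?_⟩
    refine (hpot y i j).trans_lt ?_
    refine (mul_le_mul' le_rfl (hDle y)).trans_lt ?_
    exact ENNReal.mul_lt_top hC.lt_top
      (ENNReal.mul_lt_top hD.lt_top (singularMajorant_ne_top hy).lt_top)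
  refine ⟨hall, E * (1 + D), ENNReal.mul_ne_top hEt (by simp [hD]), fun y hy i => ?_⟩
  refine (hrφ y i).trans ((hgood y hy (hall y hy)).trans ?_)
  rw [mul_assoc, add_mul, one_mul]
  gcongr
  exact hDle y

lemma exists_bound_off_ball {γ : ℝ} (hγ : 0 ≤ γ) {f : Pt n → ℂ} {C : ℝ≥0∞} (hC : C ≠ ∞)
    (hf : ∀ y ≠ 0, ‖f y‖ₑ ≤ C * singularMajorant γ y) (ε : ℝ) (hε : 0 < ε) :
    ∃ B, ∀ z, ε ≤ ‖z‖ → ‖f z‖ ≤ B := by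
  obtain ⟨E, hE, hEle⟩ := singularMajorant_le_of_le (n := n) hγ hε
  refine ⟨(C * E).toReal, fun z hz => ?_⟩
  have hz0 : z ≠ 0 := norm_pos_iff.1 (hε.trans_le hz)
  rw [← toReal_enorm]
  exact ENNReal.toReal_mono (ENNReal.mul_ne_top hC hE)
    ((hf z hz0).trans (mul_le_mul' le_rfl (hEle z hz)))

/-- The regular part of the fundamental solution is continuous wherever the micromodulus is. -/
theorem reg_continuousAt (hug : ∀ k, IsFundamentalSolution M s k (ug k)) {γ : ℝ} (hγ : 0 ≤ γ)
    (hγn : γ < n) (hκ : M.IsWeaklySingular γ) (k : Fin n) {y₀ : Pt n} (hy₀ : y₀ ≠ 0)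
    (hc : ContinuousAt (micromodulus M.α M.Θ 0) y₀) (l : Fin n) :
    ContinuousAt (fun y => (ug k).reg y l) y₀ := by
  obtain ⟨C, hC, hCle⟩ := hκ.enorm_kernel_le
  obtain ⟨hint, D, hD, hDle⟩ := reg_weakly_singular hug hγ hγn hκ k
  have hconv : ∀ i j, ContinuousAt
      (fun y => ∫ z, (M.kernel (z - y) i j : ℂ) * (ug k).reg z j) y₀ := fun i j =>
    continuousAt_integral_translate_mul (f := fun z => (M.kernel z i j : ℂ))
      (g := fun z => (ug k).reg z j) (M.kernel_integrable i j).ofReal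
      (integrable_pi_iff.1 (hug k).integrable j)
      (exists_bound_off_ball hγ hC fun y _ => hCle y i j)
      (exists_bound_off_ball hγ hD fun y hy => hDle y hy j) hy₀
  have hker : ∀ i j, ContinuousAt (fun y => (M.kernel y i j : ℂ)) y₀ := fun i j =>
    Complex.continuous_ofReal.continuousAt.comp
      (f := fun y => M.kernel y i j) (continuousAt_pi.1 (continuousAt_pi.1 hc i) j)
  have hpot : ContinuousAt (fun y => ∑ j, (ug l).coeff j * (ug k).potential M y j) y₀ := by
    refine tendsto_finsetSum _ fun j _ => Tendsto.const_mul _ ?_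
    refine Tendsto.const_mul _ (tendsto_finsetSum _ fun i _ => ?_)
    exact (hconv j i).add ((hker j i).mul_const _)
  refine hpot.congr ?_
  filter_upwards [isOpen_ne.mem_nhds hy₀] with y hy
  exact (reg_eq_potential hug hy (hint y hy) l).symm

end Regularity

/-! ### Traction of the fundamental solution. -/

section Traction

variable {n : ℕ} (M : Material n)

lemma neg_mem_family_zero {ξ : Pt n} : -ξ ∈ family M.α 0 ↔ ξ ∈ family M.α 0 := by
  simp [family, M.α_zero_neg]

lemma weightVector_neg (ξ : Pt n) : weightVector M (-ξ) = -weightVector M ξ := by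
  unfold weightVector
  by_cases h : ξ ∈ family M.α 0
  · rw [if_pos h, if_pos ((neg_mem_family_zero M).2 h), M.ω_even, smul_neg]
  · rw [if_neg h, if_neg (mt (neg_mem_family_zero M).1 h), neg_zero]

lemma weightVector_apply_eq_indicator (ξ : Pt n) (r : Fin n) :
    weightVector M ξ r = (family M.α 0).indicator (fun ξ => M.ω ξ * ξ r) ξ := by
  classical
  unfold weightVector
  rw [indicator_apply]
  split_ifs <;> simp

lemma shapeTensor_eq (x : Pt n) : shapeTensor M.α M.ω x = shapeTensor M.α M.ω 0 := by
  ext p q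
  simp only [shapeTensor, Matrix.of_apply]
  rw [← integral_indicator (M.measurableSet_family x), ← integral_indicator
    (M.measurableSet_family 0), ← integral_add_right_eq_self _ x]
  refine integral_congr_ae (Eventually.of_forall fun x' => ?_)
  classical
  simp only [indicator_apply, M.mem_family_iff x, sub_zero, add_sub_cancel_right]

/-- The inverse shape tensor. -/
def Material.shapeInv : Matrix (Fin n) (Fin n) ℝ := (shapeTensor M.α M.ω 0)⁻¹

lemma nonlocalGrad_eq {V : Type*} [NormedAddCommGroup V] [NormedSpace ℝ V] (m : Measure (Pt n))
    (w : Pt n → Fin n → V) (x : Pt n) (p q : Fin n) :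
    nonlocalGrad m M.α M.ω w x p q = ∑ r, M.shapeInv r q •
      ∫ x', weightVector M (x' - x) r • (w x' p - w x p) ∂m := by
  classical
  unfold nonlocalGrad Material.shapeInv
  rw [shapeTensor_eq M x]
  refine Finset.sum_congr rfl fun r _ => ?_
  rw [← integral_indicator (M.measurableSet_family x)]
  congr 2
  ext x'
  rw [weightVector_apply_eq_indicator]
  simp only [indicator_apply, M.mem_family_iff x]
  split_ifs <;> simp

lemma norm_traction_le (C : Fin n → Fin n → Fin n → Fin n → ℝ) {ν : Pt n} (hν : ‖ν‖ ≤ 1)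
    {G : Fin n → Fin n → ℂ} {b : ℝ} (hG : ∀ p q, ‖G p q‖ ≤ b) (j : Fin n) :
    ‖traction C ν G j‖ ≤ (∑ l, ∑ p, ∑ q, |C l j p q|) * b := by
  unfold traction
  have hterm : ∀ l p q, ‖(ν l * C l j p q) • (G q p + G p q)‖ ≤ |C l j p q| * (2 * b) := by
    intro l p q
    rw [norm_smul, norm_mul, Real.norm_eq_abs (C l j p q)]
    have h1 : ‖ν l‖ ≤ 1 := (PiLp.norm_apply_le ν l).trans hν
    have h2 : ‖G q p + G p q‖ ≤ 2 * b := (norm_add_le _ _).trans (by linarith [hG q p, hG p q])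
    calc ‖ν l‖ * |C l j p q| * ‖G q p + G p q‖ ≤ 1 * |C l j p q| * (2 * b) := by gcongr
      _ = _ := by ring
  have hsum : ‖∑ l, ∑ p, ∑ q, (ν l * C l j p q) • (G q p + G p q)‖ ≤
      ∑ l, ∑ p, ∑ q, |C l j p q| * (2 * b) :=
    norm_sum_le_of_le _ fun l _ => norm_sum_le_of_le _ fun p _ => norm_sum_le_of_le _ fun q _ =>
      hterm l p q
  rw [norm_smul]
  simp only [← Finset.sum_mul] at hsum
  rw [Real.norm_of_nonneg (by norm_num)]
  linarith

lemma tendsto_traction {ι : Type*} {L : Filter ι} (C : Fin n → Fin n → Fin n → Fin n → ℝ) (ν : Pt n)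
    {G : ι → Fin n → Fin n → ℂ} {G₀ : Fin n → Fin n → ℂ}
    (h : ∀ p q, Tendsto (fun i => G i p q) L (𝓝 (G₀ p q))) (j : Fin n) :
    Tendsto (fun i => traction C ν (G i) j) L (𝓝 (traction C ν G₀ j)) := by
  unfold traction
  refine Tendsto.const_smul (tendsto_finsetSum _ fun l _ => tendsto_finsetSum _ fun p _ =>
    tendsto_finsetSum _ fun q _ => ?_) _
  exact ((h q p).add (h p q)).const_smul _

variable {M}

lemma norm_weightVector_apply_le {c : ℝ} (hc : ∀ ξ, ‖weightVector M ξ‖ ≤ c) (ξ : Pt n) (r : Fin n) :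
    ‖weightVector M ξ r‖ ≤ c := (PiLp.norm_apply_le _ r).trans (hc ξ)

lemma weightVector_apply_integrable (h : Integrable (weightVector M)) (r : Fin n) :
    Integrable fun ξ => weightVector M ξ r :=
  (EuclideanSpace.proj (𝕜 := ℝ) r).integrable_comp h

/-- The surface traction of a bounded displacement is bounded. -/
lemma exists_norm_T_le {Ω : Set (Pt n)} (hW : Integrable (weightVector M))
    {w : Pt n → Fin n → ℂ} {B : ℝ} (hB : ∀ x ∈ Ω ∪ collar M.α Ω, ∀ i, ‖w x i‖ ≤ B) :
    ∃ b : ℝ, ∀ (ν : Pt n → Pt n), ∀ x ∈ Ω, ‖ν x‖ ≤ 1 → ∀ j, ‖M.T ν w x j‖ ≤ b := by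
  set g : ℝ := ∑ q, ∑ r, |M.shapeInv r q| * ∫ ξ, ‖weightVector M ξ r‖ * (2 * B) with hg
  have hgrad : ∀ x ∈ Ω, ∀ p q, ‖nonlocalGrad volume M.α M.ω w x p q‖ ≤ g := by
    intro x hx p q
    have hB0 : 0 ≤ B := (norm_nonneg _).trans (hB x (Or.inl hx) p)
    rw [nonlocalGrad_eq]
    have h1 : ‖∑ r, M.shapeInv r q • ∫ x', weightVector M (x' - x) r • (w x' p - w x p)‖ ≤
        ∑ r, |M.shapeInv r q| * ∫ ξ, ‖weightVector M ξ r‖ * (2 * B) := by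
      refine norm_sum_le_of_le _ fun r _ => ?_
      rw [norm_smul, Real.norm_eq_abs]
      gcongr
      rw [← integral_sub_right_eq_self (fun ξ => ‖weightVector M ξ r‖ * (2 * B)) x]
      refine norm_integral_le_of_norm_le
        (((weightVector_apply_integrable hW r).comp_sub_right x).norm.mul_const _)
        (Eventually.of_forall fun x' => ?_)
      rw [norm_smul]
      by_cases hf : x' - x ∈ family M.α 0
      · gcongr
        have h1 := hB x' (M.mem_union_collar hx ((M.mem_family_iff x x').2 hf)) p
        have h2 := hB x (Or.inl hx) p
        exact (norm_sub_le _ _).trans (by linarith)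
      · rw [weightVector_apply_eq_indicator, indicator_of_notMem hf]
        simp
    refine h1.trans ?_
    rw [hg]
    refine Finset.single_le_sum
      (f := fun q => ∑ r, |M.shapeInv r q| * ∫ ξ, ‖weightVector M ξ r‖ * (2 * B))
      (fun q _ => Finset.sum_nonneg fun r _ => ?_) (Finset.mem_univ q)
    have : 0 ≤ ∫ ξ, ‖weightVector M ξ r‖ * (2 * B) := integral_nonneg fun ξ => by positivity
    positivity
  refine ⟨∑ j, |(∑ l, ∑ p, ∑ q, |M.C l j p q|) * g|, fun ν x hx hν j => ?_⟩
  refine (norm_traction_le M.C hν (hgrad x hx) j).trans ((le_abs_self _).trans ?_)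
  exact Finset.single_le_sum (f := fun j => |(∑ l, ∑ p, ∑ q, |M.C l j p q|) * g|)
    (fun _ _ => abs_nonneg _) (Finset.mem_univ j)

/-- The nonlocal displacement gradient of a field with a point mass, as a function of the position
relative to the pole. -/
def DiracField.grad (M : Material n) (v : DiracField n) (y : Pt n) (p q : Fin n) : ℂ :=
  ∑ r, (M.shapeInv r q : ℂ) * ((∫ ξ, v.reg (ξ - -y) p * (weightVector M ξ r : ℂ)) -
    (∫ ξ, (weightVector M ξ r : ℂ)) * v.reg y p - (weightVector M y r : ℂ) * v.coeff p)

/-- By translation invariance the pole enters the gradient only through `x - x₀`, so continuity in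
the pole becomes continuity of `grad` in its argument. -/
lemma DiracField.T_shift_eq (v : DiracField n) (hv : v.pole = 0)
    (hr : ∀ i, Integrable fun x => v.reg x i) {c : ℝ} (hc : ∀ ξ, ‖weightVector M ξ‖ ≤ c)
    (hW : Integrable (weightVector M)) (ν : Pt n → Pt n) {x₀ x : Pt n} (hx : x ≠ x₀) :
    (v.shift x₀).T M ν x = traction M.C (ν x) (v.grad M (x - x₀)) := by
  have hpole : (v.shift x₀).pole = x₀ := by simp [hv]
  unfold DiracField.T
  congr 1
  ext p q
  rw [nonlocalGrad_eq, nonlocalGrad_eq, DiracField.grad, ← Finset.sum_add_distrib]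
  refine Finset.sum_congr rfl fun r _ => ?_
  rw [integral_dirac, (v.shift x₀).bump_pole, (v.shift x₀).bump_of_ne (by rwa [hpole]), hpole,
    ← smul_add, Complex.real_smul]
  congr 1
  have hWr := weightVector_apply_integrable hW r
  have h1 : ∫ x', weightVector M (x' - x) r • ((v.shift x₀).reg x' p - (v.shift x₀).reg x p) =
      (∫ ξ, v.reg (ξ - -(x - x₀)) p * (weightVector M ξ r : ℂ)) -
        (∫ ξ, (weightVector M ξ r : ℂ)) * v.reg (x - x₀) p := by
    have i1 : Integrable fun ξ => v.reg (ξ - -(x - x₀)) p * (weightVector M ξ r : ℂ) :=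
      ((hr p).comp_sub_right (-(x - x₀))).mul_bdd (c := c) hWr.ofReal.aestronglyMeasurable
        (Eventually.of_forall fun ξ => by
          rw [Complex.norm_real]
          exact norm_weightVector_apply_le hc ξ r)
    have i2 : Integrable fun ξ => (weightVector M ξ r : ℂ) * v.reg (x - x₀) p :=
      hWr.ofReal.mul_const _
    rw [← integral_mul_const, ← integral_sub i1 i2, ← integral_add_right_eq_self _ x]
    refine integral_congr_ae (Eventually.of_forall fun x' => ?_)
    simp only [DiracField.shift_reg, Complex.real_smul, add_sub_cancel_right]
    rw [sub_neg_eq_add, add_sub_assoc]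
    ring
  -- The weight is evaluated on the bond from `x` to the pole; its oddness gives the minus sign of
  -- the point-mass term in `grad`.
  rw [h1, ← neg_sub x x₀, weightVector_neg]
  simp only [Pi.zero_apply, sub_zero, DiracField.shift_coeff, Complex.real_smul, PiLp.neg_apply,
    Complex.ofReal_neg]
  ring

variable {s : ℂ} {ug : Fin n → DiracField n}

/-- The convolution with the weight is continuous everywhere; only the local terms, `reg y` and the
weight at `y`, need continuity of the kernels at the point. -/
lemma grad_continuousAt (hug : ∀ k, IsFundamentalSolution M s k (ug k)) {γ : ℝ} (hγ : 0 ≤ γ)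
    (hγn : γ < n) (hκ : M.IsWeaklySingular γ) {c : ℝ} (hc : ∀ ξ, ‖weightVector M ξ‖ ≤ c)
    (hW : Integrable (weightVector M)) (k : Fin n) {y₀ : Pt n} (hy₀ : y₀ ≠ 0)
    (hcont : ContinuousAt (micromodulus M.α M.Θ 0) y₀) (hcontW : ContinuousAt (weightVector M) y₀)
    (p q : Fin n) : ContinuousAt (fun y => (ug k).grad M y p q) y₀ := by
  refine tendsto_finsetSum _ fun r _ => Tendsto.const_mul _ ?_
  have hWr := weightVector_apply_integrable hW r
  have c1 : Continuous fun y => ∫ ξ, (ug k).reg (ξ - y) p * (weightVector M ξ r : ℂ) :=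
    continuous_integral_translate_mul (f := fun x => (ug k).reg x p) (B := c)
      (integrable_pi_iff.1 (hug k).integrable p) hWr.ofReal.aestronglyMeasurable
      (Eventually.of_forall fun ξ => by
        rw [Complex.norm_real]
        exact norm_weightVector_apply_le hc ξ r)
  have c2 : ContinuousAt (fun y => (weightVector M y r : ℂ)) y₀ :=
    Complex.continuous_ofReal.continuousAt.comp (f := fun y => weightVector M y r)
      ((EuclideanSpace.proj (𝕜 := ℝ) r).continuous.continuousAt.comp hcontW)
  exact (((c1.comp continuous_neg).continuousAt).sub
    ((reg_continuousAt hug hγ hγn hκ k hy₀ hcont p).const_mul _)).sub (c2.mul_const _)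

/-- Weakly singular bounds in terms of real numbers. -/
lemma exists_real_bound {γ : ℝ} {f : Pt n → ℂ} {C : ℝ≥0∞} (hC : C ≠ ∞)
    (hf : ∀ y ≠ 0, ‖f y‖ₑ ≤ C * singularMajorant γ y) :
    ∀ y ≠ 0, ‖f y‖ ≤ C.toReal * (1 + ‖y‖ ^ (-γ)) := by
  intro y hy
  rw [← toReal_enorm]
  refine (ENNReal.toReal_mono (ENNReal.mul_ne_top hC (singularMajorant_ne_top hy)) (hf y hy)).trans ?_
  rw [ENNReal.toReal_mul, singularMajorant_eq_ofReal hy, ENNReal.toReal_ofReal (by positivity)]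

/-- The convolution and the point-mass term are bounded because the weight is; the only singular
term is a multiple of `reg y`. Bounded terms are absorbed since the majorant is at least one. -/
lemma exists_norm_grad_le (hug : ∀ k, IsFundamentalSolution M s k (ug k)) {γ : ℝ} (hγ : 0 ≤ γ)
    (hγn : γ < n) (hκ : M.IsWeaklySingular γ) {c : ℝ} (hc : ∀ ξ, ‖weightVector M ξ‖ ≤ c)
    (k : Fin n) :
    ∃ D : ℝ, 0 ≤ D ∧ (∀ y ≠ 0, ∀ i, ‖(ug k).reg y i‖ ≤ D * (1 + ‖y‖ ^ (-γ))) ∧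
      ∀ y ≠ 0, ∀ p q, ‖(ug k).grad M y p q‖ ≤ D * (1 + ‖y‖ ^ (-γ)) := by
  obtain ⟨-, C, hC, hCle⟩ := reg_weakly_singular hug hγ hγn hκ k
  have hreg : ∀ y ≠ 0, ∀ i, ‖(ug k).reg y i‖ ≤ C.toReal * (1 + ‖y‖ ^ (-γ)) := fun y hy i =>
    exists_real_bound hC (f := fun y => (ug k).reg y i) (fun y hy => hCle y hy i) y hy
  have hc0 : 0 ≤ c := (norm_nonneg _).trans (hc 0)
  have hri : ∀ i, Integrable fun x => (ug k).reg x i := integrable_pi_iff.1 (hug k).integrable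
  set D₀ : Fin n → Fin n → ℝ := fun p q => ∑ r, |M.shapeInv r q| *
    ((∫ ξ, ‖(ug k).reg ξ p‖ * c) + ‖∫ ξ, (weightVector M ξ r : ℂ)‖ * C.toReal +
      c * ‖(ug k).coeff p‖) with hD₀
  have hI : ∀ p, 0 ≤ ∫ ξ, ‖(ug k).reg ξ p‖ * c := fun p => integral_nonneg fun ξ => by positivity
  have hD₀nn : ∀ p q, 0 ≤ D₀ p q := fun p q => Finset.sum_nonneg fun r _ =>
    mul_nonneg (abs_nonneg _) (by have := hI p; positivity)
  have hgrad : ∀ y ≠ 0, ∀ p q, ‖(ug k).grad M y p q‖ ≤ D₀ p q * (1 + ‖y‖ ^ (-γ)) := by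
    intro y hy p q
    rw [hD₀, Finset.sum_mul]
    refine norm_sum_le_of_le _ fun r _ => ?_
    have hX : 1 ≤ 1 + ‖y‖ ^ (-γ) := by
      have : 0 ≤ ‖y‖ ^ (-γ) := by positivity
      linarith
    set X := 1 + ‖y‖ ^ (-γ)
    have h1 : ‖∫ ξ, (ug k).reg (ξ - -y) p * (weightVector M ξ r : ℂ)‖ ≤
        ∫ ξ, ‖(ug k).reg ξ p‖ * c := by
      rw [← integral_sub_right_eq_self (fun ξ => ‖(ug k).reg ξ p‖ * c) (-y)]
      refine norm_integral_le_of_norm_le (((hri p).comp_sub_right (-y)).norm.mul_const c)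
        (Eventually.of_forall fun ξ => ?_)
      rw [norm_mul, Complex.norm_real]
      gcongr
      exact norm_weightVector_apply_le hc ξ r
    have h2 := hreg y hy p
    have h3 : ‖(weightVector M y r : ℂ)‖ ≤ c := by
      rw [Complex.norm_real]
      exact norm_weightVector_apply_le hc y r
    rw [norm_mul, Complex.norm_real, Real.norm_eq_abs, mul_assoc]
    gcongr
    refine (norm_sub_le _ _).trans ?_
    rw [add_mul, add_mul]
    refine add_le_add ((norm_sub_le _ _).trans (add_le_add ?_ ?_)) ?_
    · exact h1.trans (le_mul_of_one_le_right (hI p) hX)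
    · rw [norm_mul, mul_assoc]
      gcongr
    · rw [norm_mul]
      refine le_trans ?_ (le_mul_of_one_le_right (by positivity) hX)
      gcongr
  refine ⟨C.toReal + ∑ p, ∑ q, D₀ p q, ?_, fun y hy i => ?_, fun y hy p q => ?_⟩
  · have : 0 ≤ ∑ p, ∑ q, D₀ p q :=
      Finset.sum_nonneg fun p _ => Finset.sum_nonneg fun q _ => hD₀nn p q
    positivity
  · refine (hreg y hy i).trans ?_
    gcongr
    have : 0 ≤ ∑ p, ∑ q, D₀ p q :=
      Finset.sum_nonneg fun p _ => Finset.sum_nonneg fun q _ => hD₀nn p q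
    linarith
  · refine (hgrad y hy p q).trans ?_
    gcongr
    have h1 : D₀ p q ≤ ∑ q, D₀ p q :=
      Finset.single_le_sum (f := fun q => D₀ p q) (fun q _ => hD₀nn p q) (Finset.mem_univ q)
    have h2 : ∑ q, D₀ p q ≤ ∑ p, ∑ q, D₀ p q :=
      Finset.single_le_sum (f := fun p => ∑ q, D₀ p q)
        (fun p _ => Finset.sum_nonneg fun q _ => hD₀nn p q) (Finset.mem_univ p)
    have h3 : 0 ≤ C.toReal := ENNReal.toReal_nonneg
    linarith

end Traction

/-! ### Limits of surface integrals with moving poles. -/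

section Vitali

variable {n : ℕ} {γ : ℝ} {μ : Measure (Pt n)}

/-- A small ball around the pole costs at most `δ`, and outside it the majorant is at most `E`.
Neither constant depends on the pole, which yields uniform integrability along a sequence of poles.
-/
lemma exists_setLIntegral_singularMajorant_le (hγ : 0 ≤ γ) {d : ℕ} (hd : γ < d) {c : ℝ}
    (hμ : ∀ (y : Pt n) (r : ℝ), 0 < r → μ (Metric.ball y r) ≤ ENNReal.ofReal (c * r ^ d))
    {δ : ℝ≥0∞} (hδ : δ ≠ 0) :
    ∃ E : ℝ≥0∞, E ≠ ∞ ∧ ∀ (y : Pt n) (s : Set (Pt n)),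
      ∫⁻ z in s, singularMajorant γ (z - y) ∂μ ≤ δ + E * μ s := by
  obtain ⟨ε, hε0, hε⟩ := exists_ball_lintegral_le hγ hd hμ hδ
  obtain ⟨E, hE, hEle⟩ := singularMajorant_le_of_le (n := n) hγ hε0
  refine ⟨E, hE, fun y s => ?_⟩
  calc ∫⁻ z in s, singularMajorant γ (z - y) ∂μ
      ≤ ∫⁻ z in s, (Metric.ball y ε).indicator (fun z => singularMajorant γ (z - y)) z + E ∂μ := by
        refine lintegral_mono fun z => ?_
        by_cases hz : z ∈ Metric.ball y ε
        · rw [indicator_of_mem hz]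
          exact le_self_add
        · rw [indicator_of_notMem hz, zero_add]
          rw [mem_ball_iff_norm, not_lt] at hz
          exact hEle _ hz
    _ = ∫⁻ z in s, (Metric.ball y ε).indicator (fun z => singularMajorant γ (z - y)) z ∂μ +
        E * μ s := by
        rw [lintegral_add_right _ measurable_const, setLIntegral_const]
    _ ≤ δ + E * μ s := by
        gcongr
        refine (setLIntegral_le_lintegral _ _).trans ?_
        rw [lintegral_indicator Metric.isOpen_ball.measurableSet]
        exact hε y

/-- Passage to the limit under uniformly weakly singular bounds with moving poles. -/
theorem tendsto_integral_of_singular_bound [IsFiniteMeasure μ] (hγ : 0 ≤ γ) {d : ℕ} (hd : γ < d)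
    {c : ℝ}
    (hμ : ∀ (y : Pt n) (r : ℝ), 0 < r → μ (Metric.ball y r) ≤ ENNReal.ofReal (c * r ^ d))
    {f : ℕ → Pt n → ℂ} {f₀ : Pt n → ℂ} {y : ℕ → Pt n} {y₀ : Pt n} {C : ℝ} (hC : 0 < C)
    (hf : ∀ j, AEStronglyMeasurable (f j) μ)
    (hb : ∀ j, ∀ᵐ x ∂μ, ‖f j x‖ₑ ≤ ENNReal.ofReal C * singularMajorant γ (x - y j))
    (hb₀ : ∀ᵐ x ∂μ, ‖f₀ x‖ₑ ≤ ENNReal.ofReal C * singularMajorant γ (x - y₀))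
    (hlim : ∀ᵐ x ∂μ, Tendsto (fun j => f j x) atTop (𝓝 (f₀ x))) :
    Integrable f₀ μ ∧ Tendsto (fun j => ∫ x, f j x ∂μ) atTop (𝓝 (∫ x, f₀ x ∂μ)) := by
  have hset : ∀ {g : Pt n → ℂ} {p : Pt n},
      (∀ᵐ x ∂μ, ‖g x‖ₑ ≤ ENNReal.ofReal C * singularMajorant γ (x - p)) → ∀ s : Set (Pt n),
      ∫⁻ x in s, ‖g x‖ₑ ∂μ ≤
        ENNReal.ofReal C * ∫⁻ x in s, singularMajorant γ (x - p) ∂μ := by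
    intro g p hg s
    rw [← lintegral_const_mul' _ _ ENNReal.ofReal_ne_top]
    exact lintegral_mono_ae (ae_restrict_of_ae hg)
  have hfin : ∀ {g : Pt n → ℂ} {p : Pt n}, AEStronglyMeasurable g μ →
      (∀ᵐ x ∂μ, ‖g x‖ₑ ≤ ENNReal.ofReal C * singularMajorant γ (x - p)) → Integrable g μ := by
    intro g p hgm hg
    refine ⟨hgm, ?_⟩
    obtain ⟨E, hE, hEle⟩ := exists_setLIntegral_singularMajorant_le hγ hd hμ one_ne_zero
    have h1 := hset hg univ
    rw [setLIntegral_univ] at h1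
    refine (h1.trans (mul_le_mul' le_rfl (hEle p univ))).trans_lt ?_
    exact ENNReal.mul_lt_top ENNReal.ofReal_lt_top (ENNReal.add_lt_top.2
      ⟨ENNReal.one_lt_top, ENNReal.mul_lt_top hE.lt_top (measure_lt_top μ univ)⟩)
  have hf₀m : AEStronglyMeasurable f₀ μ := aestronglyMeasurable_of_tendsto_ae atTop hf hlim
  have hf₀ := hfin hf₀m hb₀
  refine ⟨hf₀, ?_⟩
  -- The bounds have moving singularities, so domination by one function is replaced by uniform
  -- integrability and Vitali's theorem.
  have hui : UnifIntegrable f 1 μ := by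
    intro ε hε
    have hδ : ENNReal.ofReal (ε / (2 * C)) ≠ 0 := by
      rw [Ne, ENNReal.ofReal_eq_zero, not_le]
      positivity
    obtain ⟨E, hE, hEle⟩ := exists_setLIntegral_singularMajorant_le hγ hd hμ hδ
    -- Half of `ε` goes to the ball around the pole and half to the rest; `E + 1` avoids a zero
    -- denominator.
    refine ⟨ε / (2 * (C * (E.toReal + 1))), by positivity, fun j s hs hμs => ?_⟩
    rw [eLpNorm_one_eq_lintegral_enorm]
    simp only [enorm_indicator_eq_indicator_enorm]
    rw [lintegral_indicator hs]
    refine (hset (hb j) s).trans ?_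
    calc ENNReal.ofReal C * ∫⁻ x in s, singularMajorant γ (x - y j) ∂μ ≤
        ENNReal.ofReal C * (ENNReal.ofReal (ε / (2 * C)) +
          ENNReal.ofReal (E.toReal + 1) * ENNReal.ofReal (ε / (2 * (C * (E.toReal + 1))))) := by
          gcongr
          refine (hEle (y j) s).trans ?_
          gcongr
          rw [← ENNReal.ofReal_toReal hE, ENNReal.toReal_ofReal ENNReal.toReal_nonneg]
          exact ENNReal.ofReal_le_ofReal (by linarith)
      _ = ENNReal.ofReal ε := by
          have hE0 : 0 ≤ E.toReal := ENNReal.toReal_nonneg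
          rw [← ENNReal.ofReal_mul (by positivity), ← ENNReal.ofReal_add (by positivity)
            (by positivity), ← ENNReal.ofReal_mul hC.le]
          congr 1
          field_simp
          ring
  exact tendsto_integral_of_L1' f₀ hf₀m (Eventually.of_forall fun j => hfin (hf j) (hb j))
    (tendsto_Lp_finite_of_tendsto_ae le_rfl (by simp) hf (memLp_one_iff_integrable.2 hf₀) hui hlim)

/-- An integrable function has a principal value at every point without mass. -/
lemma hasPV_of_integrableOn {A : Set (Pt n)} (hA : MeasurableSet A) {f : Pt n → ℂ}
    (hf : IntegrableOn f A μ) {x : Pt n} (hx : μ {x} = 0) :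
    HasPV μ A f x (∫ x' in A, f x' ∂μ) := by
  refine ⟨fun ε _ => hf.mono_set sdiff_subset, ?_⟩
  have hm : ∀ ε : ℝ, MeasurableSet (A \ Metric.ball x ε) := fun ε =>
    hA.diff Metric.isOpen_ball.measurableSet
  simp only [← integral_indicator (hm _), ← integral_indicator hA]
  refine tendsto_integral_filter_of_dominated_convergence (fun z => ‖A.indicator f z‖)
    (Eventually.of_forall fun ε =>
      ((integrable_indicator_iff (hm ε)).2 (hf.mono_set sdiff_subset)).aestronglyMeasurable)
    (Eventually.of_forall fun ε => Eventually.of_forall fun z => ?_)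
    ((integrable_indicator_iff hA).2 hf).norm ?_
  · exact norm_indicator_le_of_subset sdiff_subset f z
  · filter_upwards [compl_mem_ae_iff.2 hx] with z hz
    have hpos : 0 < dist z x := dist_pos.2 hz
    refine tendsto_const_nhds.congr' ?_
    filter_upwards [Ioo_mem_nhdsGT hpos] with ε hε
    have hiff : z ∈ A \ Metric.ball x ε ↔ z ∈ A := by
      simp only [Set.mem_sdiff, Metric.mem_ball, not_lt, and_iff_left_iff_imp]
      exact fun _ => hε.2.le
    classical
    rw [indicator_apply, indicator_apply]
    simp only [hiff]

end Vitali

/-! ### The formula at interior and boundary points. -/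

section Boundary

variable {n : ℕ} {M : Material n} {Ω Ωd Ωn : Set (Pt n)} {ν : Pt n → Pt n} {s : ℂ}
  {w F : Pt n → Fin n → ℂ} {B : ℝ}

lemma surface_isFiniteMeasure (hΩ : IsCompact Ω) {d : ℕ} {c : ℝ}
    (h : ∀ (y : Pt n) (r : ℝ), 0 < r → surface Ω (Metric.ball y r) ≤ ENNReal.ofReal (c * r ^ d)) :
    IsFiniteMeasure (surface Ω) := by
  obtain ⟨R, hR0, hR⟩ := hΩ.isBounded.subset_ball_lt 0 0
  refine ⟨?_⟩
  have h1 : surface Ω univ ≤ surface Ω (Metric.ball 0 R) := by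
    unfold surface
    rw [Measure.restrict_apply_univ, Measure.restrict_apply Metric.isOpen_ball.measurableSet]
    exact measure_mono fun x hx => ⟨hR (hΩ.isClosed.frontier_subset hx), hx⟩
  exact (h1.trans (h 0 R hR0)).trans_lt ENNReal.ofReal_lt_top

/-- Balls shrinking to the point have measure tending to zero as soon as the exponent is positive,
which for the surface means `n ≥ 2`. -/
lemma surface_singleton {d : ℕ} (hd : d ≠ 0) {c : ℝ}
    (h : ∀ (y : Pt n) (r : ℝ), 0 < r → surface Ω (Metric.ball y r) ≤ ENNReal.ofReal (c * r ^ d))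
    (x : Pt n) : surface Ω {x} = 0 := by
  have hlim : Tendsto (fun r : ℝ => ENNReal.ofReal (c * r ^ d)) (𝓝[>] 0) (𝓝 0) := by
    have : Tendsto (fun r : ℝ => ENNReal.ofReal (c * r ^ d)) (𝓝 0)
        (𝓝 (ENNReal.ofReal (c * 0 ^ d))) := 
      (ENNReal.continuous_ofReal.comp (by fun_prop : Continuous fun r : ℝ => c * r ^ d)).tendsto 0
    rw [zero_pow hd, mul_zero, ENNReal.ofReal_zero] at this
    exact this.mono_left nhdsWithin_le_nhds
  refine le_antisymm (ge_of_tendsto hlim ?_) zero_le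
  filter_upwards [self_mem_nhdsWithin] with r hr
  exact (measure_mono (singleton_subset_iff.2 (Metric.mem_ball_self hr))).trans (h x r hr)

/-- The effective body force is continuous if the displacement is. -/
lemma continuousOn_of_force_eq (hY : MeasurableSet (Ω ∪ collar M.α Ω))
    (hw : ∀ i, AEStronglyMeasurable fun x => w x i)
    (hB : ∀ x ∈ Ω ∪ collar M.α Ω, ∀ i, ‖w x i‖ ≤ B)
    (hF : ∀ x ∈ Ω, ∀ i, M.force w x i + F x i = M.ρ * s ^ 2 * w x i)
    (hc : ∀ i, ContinuousOn (fun x => w x i) Ω) (i : Fin n) : ContinuousOn (fun x => F x i) Ω := by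
  have hconv : ∀ j, Continuous fun y =>
      ∫ x in Ω ∪ collar M.α Ω, (M.kernel (x - y) i j : ℂ) * w x j := by
    intro j
    have h1 : Continuous fun y => ∫ x, (M.kernel (x - y) i j : ℂ) *
        (Ω ∪ collar M.α Ω).indicator (fun x => w x j) x := by
      refine continuous_integral_translate_mul (f := fun ξ => (M.kernel ξ i j : ℂ)) (B := |B|)
        (M.kernel_integrable i j).ofReal ((hw j).indicator hY) (Eventually.of_forall fun x => ?_)
      by_cases hx : x ∈ Ω ∪ collar M.α Ω
      · rw [indicator_of_mem hx]
        exact (hB x hx j).trans (le_abs_self B)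
      · rw [indicator_of_notMem hx, norm_zero]
        exact abs_nonneg B
    refine h1.congr fun y => ?_
    rw [← integral_indicator hY]
    refine integral_congr_ae (Eventually.of_forall fun x => ?_)
    classical
    simp only [indicator_apply]
    split_ifs <;> simp
  have e : ∀ x ∈ Ω, F x i = M.ρ * s ^ 2 * w x i + 2 * ∑ j,
      ((∫ x' in Ω ∪ collar M.α Ω, (M.kernel (x' - x) i j : ℂ) * w x' j) -
        M.mass i j * w x j) := by
    intro x hx
    rw [← hF x hx i, M.force_eq_of_mem hY hw hB hx]
    ring
  refine ContinuousOn.congr ?_ e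
  refine ((hc i).const_mul _).add (ContinuousOn.const_mul (continuousOn_finsetSum _ fun j _ => ?_) _)
  exact (hconv j).continuousOn.sub ((hc j).const_mul _)

/-- The volume potential of the body force is continuous in the pole. -/
lemma pairing_continuousOn (hΩ : IsCompact Ω) (hc : ∀ i, ContinuousOn (fun x => F x i) Ω)
    {v : DiracField n} (hv : v.pole = 0) (hr : ∀ i, Integrable fun x => v.reg x i) :
    ContinuousOn (fun x₀ => (v.shift x₀).pairing Ω F) Ω := by
  have hm := hΩ.isClosed.measurableSet
  have hbd : ∀ i, ∃ b, ∀ x ∈ Ω, ‖F x i‖ ≤ b := fun i => hΩ.exists_bound_of_continuousOn (hc i)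
  choose b hb using hbd
  have hFm : ∀ i, AEStronglyMeasurable (Ω.indicator fun x => F x i) := fun i =>
    (aestronglyMeasurable_indicator_iff hm).2 ((hc i).aestronglyMeasurable hm)
  have hFb : ∀ i, ∀ᵐ x, ‖Ω.indicator (fun x => F x i) x‖ ≤ |b i| := fun i =>
    Eventually.of_forall fun x => by
      by_cases hx : x ∈ Ω
      · rw [indicator_of_mem hx]
        exact (hb i x hx).trans (le_abs_self _)
      · rw [indicator_of_notMem hx, norm_zero]
        exact abs_nonneg _
  have h1 : Continuous fun x₀ => ∑ i, ∫ x, v.reg (x - x₀) i * Ω.indicator (fun x => F x i) x :=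
    continuous_finsetSum _ fun i _ =>
      continuous_integral_translate_mul (f := fun x => v.reg x i) (hr i) (hFm i) (hFb i)
  have h2 : ContinuousOn (fun x₀ => F x₀ ⬝ᵥ v.coeff) Ω :=
    continuousOn_finsetSum _ fun i _ => (hc i).mul_const _
  refine (h1.continuousOn.add h2).congr fun x₀ hx₀ => ?_
  unfold DiracField.pairing
  have hp : (v.shift x₀).pole = x₀ := by simp [hv]
  -- The point mass counts fully at every pole in `Ω`, so its contribution is continuous up to the
  -- boundary and leaves no boundary factor.
  rw [hp, if_pos hx₀]
  refine congrArg₂ (fun a b : ℂ => a + b) ?_ rfl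
  beta_reduce
  rw [← integral_finsetSum _ fun i _ => ((hr i).comp_sub_right x₀).mul_bdd (hFm i) (hFb i),
    ← integral_indicator hm]
  refine integral_congr_ae (Eventually.of_forall fun x => ?_)
  by_cases hx : x ∈ Ω
  · simp only [indicator_of_mem hx, dotProduct, DiracField.shift_reg]
    exact Finset.sum_congr rfl fun i _ => mul_comm _ _
  · simp [indicator_of_notMem hx]

lemma norm_dotProduct_le {a b : Fin n → ℂ} {A B : ℝ} (ha : ∀ i, ‖a i‖ ≤ A) (hb : ∀ i, ‖b i‖ ≤ B) :
    ‖a ⬝ᵥ b‖ ≤ n * (A * B) := by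
  have h : ∀ i ∈ Finset.univ, ‖a i * b i‖ ≤ A * B := fun i _ => by
    rw [norm_mul]
    exact mul_le_mul (ha i) (hb i) (norm_nonneg _) ((norm_nonneg _).trans (ha i))
  simpa [dotProduct] using norm_sum_le_of_le _ h

lemma exists_nonneg_bound (t : Fin n → ℝ) : ∃ B, 0 ≤ B ∧ ∀ j, t j ≤ B :=
  ⟨∑ j, |t j|, Finset.sum_nonneg fun _ _ => abs_nonneg _, fun j => (le_abs_self _).trans
    (Finset.single_le_sum (f := fun j => |t j|) (fun _ _ => abs_nonneg _) (Finset.mem_univ j))⟩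

variable {ug : Fin n → DiracField n}

/-- Weakly singular bound of the boundary integrand, uniform in the pole. -/
lemma exists_boundaryIntegrand_le (hug : ∀ k, IsFundamentalSolution M s k (ug k)) {γ : ℝ}
    (hγ : 0 ≤ γ) (hγn : γ < n) (hκ : M.IsWeaklySingular γ) {c : ℝ}
    (hc : ∀ ξ, ‖weightVector M ξ‖ ≤ c) (hW : Integrable (weightVector M))
    (hB : ∀ x ∈ Ω ∪ collar M.α Ω, ∀ i, ‖w x i‖ ≤ B) (k : Fin n) :
    ∃ C : ℝ, 0 < C ∧ ∀ x₀, ∀ x ∈ Ω, x ≠ x₀ → ‖ν x‖ ≤ 1 →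
      ‖boundaryIntegrand M ν w ((ug k).shift x₀) x‖ₑ ≤
        ENNReal.ofReal C * singularMajorant γ (x - x₀) := by
  obtain ⟨b, hb⟩ := exists_norm_T_le hW hB
  obtain ⟨D, hD0, hDreg, hDgrad⟩ := exists_norm_grad_le hug hγ hγn hκ hc k
  obtain ⟨Cs, hCsnn, hCj⟩ := exists_nonneg_bound fun j => ∑ l, ∑ p, ∑ q, |M.C l j p q|
  refine ⟨n * (|b| * D) + n * (Cs * D * |B|) + 1, by positivity, fun x₀ x hx hne hν => ?_⟩
  have hy : x - x₀ ≠ 0 := sub_ne_zero.2 hne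
  set X := 1 + ‖x - x₀‖ ^ (-γ) with hX
  have hX0 : 0 ≤ X := by positivity
  have h1 : ‖M.T ν w x ⬝ᵥ ((ug k).shift x₀).reg x‖ ≤ n * (|b| * (D * X)) :=
    norm_dotProduct_le (fun i => (hb ν x hx hν i).trans (le_abs_self b)) fun i => hDreg _ hy i
  have h2 : ‖((ug k).shift x₀).T M ν x ⬝ᵥ w x‖ ≤ n * (Cs * (D * X) * |B|) := by
    rw [(ug k).T_shift_eq (hug k).pole_eq (integrable_pi_iff.1 (hug k).integrable) hc hW ν hne]
    refine norm_dotProduct_le (fun i => (norm_traction_le M.C hν (hDgrad _ hy) i).trans ?_)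
      fun i => (hB x (Or.inl hx) i).trans (le_abs_self B)
    gcongr
    exact hCj i
  rw [singularMajorant_eq_ofReal hy, ← ENNReal.ofReal_mul (by positivity), ← ofReal_norm]
  refine ENNReal.ofReal_le_ofReal ((norm_sub_le _ _).trans ((add_le_add h1 h2).trans ?_))
  rw [← hX]
  linarith

/-- The boundary integrand is continuous in the pole at points of continuity of the kernels. -/
lemma tendsto_boundaryIntegrand (hug : ∀ k, IsFundamentalSolution M s k (ug k)) {γ : ℝ}
    (hγ : 0 ≤ γ) (hγn : γ < n) (hκ : M.IsWeaklySingular γ) {c : ℝ}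
    (hc : ∀ ξ, ‖weightVector M ξ‖ ≤ c) (hW : Integrable (weightVector M)) (k : Fin n)
    {y : ℕ → Pt n} {y₀ x : Pt n} (hy : Tendsto y atTop (𝓝 y₀)) (hx : x ≠ y₀)
    (hxy : ∀ j, x ≠ y j) (hcκ : ContinuousAt (micromodulus M.α M.Θ 0) (x - y₀))
    (hcW : ContinuousAt (weightVector M) (x - y₀)) :
    Tendsto (fun j => boundaryIntegrand M ν w ((ug k).shift (y j)) x) atTop
      (𝓝 (boundaryIntegrand M ν w ((ug k).shift y₀) x)) := by
  have hne : x - y₀ ≠ 0 := sub_ne_zero.2 hx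
  have hsub : Tendsto (fun j => x - y j) atTop (𝓝 (x - y₀)) := hy.const_sub x
  unfold boundaryIntegrand
  refine Tendsto.sub (tendsto_finsetSum _ fun i _ => Tendsto.const_mul _ ?_)
    (tendsto_finsetSum _ fun i _ => Tendsto.mul_const _ ?_)
  · exact (reg_continuousAt hug hγ hγn hκ k hne hcκ i).tendsto.comp hsub
  · have hT : ∀ {z}, x ≠ z → ((ug k).shift z).T M ν x =
        traction M.C (ν x) ((ug k).grad M (x - z)) := fun hz =>
      (ug k).T_shift_eq (hug k).pole_eq (integrable_pi_iff.1 (hug k).integrable) hc hW ν hz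
    rw [hT hx]
    simp only [fun j => hT (hxy j)]
    exact tendsto_traction M.C (ν x) (fun p q =>
      (grad_continuousAt hug hγ hγn hκ hc hW k hne hcκ hcW p q).tendsto.comp hsub) i

/-- The Somigliana formula with a single integral over the local boundary. -/
def HasSomigliana (M : Material n) (Ω : Set (Pt n)) (ν : Pt n → Pt n)
    (w F : Pt n → Fin n → ℂ) (v : DiracField n) (x : Pt n) (k : Fin n) : Prop :=
  Integrable (boundaryIntegrand M ν w v) (surface Ω) ∧
  IntegrableOn (fun x' => F x' ⬝ᵥ v.reg x') Ω ∧
  w x k = (∫ x', boundaryIntegrand M ν w v x' ∂surface Ω) + v.pairing Ω F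

lemma HasSomigliana.somiglianaFormula (hΩ : IsBody M.α Ω Ωd Ωn ν) {v : DiracField n} {x : Pt n}
    {k : Fin n} (h : HasSomigliana M Ω ν w F v x k) : SomiglianaFormula M Ω Ωd Ωn ν w F v x k :=
  ⟨h.1.integrableOn, h.1.integrableOn, h.2.1, by rw [h.2.2, hΩ.surface_integral_eq h.1]⟩

/-- The Somigliana formula at interior points. -/
theorem hasSomigliana_of_mem_interior (hΩ : IsBody M.α Ω Ωd Ωn ν)
    (hw : ∀ i, AEStronglyMeasurable fun x => w x i)
    (hB : ∀ x ∈ Ω ∪ collar M.α Ω, ∀ i, ‖w x i‖ ≤ B)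
    (hF : ∀ x ∈ Ω, ∀ i, M.force w x i + F x i = M.ρ * s ^ 2 * w x i) {k : Fin n} {v : DiracField n}
    (hv : IsFundamentalSolution M s k v) {x₀ : Pt n} (hx₀ : x₀ ∈ interior Ω)
    (h₁ : Equivalency Ω (collar M.α Ω) (v.shift x₀).reg (M.interaction Ω w) (M.T ν w))
    (h₂ : Equivalency Ω (collar M.α Ω) w ((v.shift x₀).interaction M Ω) ((v.shift x₀).T M ν)) :
    HasSomigliana M Ω ν w F (v.shift x₀) x₀ k := by
  obtain ⟨i1, -, -, e⟩ := hv.reciprocity hΩ.compact.isClosed.measurableSet (collar_measurable hΩ)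
    hw hB hF (interior_subset hx₀)
  have e1 : boundaryIntegrand M ν w (v.shift x₀) = fun x' =>
      (v.shift x₀).reg x' ⬝ᵥ M.T ν w x' - w x' ⬝ᵥ (v.shift x₀).T M ν x' := by
    ext x'
    rw [boundaryIntegrand, dotProduct_comm, dotProduct_comm (w x')]
  refine ⟨e1 ▸ h₁.2.1.sub h₂.2.1, i1, ?_⟩
  rw [e, h₁.2.2, h₂.2.2, e1, integral_sub h₁.2.1 h₂.2.1]

/-- The Somigliana formula extends to boundary points. -/
theorem hasSomigliana_of_mem_frontier (hΩ : IsBody M.α Ω Ωd Ωn ν)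
    (hw : ∀ i, AEStronglyMeasurable fun x => w x i)
    (hB : ∀ x ∈ Ω ∪ collar M.α Ω, ∀ i, ‖w x i‖ ≤ B)
    (hF : ∀ x ∈ Ω, ∀ i, M.force w x i + F x i = M.ρ * s ^ 2 * w x i)
    (hwc : ∀ i, ContinuousOn (fun x => w x i) Ω)
    (hug : ∀ k, IsFundamentalSolution M s k (ug k)) (hreg : IsBoundaryRegular M Ω) {k : Fin n}
    (hint : ∀ x₀ ∈ interior Ω, HasSomigliana M Ω ν w F ((ug k).shift x₀) x₀ k)
    {x : Pt n} (hx : x ∈ frontier Ω) : HasSomigliana M Ω ν w F ((ug k).shift x) x k := by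
  have hxΩ : x ∈ Ω := hΩ.frontier_subset hx
  have hY := hΩ.compact.isClosed.measurableSet.union (collar_measurable hΩ)
  obtain ⟨i1, -⟩ := (hug k).reciprocity hΩ.compact.isClosed.measurableSet (collar_measurable hΩ)
    hw hB hF hxΩ
  have h2n := hreg.two_le
  obtain ⟨ca, hca⟩ := hreg.ahlfors
  obtain ⟨cκ, γ, hγ, hγ1, hκ'⟩ := hreg.weakly_singular
  obtain ⟨cW, hcW⟩ := hreg.weight_bounded
  have hγn : γ < n := by linarith
  have hγd : γ < ((n - 1 : ℕ) : ℝ) := by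
    rw [Nat.cast_sub (by omega)]
    simpa using hγ1
  have hκ : M.IsWeaklySingular γ := ⟨cκ, hκ'⟩
  have : IsFiniteMeasure (surface Ω) := surface_isFiniteMeasure hΩ.compact hca
  -- Interior poles approach the boundary point; this is where `Ω` must be the closure of its
  -- interior.
  obtain ⟨y, hyint, hy⟩ := mem_closure_iff_seq_limit.1 (hreg.regular_closed hxΩ)
  obtain ⟨C, hC, hCle⟩ := exists_boundaryIntegrand_le (ν := ν) hug hγ hγn hκ hcW
    hreg.weight_integrable hB k
  have hfr : ∀ᵐ x' ∂surface Ω, x' ∈ frontier Ω :=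
    ae_restrict_mem isClosed_frontier.measurableSet
  have hne : ∀ᵐ x' ∂surface Ω, x' ≠ x :=
    compl_mem_ae_iff.2 (surface_singleton (by omega) hca x)
  -- Interior poles never lie on the frontier, so every approximating integrand is evaluated off its
  -- pole.
  have hney : ∀ x' ∈ frontier Ω, ∀ j, x' ≠ y j := by
    rintro x' hx' j rfl
    exact hx'.2 (hyint j)
  obtain ⟨hI, hlim⟩ := tendsto_integral_of_singular_bound hγ hγd hca hC
    (f := fun j => boundaryIntegrand M ν w ((ug k).shift (y j)))
    (f₀ := boundaryIntegrand M ν w ((ug k).shift x)) (y := y) (y₀ := x)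
    (fun j => (hint (y j) (hyint j)).1.aestronglyMeasurable)
    (fun j => by
      filter_upwards [hfr, hΩ.normal] with x' h1 h2
      exact hCle (y j) x' (hΩ.frontier_subset h1) (hney x' h1 j) h2.1.le)
    (by
      filter_upwards [hfr, hΩ.normal, hne] with x' h1 h2 h3
      exact hCle x x' (hΩ.frontier_subset h1) h3 h2.1.le)
    (by
      filter_upwards [hfr, hne, hreg.continuous_micromodulus x hx, hreg.continuous_weight x hx]
        with x' h1 h2 h3 h4
      exact tendsto_boundaryIntegrand hug hγ hγn hκ hcW hreg.weight_integrable k hy h2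
        (hney x' h1) h3 h4)
  refine ⟨hI, i1, ?_⟩
  have hyΩ : Tendsto y atTop (𝓝[Ω] x) := tendsto_nhdsWithin_iff.2
    ⟨hy, Eventually.of_forall fun j => interior_subset (hyint j)⟩
  have hpair := (pairing_continuousOn hΩ.compact
    (continuousOn_of_force_eq hY hw hB hF hwc) (hug k).pole_eq
    (integrable_pi_iff.1 (hug k).integrable) x hxΩ).tendsto.comp hyΩ
  have hwlim := (hwc k x hxΩ).tendsto.comp hyΩ
  -- Both sides of the interior formula converge along `y`; the limits are the two sides at the
  -- boundary point.
  refine tendsto_nhds_unique hwlim ((hlim.add hpair).congr fun j => ?_)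
  exact (hint (y j) (hyint j)).2.2.symm

lemma HasSomigliana.boundaryIntegralEquation (hΩ : IsBody M.α Ω Ωd Ωn ν) {v : DiracField n}
    {x : Pt n} {k : Fin n} (hx : surface Ω {x} = 0) (h : HasSomigliana M Ω ν w F v x k) :
    BoundaryIntegralEquation M Ω Ωd Ωn ν w F v x k := by
  obtain ⟨h1, h2, h3, h4⟩ := h.somiglianaFormula hΩ
  have hm : ∀ A : Set (Pt n), MeasurableSet (localBoundary Ω A) := fun A =>
    (isClosed_closure.inter hΩ.compact.isClosed).measurableSet
  exact ⟨h3, _, _, hasPV_of_integrableOn (hm Ωd) h1 hx, hasPV_of_integrableOn (hm Ωn) h2 hx, h4⟩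

end Boundary

end Peridynamics

end

/-! ### Assembly of the three claims. -/

open Peridynamics
theorem mainTheorem3 {n : ℕ} (M : Material n)
    -- the body, the parts of its volume-constrained boundary, and its outer unit normal
    (Ω Ωd Ωn : Set (Pt n)) (ν : Pt n → Pt n) (hΩ : IsBody M.α Ω Ωd Ωn ν)
    -- the motion: displacement, velocity, body force, volume constraints, initial data
    (u v b gd gn : Pt n → ℝ → Fin n → ℝ) (u₀ v₀ : Pt n → Fin n → ℝ)
    (hu : IsMotion M Ω Ωd Ωn u v b gd gn u₀ v₀)
    (hu_meas : Measurable fun p : Pt n × ℝ => u p.1 p.2)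
    -- the Laplace parameter, and convergence of the Laplace transforms
    (s : ℂ) (hs : 0 < s.re)
    (hu_exp : ∃ K σ : ℝ, σ < s.re ∧
      ∀ x ∈ Ω ∪ collar M.α Ω, ∀ t, 0 ≤ t → ‖u x t‖ ≤ K * Real.exp (σ * t))
    (hb_int : ∀ x ∈ Ω, IntegrableOn (fun t : ℝ => Real.exp (-(s.re * t)) • b x t) (Ioi 0))
    -- the Laplace-domain fundamental solutions
    (ug : Fin n → DiracField n) (hug : ∀ k, IsFundamentalSolution M s k (ug k))
    -- the equivalency condition for the possible displacement `ug` and the actual state `ũ`,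
    -- and for the possible displacement `ũ` and the actual state `ug`
    (heq_u : ∀ x₀ ∈ interior Ω, ∀ k, Equivalency Ω (collar M.α Ω)
      ((ug k).shift x₀).reg (M.interaction Ω (laplace u s)) (M.T ν (laplace u s)))
    (heq_g : ∀ x₀ ∈ interior Ω, ∀ k, Equivalency Ω (collar M.α Ω)
      (laplace u s) (((ug k).shift x₀).interaction M Ω) (((ug k).shift x₀).T M ν)) :
    -- the Laplace-transformed equation of motion, with the effective body force
    (∀ x ∈ Ω, ∀ i, M.force (laplace u s) x i + effectiveForce M.ρ b u₀ v₀ s x i =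
      M.ρ * s ^ 2 * laplace u s x i) ∧
    -- the Somigliana formula at interior points
    (∀ x ∈ interior Ω, ∀ k, SomiglianaFormula M Ω Ωd Ωn ν
      (laplace u s) (effectiveForce M.ρ b u₀ v₀ s) ((ug k).shift x) x k) ∧
    -- the boundary integral equation, and the Somigliana formula at boundary points
    (IsBoundaryRegular M Ω → (∀ t, 0 ≤ t → ContinuousOn (fun x => u x t) Ω) →
      ∀ x ∈ frontier Ω, ∀ k,
        BoundaryIntegralEquation M Ω Ωd Ωn ν
          (laplace u s) (effectiveForce M.ρ b u₀ v₀ s) ((ug k).shift x) x k ∧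
        SomiglianaFormula M Ω Ωd Ωn ν
          (laplace u s) (effectiveForce M.ρ b u₀ v₀ s) ((ug k).shift x) x k) := by
  obtain ⟨K, σ, hσ, hK⟩ := hu_exp
  have hF := fun (x : Pt n) (hx : x ∈ Ω) (i : Fin n) =>
    laplace_motion hu hu_meas hσ hK hb_int hx i
  have hw : ∀ i, AEStronglyMeasurable fun x => laplace u s x i := fun i =>
    (laplace_measurable hu_meas s i).aestronglyMeasurable
  have hB := fun (x : Pt n) (hx : x ∈ Ω ∪ collar M.α Ω) (i : Fin n) =>
    norm_laplace_le hσ (hK x hx) i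
  have hint : ∀ x₀ ∈ interior Ω, ∀ k, HasSomigliana M Ω ν (laplace u s)
      (effectiveForce M.ρ b u₀ v₀ s) ((ug k).shift x₀) x₀ k := fun x₀ hx₀ k =>
    hasSomigliana_of_mem_interior hΩ hw hB hF (hug k) hx₀ (heq_u x₀ hx₀ k) (heq_g x₀ hx₀ k)
  refine ⟨hF, fun x hx k => (hint x hx k).somiglianaFormula hΩ, fun hreg hcont x hx k => ?_⟩
  have hwc := laplace_continuousOn hu_meas hσ (fun x hx => hK x (Or.inl hx)) hcont
  have h := hasSomigliana_of_mem_frontier hΩ hw hB hF hwc hug hreg (fun x₀ hx₀ => hint x₀ hx₀ k) hx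
  obtain ⟨c, hc⟩ := hreg.ahlfors
  have h2 := hreg.two_le
  -- The boundary integrals converge absolutely and single points are surface-null, so the principal
  -- values equal the ordinary integrals.
  exact ⟨h.boundaryIntegralEquation hΩ (surface_singleton (by omega) hc x),
    h.somiglianaFormula hΩ⟩
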